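/- Fix $B>1$ and a window $b:\mathbb R\to\mathbb R$ that is $C^\infty$ on $(0,\infty)$, vanishes outside $[B^{-1},B]$ and satisfies $\sum_{j\ge 0}b^2(l/B^j)=1$ for every integer $l>B$. Let $\{Y_{lm}\}$ be a real orthonormal basis of spherical harmonics of $L^2(\mathbb S^2)$ ($l\ge 0$, $2l+1$ values of $m$). For every $j\ge 0$ let $\xi_{jk}\in\mathbb S^2$, $\lambda_{jk}>0$ ($k=1,\dots,N_j$) be cubature points and weights, such that $\sum_k\lambda_{jk}p(\xi_{jk})=\int_{\mathbb S^2}p\,dx$ for all polynomials $p$ of degree at most $2\lfloor B^{j+1}\rfloor$, and such that, for constants $c_1,c_2,c_1',c_2'>0$ and all $j,k$, $c_1B^{-2j}\le\lambda_{jk}\le c_2B^{-2j}$ and $c_1'B^{2j}\le N_j\le c_2'B^{2j}$. The needlets are $$\psi_{jk}(x)=\sqrt{\lambda_{jk}}\sum_l b\Big(\frac l{B^j}\Big)\sum_m Y_{lm}(x)Y_{lm}(\xi_{jk}).$$ Let $T$ be a jointly measurable, zero-mean, Gaussian random field on $\mathbb S^2$ that is isotropic, i.e. for every $g\in SO(3)$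 the processes $T(g\,\cdot)$ and $T(\cdot)$ have the same law. Put $a_{lm}=\int_{\mathbb S^2}T\,Y_{lm}\,dx$ and let $C_l=\mathbb E(a_{lm}^2)$ be its angular power spectrum. Assume that $C_l=l^{-\alpha_0}G(l)$ for all $l\ge1$, where $\alpha_0>2$; $G$ is $C^\infty$ on $(0,\infty)$; $c_0^{-1}\le G(l)\le c_0$ for some $c_0>0$ and all integers $l\ge1$; for every $r\in\mathbb N$ there is $c_r>0$ with $|G^{(r)}(u)|\le c_ru^{-r}$ for all $u>0$; and $G(l)=G_0(1+O(l^{-1}))$ as $l\to\infty$, with $G_0>0$. Let $A=[a_1,a_2]$ with $2<a_1<a_2<\infty$ and $\Gamma=[\gamma_1,\gamma_2]$ with $0<\gamma_1<\gamma_2<\infty$ be such that $\alpha_0\in A$ and $G_0\in\Gamma$. Put $\beta_{jk}=\int_{\mathbb S^2}\psi_{jk}T\,dx$, $K_j(\alpha)=N_j^{-1}\sum_lb^2(l/B^j)(2l+1)l^{-\alpha}$, and $$\mathcal R_J(G,\alpha)=\sum_{j=1}^J\Big[\frac{\sum_k\beta_{jk}^2}{GK_j(\alpha)}-\sum_k\log\frac{\beta_{jk}^2}{GK_j(\alpha)}\Big],\qquad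 \widehat G_J(\alpha)=\frac1{\sum_{j=1}^JN_j}\sum_{j=1}^J\frac{\sum_k\beta_{jk}^2}{K_j(\alpha)},$$ $$R_J(\alpha)=\log\sum_{j=1}^J\frac{\sum_k\beta_{jk}^2}{K_j(\alpha)}+\frac1{\sum_{j=1}^JN_j}\sum_{j=1}^JN_j\log K_j(\alpha),$$ where, for the finitely many levels $j$ (if any) at which $b(l/B^j)=0$ for all integers $l$, so that all $\psi_{jk}$ and $K_j$ vanish, the $j$-th terms of the sums involving $K_j$ are read as $0$. Then the needlet Whittle estimator is consistent, in both of its forms: (i) if, for every $J\ge1$, almost surely $(\widehat\alpha_J,\widehat G_J)\in A\times\Gamma$ minimizes $\mathcal R_J(G,\alpha)$ over $\alpha\in A$, $G\in\Gamma$, then $(\widehat\alpha_J,\widehat G_J)\to(\alpha_0,G_0)$ in probability as $J\to\infty$; (ii) if, for every $J\ge1$, almost surely $\widehat\alpha_J\in A$ minimizes $R_J(\alpha)$ over $\alpha\in A$, then $(\widehat\alpha_J,\widehat G_J(\widehat\alpha_J))\to(\alpha_0,G_0)$ in probability as $J\to\infty$. -/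

import Mathlib

open MeasureTheory ProbabilityTheory Filter Set
open scoped Topology

noncomputable section

namespace Needlet

/-- Euclidean three-space. -/
abbrev E3 : Type := EuclideanSpace ℝ (Fin 3)

/-- The unit sphere `S²` in `ℝ³`. -/
abbrev S2 : Type := Metric.sphere (0 : E3) 1

/-- The surface measure of `S²` (total mass `4π`). -/
def surf : Measure S2 := (volume : Measure E3).toSphere

/-- The action of a linear isometry of `ℝ³` on the unit sphere. -/
def rotate (g : E3 ≃ₗᵢ[ℝ] E3) (x : S2) : S2 :=
  ⟨g x.1, by simp⟩

/-- The polynomial function on `ℝ³` given by a polynomial in three variables. -/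
def polyFun (p : MvPolynomial (Fin 3) ℝ) (v : E3) : ℝ :=
  MvPolynomial.eval (fun i => v i) p

/-- `f` is a (real) spherical harmonic of degree `l`: the restriction to `S²` of a harmonic
homogeneous polynomial of degree `l`. -/
def IsSphericalHarmonic (l : ℕ) (f : S2 → ℝ) : Prop :=
  ∃ p : MvPolynomial (Fin 3) ℝ, p.IsHomogeneous l ∧
    (∀ v : E3, Laplacian.laplacian (polyFun p) v = 0) ∧ ∀ x : S2, f x = polyFun p x.1

/-- `Y l m` (`l ≥ 0`, with `2 l + 1` values of `m`) is an orthonormal basis of `L²(S²)` made of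
real spherical harmonics: the family is orthonormal and, for each `l`, the functions `Y l m` span
the space of spherical harmonics of degree `l`. -/
structure IsHarmonicBasis (Y : (l : ℕ) → Fin (2 * l + 1) → S2 → ℝ) : Prop where
  harmonic : ∀ l m, IsSphericalHarmonic l (Y l m)
  orthonormal : ∀ l m l' m', ∫ x, Y l m x * Y l' m' x ∂surf =
    if (⟨l, m⟩ : (l : ℕ) × Fin (2 * l + 1)) = ⟨l', m'⟩ then 1 else 0
  span : ∀ l f, IsSphericalHarmonic l f → f ∈ Submodule.span ℝ (Set.range (Y l))

/-- The needlet window `b` with bandwidth parameter `B > 1`: smooth on `(0, ∞)`, supported in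
`[B⁻¹, B]`, with the partition of unity property at every integer `l > B`. -/
structure IsWindow (B : ℝ) (b : ℝ → ℝ) : Prop where
  smooth : ContDiffOn ℝ (⊤ : ℕ∞) b (Ioi 0)
  support : Function.support b ⊆ Icc B⁻¹ B
  partition : ∀ l : ℕ, B < l → ∑' j : ℕ, b (l / B ^ j) ^ 2 = 1

/-- Cubature points `ξ j k` and weights `w j k`, `k = 1, …, N j`, on the sphere at every resolution
level `j`: the weights are positive, the cubature formula at level `j` integrates exactly all
polynomials of degree at most `2 ⌊B ^ (j + 1)⌋`, and `w j k ≈ B ^ (-2 j)`, `N j ≈ B ^ (2 j)`. -/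
structure Cubature (B : ℝ) where
  N : ℕ → ℕ
  ξ : (j : ℕ) → Fin (N j) → S2
  w : (j : ℕ) → Fin (N j) → ℝ
  w_pos : ∀ j k, 0 < w j k
  exact : ∀ (j : ℕ) (p : MvPolynomial (Fin 3) ℝ), p.totalDegree ≤ 2 * ⌊B ^ (j + 1)⌋₊ →
    ∑ k, w j k * polyFun p (ξ j k).1 = ∫ x : S2, polyFun p x.1 ∂surf
  w_size : ∃ c₁ c₂ : ℝ, 0 < c₁ ∧ 0 < c₂ ∧
    ∀ j k, c₁ / B ^ (2 * j) ≤ w j k ∧ w j k ≤ c₂ / B ^ (2 * j)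
  N_size : ∃ c₁ c₂ : ℝ, 0 < c₁ ∧ 0 < c₂ ∧
    ∀ j, c₁ * B ^ (2 * j) ≤ (N j : ℝ) ∧ (N j : ℝ) ≤ c₂ * B ^ (2 * j)

/-- The multipoles `l` that can have `b (l / B ^ j) ≠ 0`, that is, `l ≤ B ^ (j + 1)`. -/
def band (B : ℝ) (j : ℕ) : Finset ℕ := Finset.range (⌊B ^ (j + 1)⌋₊ + 1)

/-- The spherical needlet `ψ_{jk}`. -/
def needlet {B : ℝ} (b : ℝ → ℝ) (Y : (l : ℕ) → Fin (2 * l + 1) → S2 → ℝ) (X : Cubature B)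
    (j : ℕ) (k : Fin (X.N j)) (x : S2) : ℝ :=
  √(X.w j k) * ∑ l ∈ band B j, b (l / B ^ j) * ∑ m, Y l m x * Y l m (X.ξ j k)

/-- A jointly measurable, centred, Gaussian and isotropic random field on the sphere. Isotropy:
for every rotation `g`, the processes `x ↦ T (g x)` and `x ↦ T x` have the same law. -/
structure IsIsotropicGaussianField {Ω : Type*} [MeasurableSpace Ω] (P : Measure Ω)
    (T : S2 → Ω → ℝ) : Prop where
  measurable : Measurable (Function.uncurry T)
  gaussian : IsGaussianProcess T P
  centred : ∀ x, ∫ ω, T x ω ∂P = 0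
  isotropic : ∀ g : E3 ≃ₗᵢ[ℝ] E3, LinearMap.det (g.toLinearEquiv : E3 →ₗ[ℝ] E3) = 1 →
    IdentDistrib (fun ω x => T (rotate g x) ω) (fun ω x => T x ω) P P

/-- The spherical harmonic coefficient `a_{lm}` of the field. -/
def harmonicCoeff {Ω : Type*} (Y : (l : ℕ) → Fin (2 * l + 1) → S2 → ℝ) (T : S2 → Ω → ℝ)
    (l : ℕ) (m : Fin (2 * l + 1)) (ω : Ω) : ℝ :=
  ∫ x, T x ω * Y l m x ∂surf

/-- `C` is the angular power spectrum of `T`: `C l = E (a_{lm}²)` for all `l` and `m`. -/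
def HasAngularPowerSpectrum {Ω : Type*} [MeasurableSpace Ω] (P : Measure Ω)
    (Y : (l : ℕ) → Fin (2 * l + 1) → S2 → ℝ) (T : S2 → Ω → ℝ) (C : ℕ → ℝ) : Prop :=
  ∀ l m, ∫ ω, harmonicCoeff Y T l m ω ^ 2 ∂P = C l

/-- The regularity condition on the spectrum: `C l = l ^ (-α₀) G(l)`, `α₀ > 2`, with `G` smooth on
`(0, ∞)`, bounded above and away from zero at the integers, with symbol-type bounds on all its
derivatives, and `G(l) = G₀ (1 + O(1 / l))` with `G₀ > 0`. -/
structure IsRegularSpectrum (C : ℕ → ℝ) (α₀ G₀ : ℝ) (G : ℝ → ℝ) : Prop where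
  two_lt : 2 < α₀
  G₀_pos : 0 < G₀
  spectrum : ∀ l : ℕ, 1 ≤ l → C l = (l : ℝ) ^ (-α₀) * G l
  bounded : ∃ c₀ : ℝ, 0 < c₀ ∧ ∀ l : ℕ, 1 ≤ l → c₀⁻¹ ≤ G l ∧ G l ≤ c₀
  smooth : ContDiffOn ℝ (⊤ : ℕ∞) G (Ioi 0)
  deriv_bound : ∀ r : ℕ, ∃ c : ℝ, 0 < c ∧ ∀ u : ℝ, 0 < u → |iteratedDeriv r G u| ≤ c / u ^ r
  expansion : (fun l : ℕ => G l / G₀ - 1) =O[atTop] fun l : ℕ => (l : ℝ)⁻¹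

/-- The needlet coefficient `β_{jk} = ⟨T, ψ_{jk}⟩`. -/
def needletCoeff {Ω : Type*} {B : ℝ} (b : ℝ → ℝ) (Y : (l : ℕ) → Fin (2 * l + 1) → S2 → ℝ)
    (X : Cubature B) (T : S2 → Ω → ℝ) (j : ℕ) (k : Fin (X.N j)) (ω : Ω) : ℝ :=
  ∫ x, needlet b Y X j k x * T x ω ∂surf

/-- The function `K_j(α) = N_j⁻¹ ∑_l b²(l / B^j) (2 l + 1) l ^ (-α)`. -/
def K {B : ℝ} (b : ℝ → ℝ) (X : Cubature B) (j : ℕ) (α : ℝ) : ℝ :=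
  (X.N j : ℝ)⁻¹ * ∑ l ∈ band B j, b (l / B ^ j) ^ 2 * (2 * l + 1) * (l : ℝ) ^ (-α)

/-- The needlet Whittle objective function (minus twice the log pseudo-likelihood) of a family of
coefficients `β`, at resolution levels `1, …, J`. -/
def objective {B : ℝ} (b : ℝ → ℝ) (X : Cubature B) (β : (j : ℕ) → Fin (X.N j) → ℝ) (J : ℕ)
    (α G : ℝ) : ℝ :=
  ∑ j ∈ Finset.Icc 1 J, ((∑ k, β j k ^ 2) / (G * K b X j α) -
    ∑ k, Real.log (β j k ^ 2 / (G * K b X j α)))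

/-- The total number `∑_{j=1}^J N_j` of coefficients. -/
def total {B : ℝ} (X : Cubature B) (J : ℕ) : ℝ := ∑ j ∈ Finset.Icc 1 J, (X.N j : ℝ)

/-- The profile estimate `Ĝ(α)`. -/
def profileG {B : ℝ} (b : ℝ → ℝ) (X : Cubature B) (β : (j : ℕ) → Fin (X.N j) → ℝ) (J : ℕ)
    (α : ℝ) : ℝ :=
  (total X J)⁻¹ * ∑ j ∈ Finset.Icc 1 J, (∑ k, β j k ^ 2) / K b X j α

/-- The concentrated objective function `R_J(α)`. -/
def concentrated {B : ℝ} (b : ℝ → ℝ) (X : Cubature B) (β : (j : ℕ) → Fin (X.N j) → ℝ) (J : ℕ)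
    (α : ℝ) : ℝ :=
  Real.log (∑ j ∈ Finset.Icc 1 J, (∑ k, β j k ^ 2) / K b X j α) +
    (total X J)⁻¹ * ∑ j ∈ Finset.Icc 1 J, (X.N j : ℝ) * Real.log (K b X j α)

end Needlet

end

/-!
The needlet coefficients enter the profile estimate and the concentrated objective function only
through the energies `S_j = ∑_k β_{jk}²`, and by the cubature formula and orthonormality
(`IsHarmonicBasis.sum_needletCoeff_sq`) these do not depend on the cubature:
`S_j = ∑_l b²(l / B^j) ∑_m a_{lm}²`. In the two-parameter objective function, the terms
`log β_{jk}²` depend on neither parameter and cancel in comparisons; almost surely no coefficient at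
an active level vanishes (`IsIsotropicGaussianField.ae_needletCoeff_ne_zero`).

*Concentration.* The covariance `E T_l(x) T_l'(y)` of two components of the field is rotation
invariant, and half-turns exchange any two points, so it is symmetric in `x` and `y`; being a
harmonic of degree `l` and of degree `l'` in the same variable, it vanishes for `l ≠ l'`. All
functionals `∫ T f` are Gaussian, as they lie in the `L²`-closure of the span of the `T(x)`
(`IsIsotropicGaussianField.hasLaw_pairing`). Uncorrelated coefficients of different degrees thus
have uncorrelated squares, and a Cauchy-Schwarz bound inside each degree suffices for
`Var S_j ≤ 3 ∑_l b⁴(l / B^j) (2 l + 1)² C_l²`. As a band holds of the order of `B^j` degrees, the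
normalized energies `W_j = S_j / (N_j K_j(α₀))` satisfy `E (W_j - G₀)² = O(B^{-j})`
(`IsIsotropicGaussianField.exists_integral_normEnergy_sub_sq_le`).

*Separation.* With shares `p_j = N_j / ∑_{i ≤ J} N_i` and log-ratios
`x_j = log (K_j(α₀) / K_j(α))`, the profile estimate is `Ĝ_J(α) = ∑_j p_j exp(x_j) W_j`, and
`R_J(α) - R_J(α₀) = log (Ĝ_J(α) exp(-∑_j p_j x_j)) - log Ĝ_J(α₀)`. Jensen's inequality
says that this is nearly nonnegative when `W_j ≈ G₀`. Since `x_j` is within `|α - α₀| log B` of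
`j (α - α₀) log B`, and the levels `J` and `J - 3` both keep a fixed share, the inequality is strict
with a gain of the order of `(α - α₀)²` (`exists_le_fitted_mul_exp`). The levels `j ≤ J / 2`, at
which `W_j` need not be close to `G₀`, have an exponentially small share.

*Conclusion.* The fluctuations of the remaining `W_j` are exponentially small in `J`, in
probability, so every minimizer satisfies `J |α̂ - α₀| → 0`. Then `exp(x_j)` is uniformly close to
`1` for `j ≤ J`, so that `Ĝ_J(α̂) → G₀` (`exists_forall_close`). In the two-parameter form,
minimality moreover bounds `v - 1 - log v` for `v = Ĝ_J(α̂) / Ĝ`, which forces `v → 1`.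
-/

namespace Needlet

/-! ### Spherical harmonics and rotations -/

instance : IsFiniteMeasure surf := by unfold surf; infer_instance

lemma continuous_rotate (g : E3 ≃ₗᵢ[ℝ] E3) : Continuous (rotate g) :=
  (g.continuous.comp continuous_subtype_val).subtype_mk _

lemma rotate_symm_apply (g : E3 ≃ₗᵢ[ℝ] E3) (x : S2) : rotate g (rotate g.symm x) = x :=
  Subtype.ext (by simp [rotate])

lemma rotate_apply_symm (g : E3 ≃ₗᵢ[ℝ] E3) (x : S2) : rotate g.symm (rotate g x) = x :=
  Subtype.ext (by simp [rotate])

open scoped Pointwise in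
/-- The surface measure is invariant under linear isometries, because Lebesgue measure is. -/
lemma measurePreserving_rotate (g : E3 ≃ₗᵢ[ℝ] E3) : MeasurePreserving (rotate g) surf surf := by
  refine ⟨(continuous_rotate g).measurable, ?_⟩
  ext s hs
  rw [Measure.map_apply (continuous_rotate g).measurable hs, surf,
    Measure.toSphere_apply' _ ((continuous_rotate g).measurable hs), Measure.toSphere_apply' _ hs]
  congr 1
  have hpre : (Ioo (0 : ℝ) 1 • (Subtype.val '' (rotate g ⁻¹' s)) : Set E3)
      = g ⁻¹' (Ioo (0 : ℝ) 1 • (Subtype.val '' s)) := by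
    ext v
    simp only [Set.mem_smul, mem_image, mem_preimage]
    constructor
    · rintro ⟨r, hr, -, ⟨x, hx, rfl⟩, rfl⟩
      exact ⟨r, hr, _, ⟨_, hx, rfl⟩, by simp [rotate]⟩
    · rintro ⟨r, hr, -, ⟨x, hx, rfl⟩, h⟩
      refine ⟨r, hr, _, ⟨rotate g.symm x, by rwa [rotate_symm_apply], rfl⟩, ?_⟩
      rw [← g.symm_apply_apply v, ← h]
      simp [rotate]
  rw [hpre]
  have hemb : MeasurableEmbedding g := g.toHomeomorph.measurableEmbedding
  exact (LinearIsometryEquiv.measurePreserving g).measure_preimage_emb hemb _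

lemma integral_comp_rotate (g : E3 ≃ₗᵢ[ℝ] E3) (f : S2 → ℝ) :
    ∫ x, f (rotate g x) ∂surf = ∫ x, f x ∂surf := by
  let e : S2 ≃ₜ S2 :=
    { toFun := rotate g
      invFun := rotate g.symm
      left_inv := rotate_apply_symm g
      right_inv := rotate_symm_apply g
      continuous_toFun := continuous_rotate g
      continuous_invFun := continuous_rotate g.symm }
  exact (measurePreserving_rotate g).integral_comp e.measurableEmbedding f

lemma contDiff_polyFun (p : MvPolynomial (Fin 3) ℝ) : ContDiff ℝ 2 (polyFun p) := by
  unfold polyFun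
  induction p using MvPolynomial.induction_on with
  | C a => simpa using contDiff_const
  | add p q hp hq => simpa using hp.add hq
  | mul_X p i hp =>
    simp only [map_mul, MvPolynomial.eval_X]
    exact hp.mul (EuclideanSpace.proj (𝕜 := ℝ) i).contDiff

/-- A linear isometry carries spherical harmonics of degree `l` to spherical harmonics of
degree `l`. -/
lemma IsSphericalHarmonic.comp_rotate {l : ℕ} {f : S2 → ℝ} (hf : IsSphericalHarmonic l f)
    (g : E3 ≃ₗᵢ[ℝ] E3) : IsSphericalHarmonic l (fun x => f (rotate g x)) := by
  obtain ⟨p, hp, hlap, hfp⟩ := hf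
  let bas := EuclideanSpace.basisFun (Fin 3) ℝ
  let φ : Fin 3 → MvPolynomial (Fin 3) ℝ := fun i =>
    ∑ j, MvPolynomial.C (g (bas j) i) * MvPolynomial.X j
  have hpoly : polyFun (MvPolynomial.aeval φ p) = polyFun p ∘ g := by
    ext v
    have hv : ∀ i, MvPolynomial.eval (fun i => v i) (φ i) = g v i := by
      intro i
      have : g v = ∑ j, v j • g (bas j) := by
        conv_lhs => rw [← bas.sum_repr v]
        simp [bas, map_sum]
      rw [this]
      simp [φ, mul_comm]
    simp only [polyFun, Function.comp]
    rw [← funext hv]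
    clear hp hlap hfp
    induction p using MvPolynomial.induction_on with
    | C a => simp
    | add p q hp hq => simp_all
    | mul_X p i hp => simp_all
  refine ⟨MvPolynomial.aeval φ p, ?_, ?_, ?_⟩
  · have h := hp.aeval (n := 1) φ (fun i => ?_)
    · simpa using h
    · exact MvPolynomial.IsHomogeneous.sum _ _ _ fun j _ =>
        (MvPolynomial.isHomogeneous_X _ j).C_mul _
  · intro v
    rw [hpoly, InnerProductSpace.laplacian_eq_iteratedFDeriv_orthonormalBasis _ bas]
    have h2 := hlap (g v)
    rw [InnerProductSpace.laplacian_eq_iteratedFDeriv_orthonormalBasis _ (bas.map g)] at h2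
    rw [← h2]
    refine Finset.sum_congr rfl fun i _ => ?_
    have := ContinuousLinearMap.iteratedFDeriv_comp_right
      (g.toContinuousLinearEquiv : E3 →L[ℝ] E3) (contDiff_polyFun p) v (i := 2) le_rfl
    have h3 := congrArg (fun M => M ![bas i, bas i]) this
    simp only [ContinuousMultilinearMap.compContinuousLinearMap_apply] at h3
    refine h3.trans ?_
    congr 1
    ext k
    fin_cases k <;> simp
  · intro x
    rw [hpoly]
    exact hfp _

lemma IsSphericalHarmonic.continuous {l : ℕ} {f : S2 → ℝ} (hf : IsSphericalHarmonic l f) :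
    Continuous f := by
  obtain ⟨p, -, -, hfp⟩ := hf
  rw [funext hfp]
  exact (contDiff_polyFun p).continuous.comp continuous_subtype_val

lemma integrable_of_continuous {f : S2 → ℝ} (hf : Continuous f) : Integrable f surf :=
  hf.integrable_of_hasCompactSupport (HasCompactSupport.of_compactSpace f)

lemma exists_bound_of_continuous {f : S2 → ℝ} (hf : Continuous f) : ∃ c, ∀ x, |f x| ≤ c := by
  obtain ⟨c, hc⟩ := isCompact_univ.exists_bound_of_continuousOn hf.continuousOn
  exact ⟨c, fun x => hc x (mem_univ x)⟩

section HarmonicBasis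

variable {Y : (l : ℕ) → Fin (2 * l + 1) → S2 → ℝ}

lemma IsHarmonicBasis.continuous (hY : IsHarmonicBasis Y) (l : ℕ) (m) : Continuous (Y l m) :=
  (hY.harmonic l m).continuous

lemma IsHarmonicBasis.integral_sum_mul (hY : IsHarmonicBasis Y) (l : ℕ)
    (c : Fin (2 * l + 1) → ℝ) (l' : ℕ) (m' : Fin (2 * l' + 1)) :
    ∫ x, (∑ m, c m * Y l m x) * Y l' m' x ∂surf =
      ∑ m, c m * if (⟨l, m⟩ : (l : ℕ) × Fin (2 * l + 1)) = ⟨l', m'⟩ then 1 else 0 := by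
  simp_rw [Finset.sum_mul, mul_assoc]
  rw [integral_finsetSum]
  · refine Finset.sum_congr rfl fun m _ => ?_
    rw [integral_const_mul, hY.orthonormal]
  · intro m _
    exact (integrable_of_continuous ((hY.continuous l m).mul (hY.continuous l' m'))).const_mul _

lemma IsHarmonicBasis.integral_sum_mul_self (hY : IsHarmonicBasis Y) (l : ℕ)
    (c : Fin (2 * l + 1) → ℝ) (m' : Fin (2 * l + 1)) :
    ∫ x, (∑ m, c m * Y l m x) * Y l m' x ∂surf = c m' := by
  rw [hY.integral_sum_mul]
  simp

lemma IsHarmonicBasis.integral_sum_mul_of_ne (hY : IsHarmonicBasis Y) {l l' : ℕ} (h : l ≠ l')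
    (c : Fin (2 * l + 1) → ℝ) (m' : Fin (2 * l' + 1)) :
    ∫ x, (∑ m, c m * Y l m x) * Y l' m' x ∂surf = 0 := by
  rw [hY.integral_sum_mul]
  refine Finset.sum_eq_zero fun m _ => ?_
  rw [if_neg, mul_zero]
  intro h'
  exact h (congrArg Sigma.fst h')

/-- A linear isometry acts on the harmonics of degree `l` through an orthogonal matrix. -/
lemma IsHarmonicBasis.exists_rotation_matrix (hY : IsHarmonicBasis Y) (l : ℕ)
    (g : E3 ≃ₗᵢ[ℝ] E3) : ∃ R : Matrix (Fin (2 * l + 1)) (Fin (2 * l + 1)) ℝ,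
      (∀ m x, Y l m (rotate g x) = ∑ m', R m m' * Y l m' x) ∧ R.transpose * R = 1 := by
  have h : ∀ m, ∃ c : Fin (2 * l + 1) → ℝ, ∀ x, Y l m (rotate g x) = ∑ m', c m' * Y l m' x := by
    intro m
    have h1 := hY.span l _ ((hY.harmonic l m).comp_rotate g)
    rw [Submodule.mem_span_range_iff_exists_fun] at h1
    obtain ⟨c, hc⟩ := h1
    refine ⟨c, fun x => ?_⟩
    rw [← congrFun hc x]
    simp
  choose c hR using h
  let R : Matrix (Fin (2 * l + 1)) (Fin (2 * l + 1)) ℝ := Matrix.of c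
  change ∀ m x, Y l m (rotate g x) = ∑ m', R m m' * Y l m' x at hR
  refine ⟨R, hR, ?_⟩
  rw [mul_eq_one_comm]
  ext m n
  have h1 := integral_comp_rotate g (fun x => Y l m x * Y l n x)
  simp only [hY.orthonormal] at h1
  simp only [hR] at h1
  have h2 : ∀ x, (∑ m', R m m' * Y l m' x) * (∑ m', R n m' * Y l m' x)
      = ∑ m', R n m' * ((∑ k, R m k * Y l k x) * Y l m' x) := by
    intro x
    rw [Finset.mul_sum]
    exact Finset.sum_congr rfl fun _ _ => by ring
  simp only [h2] at h1
  rw [integral_finsetSum] at h1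
  · simp only [integral_const_mul, hY.integral_sum_mul_self] at h1
    rw [Matrix.mul_apply, Matrix.one_apply]
    simp only [Matrix.transpose_apply]
    convert h1 using 1
    · exact Finset.sum_congr rfl fun _ _ => mul_comm _ _
    · simp
  · intro m' _
    refine (integrable_of_continuous ?_).const_mul _
    exact (continuous_finsetSum _ fun k _ => continuous_const.mul (hY.continuous l k)).mul
      (hY.continuous l m')

end HarmonicBasis

/-- Any two points of the sphere are exchanged by a half-turn, about the axis through `x + y` unless
they are antipodal. -/
lemma exists_rotation_swap (x y : S2) : ∃ g : E3 ≃ₗᵢ[ℝ] E3,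
    LinearMap.det (g.toLinearEquiv : E3 →ₗ[ℝ] E3) = 1 ∧ rotate g x = y ∧ rotate g y = x := by
  have hdet : ∀ u : E3, u ≠ 0 →
      LinearMap.det ((ℝ ∙ u).reflection.toLinearEquiv : E3 →ₗ[ℝ] E3) = 1 := by
    intro u hu
    have h1 := (ℝ ∙ u).det_reflection
    have h2 : Module.finrank ℝ (ℝ ∙ u)ᗮ = 2 := by
      have := (ℝ ∙ u).finrank_add_finrank_orthogonal
      rw [finrank_span_singleton hu] at this
      simp at this
      omega
    rw [h2] at h1
    simpa using h1
  have hx : ‖(x : E3)‖ = 1 := by simp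
  have hy : ‖(y : E3)‖ = 1 := by simp
  by_cases hxy : (x : E3) + y = 0
  · -- antipodal points: any axis orthogonal to `x` will do
    have hy' : (y : E3) = -x := (neg_eq_of_add_eq_zero_right hxy).symm
    obtain ⟨u, hu, hu0⟩ : ∃ u ∈ (ℝ ∙ (x : E3))ᗮ, u ≠ 0 := by
      apply Submodule.exists_mem_ne_zero_of_ne_bot
      intro hbot
      have := (ℝ ∙ (x : E3)).finrank_add_finrank_orthogonal
      have hx0 : (x : E3) ≠ 0 := by
        intro h
        rw [h] at hx
        simp at hx
      rw [finrank_span_singleton hx0, hbot] at this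
      simp at this
    have hxu : (x : E3) ∈ (ℝ ∙ u)ᗮ := by
      rw [Submodule.mem_orthogonal_singleton_iff_inner_right] at hu ⊢
      rw [real_inner_comm]; exact hu
    refine ⟨(ℝ ∙ u).reflection, hdet u hu0, Subtype.ext ?_, Subtype.ext ?_⟩
    · simp only [rotate]
      rw [Submodule.reflection_mem_subspace_orthogonalComplement_eq_neg hxu, hy']
    · simp only [rotate]
      rw [hy', map_neg, Submodule.reflection_mem_subspace_orthogonalComplement_eq_neg hxu, neg_neg]
  · have h1 : (ℝ ∙ ((x : E3) + y)).reflection ((x : E3) + y) = x + y :=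
      Submodule.reflection_mem_subspace_eq_self (Submodule.mem_span_singleton_self _)
    have h2 : (ℝ ∙ ((x : E3) + y)).reflection ((x : E3) - y) = -(x - y) := by
      apply Submodule.reflection_mem_subspace_orthogonalComplement_eq_neg
      rw [Submodule.mem_orthogonal_singleton_iff_inner_right]
      exact (real_inner_add_sub_eq_zero_iff _ _).2 (by rw [hx, hy])
    rw [map_add] at h1
    rw [map_sub] at h2
    have h3 : (ℝ ∙ ((x : E3) + y)).reflection (x : E3) = y := by
      have : (2 : ℝ) • (ℝ ∙ ((x : E3) + y)).reflection (x : E3) = (2 : ℝ) • (y : E3) := by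
        rw [two_smul, two_smul]
        have := congrArg₂ (· + ·) h1 h2
        convert this using 1 <;> abel
      exact smul_right_injective E3 two_ne_zero this
    refine ⟨_, hdet _ hxy, Subtype.ext h3, Subtype.ext ?_⟩
    rw [h3] at h1
    simp only [rotate]
    rw [add_comm (x : E3) y] at h1 ⊢
    exact add_left_cancel h1

/-! ### Second moments of the field and of its harmonic coefficients -/

/-- The linear functional `⟨T, f⟩ = ∫ T f` of the field. -/
noncomputable def pairing {Ω : Type*} (T : S2 → Ω → ℝ) (f : S2 → ℝ) (ω : Ω) : ℝ :=
  ∫ x, T x ω * f x ∂surf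

lemma integrable_mul_of_continuous {t f : S2 → ℝ} (ht : Integrable t surf)
    (hf : Continuous f) : Integrable (fun x => t x * f x) surf := by
  obtain ⟨c, hc⟩ := exists_bound_of_continuous hf
  exact ht.mul_bdd hf.aestronglyMeasurable (ae_of_all _ hc)

lemma pairing_sum {Ω : Type*} {T : S2 → Ω → ℝ} {ω : Ω} (hω : Integrable (fun x => T x ω) surf)
    {ι : Type*} (s : Finset ι) (c : ι → ℝ) (f : ι → S2 → ℝ) (hf : ∀ i, Continuous (f i)) :
    pairing T (fun x => ∑ i ∈ s, c i * f i x) ω = ∑ i ∈ s, c i * pairing T (f i) ω := by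
  simp only [pairing, Finset.mul_sum]
  rw [integral_finsetSum]
  · refine Finset.sum_congr rfl fun i _ => ?_
    rw [← integral_const_mul]
    exact integral_congr_ae (ae_of_all _ fun x => by simp only; ring)
  · intro i _
    exact integrable_mul_of_continuous hω (continuous_const.mul (hf i))

section Field

variable {Ω : Type*} [MeasurableSpace Ω] {P : Measure Ω} {T : S2 → Ω → ℝ}

/-- The covariance kernel of the field. -/
noncomputable def covKernel (P : Measure Ω) (T : S2 → Ω → ℝ) (z : S2 × S2) : ℝ :=
  ∫ ω, T z.1 ω * T z.2 ω ∂P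

lemma IsIsotropicGaussianField.memLp (hT : IsIsotropicGaussianField P T) (x : S2) :
    MemLp (T x) 2 P := (hT.gaussian.hasGaussianLaw_eval x).memLp_two

lemma IsIsotropicGaussianField.integrable_mul (hT : IsIsotropicGaussianField P T) (x y : S2) :
    Integrable (fun ω => T x ω * T y ω) P := (hT.memLp x).integrable_mul (hT.memLp y)

lemma IsIsotropicGaussianField.covKernel_rotate (hT : IsIsotropicGaussianField P T)
    {g : E3 ≃ₗᵢ[ℝ] E3} (hg : LinearMap.det (g.toLinearEquiv : E3 →ₗ[ℝ] E3) = 1) (x y : S2) :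
    covKernel P T (rotate g x, rotate g y) = covKernel P T (x, y) := by
  have h := (hT.isotropic g hg).comp (u := fun t : S2 → ℝ => t x * t y)
    ((measurable_pi_apply x).mul (measurable_pi_apply y))
  exact h.integral_eq

lemma IsIsotropicGaussianField.covKernel_diag (hT : IsIsotropicGaussianField P T) (x y : S2) :
    covKernel P T (x, x) = covKernel P T (y, y) := by
  obtain ⟨g, hg, hxy, -⟩ := exists_rotation_swap x y
  rw [← hxy, hT.covKernel_rotate hg]

lemma IsIsotropicGaussianField.measurable_pairing (hT : IsIsotropicGaussianField P T)
    {f : S2 → ℝ} (hf : Continuous f) : Measurable (pairing T f) := by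
  have h : Measurable (Function.uncurry fun (ω : Ω) (x : S2) => T x ω * f x) := by
    have h1 : Measurable fun p : Ω × S2 => T p.2 p.1 := hT.measurable.comp measurable_swap
    exact h1.mul (hf.measurable.comp measurable_snd)
  exact (h.stronglyMeasurable.integral_prod_right (ν := surf)).measurable

variable [IsProbabilityMeasure P]

/-- The integrand of the second moment of two linear functionals is integrable on
`S² × S² × Ω`: the variance of the field is constant and the sphere has finite measure. -/
lemma IsIsotropicGaussianField.integrable_prod (hT : IsIsotropicGaussianField P T)
    {f f' : S2 → ℝ} (hf : Continuous f) (hf' : Continuous f') :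
    Integrable (fun p : (S2 × S2) × Ω => (T p.1.1 p.2 * f p.1.1) * (T p.1.2 p.2 * f' p.1.2))
      ((surf.prod surf).prod P) := by
  have hmeas : Measurable
      (fun p : (S2 × S2) × Ω => (T p.1.1 p.2 * f p.1.1) * (T p.1.2 p.2 * f' p.1.2)) := by
    have h1 : Measurable fun p : (S2 × S2) × Ω => T p.1.1 p.2 :=
      hT.measurable.comp (f := fun p : (S2 × S2) × Ω => (p.1.1, p.2)) (by fun_prop)
    have h2 : Measurable fun p : (S2 × S2) × Ω => T p.1.2 p.2 :=
      hT.measurable.comp (f := fun p : (S2 × S2) × Ω => (p.1.2, p.2)) (by fun_prop)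
    have h3 := hf.measurable
    have h4 := hf'.measurable
    exact (h1.mul (h3.comp (by fun_prop))).mul (h2.mul (h4.comp (by fun_prop)))
  rw [integrable_prod_iff hmeas.aestronglyMeasurable]
  obtain ⟨c, hc⟩ := exists_bound_of_continuous hf
  obtain ⟨c', hc'⟩ := exists_bound_of_continuous hf'
  have hint : ∀ z : S2 × S2,
      Integrable (fun ω => (T z.1 ω * f z.1) * (T z.2 ω * f' z.2)) P := by
    intro z
    refine ((hT.integrable_mul z.1 z.2).mul_const (f z.1 * f' z.2)).congr ?_
    exact ae_of_all _ fun ω => by simp only; ring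
  refine ⟨ae_of_all _ hint, ?_⟩
  rcases isEmpty_or_nonempty S2 with hS | ⟨⟨x₀⟩⟩
  · have : IsEmpty (S2 × S2) := inferInstance
    exact Integrable.of_isEmpty
  refine Integrable.mono' (integrable_const (covKernel P T (x₀, x₀) * (|c| * |c'|)))
    hmeas.aestronglyMeasurable.norm.integral_prod_right' (ae_of_all _ fun z => ?_)
  have h0 : 0 ≤ ∫ ω, ‖(T z.1 ω * f z.1) * (T z.2 ω * f' z.2)‖ ∂P :=
    integral_nonneg fun _ => norm_nonneg _
  rw [Real.norm_of_nonneg h0]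
  have h1 : ∀ x, covKernel P T (x₀, x₀) = ∫ ω, T x ω * T x ω ∂P := fun x =>
    hT.covKernel_diag x₀ x
  have h2 : covKernel P T (x₀, x₀)
      = ∫ ω, (T z.1 ω * T z.1 ω + T z.2 ω * T z.2 ω) / 2 ∂P := by
    rw [integral_div, integral_add (hT.integrable_mul _ _) (hT.integrable_mul _ _), ← h1, ← h1]
    ring
  rw [h2, ← integral_mul_const]
  refine integral_mono (hint z).norm ?_ fun ω => ?_
  · exact (((hT.integrable_mul _ _).add (hT.integrable_mul _ _)).div_const _).mul_const _
  simp only [Real.norm_eq_abs, abs_mul]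
  have h3 : |T z.1 ω| * |T z.2 ω| ≤ (T z.1 ω * T z.1 ω + T z.2 ω * T z.2 ω) / 2 := by
    nlinarith [sq_nonneg (|T z.1 ω| - |T z.2 ω|), abs_mul_abs_self (T z.1 ω),
      abs_mul_abs_self (T z.2 ω)]
  have h4 : |f z.1| * |f' z.2| ≤ |c| * |c'| :=
    mul_le_mul ((hc _).trans (le_abs_self c)) ((hc' _).trans (le_abs_self c'))
      (abs_nonneg _) (abs_nonneg _)
  calc |T z.1 ω| * |f z.1| * (|T z.2 ω| * |f' z.2|)
      = (|T z.1 ω| * |T z.2 ω|) * (|f z.1| * |f' z.2|) := by ring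
    _ ≤ _ := mul_le_mul h3 h4 (by positivity) ((by positivity : (0 : ℝ) ≤ _).trans h3)

lemma IsIsotropicGaussianField.integrable_pairing_mul (hT : IsIsotropicGaussianField P T)
    {f f' : S2 → ℝ} (hf : Continuous f) (hf' : Continuous f') :
    Integrable (fun ω => pairing T f ω * pairing T f' ω) P := by
  refine (hT.integrable_prod hf hf').integral_prod_right.congr (ae_of_all _ fun ω => ?_)
  exact integral_prod_mul (fun z => T z ω * f z) (fun z => T z ω * f' z)

lemma IsIsotropicGaussianField.integral_pairing_mul (hT : IsIsotropicGaussianField P T)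
    {f f' : S2 → ℝ} (hf : Continuous f) (hf' : Continuous f') :
    ∫ ω, pairing T f ω * pairing T f' ω ∂P =
      ∫ z : S2 × S2, covKernel P T z * (f z.1 * f' z.2) ∂(surf.prod surf) := by
  have h := integral_integral_swap
    (f := fun (z : S2 × S2) ω => (T z.1 ω * f z.1) * (T z.2 ω * f' z.2)) (hT.integrable_prod hf hf')
  calc ∫ ω, pairing T f ω * pairing T f' ω ∂P
      = ∫ ω, ∫ z : S2 × S2, (T z.1 ω * f z.1) * (T z.2 ω * f' z.2) ∂(surf.prod surf) ∂P :=
        integral_congr_ae (ae_of_all _ fun ω =>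
          (integral_prod_mul (fun z => T z ω * f z) (fun z => T z ω * f' z)).symm)
    _ = _ := h.symm
    _ = _ := by
      refine integral_congr_ae (ae_of_all _ fun z => ?_)
      simp only [covKernel]
      rw [← integral_mul_const]
      exact integral_congr_ae (ae_of_all _ fun ω => by simp only; ring)

/-- Second moments of linear functionals of an isotropic field are rotation invariant. -/
lemma IsIsotropicGaussianField.integral_pairing_mul_rotate (hT : IsIsotropicGaussianField P T)
    {g : E3 ≃ₗᵢ[ℝ] E3} (hg : LinearMap.det (g.toLinearEquiv : E3 →ₗ[ℝ] E3) = 1)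
    {f f' : S2 → ℝ} (hf : Continuous f) (hf' : Continuous f') :
    ∫ ω, pairing T (fun x => f (rotate g x)) ω * pairing T (fun x => f' (rotate g x)) ω ∂P =
      ∫ ω, pairing T f ω * pairing T f' ω ∂P := by
  rw [hT.integral_pairing_mul (f := fun x => f (rotate g x)) (f' := fun x => f' (rotate g x))
      (hf.comp (continuous_rotate g)) (hf'.comp (continuous_rotate g)),
    hT.integral_pairing_mul hf hf']
  let e : S2 ≃ₜ S2 :=
    { toFun := rotate g
      invFun := rotate g.symm
      left_inv := rotate_apply_symm g
      right_inv := rotate_symm_apply g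
      continuous_toFun := continuous_rotate g
      continuous_invFun := continuous_rotate g.symm }
  have hmp := (measurePreserving_rotate g).prod (measurePreserving_rotate g)
  have hemb : MeasurableEmbedding (Prod.map (rotate g) (rotate g)) :=
    (e.prodCongr e).measurableEmbedding
  have := hmp.integral_comp hemb (fun z : S2 × S2 => covKernel P T z * (f z.1 * f' z.2))
  rw [← this]
  refine integral_congr_ae (ae_of_all _ fun z => ?_)
  simp only [Prod.map]
  rw [hT.covKernel_rotate hg]

lemma IsIsotropicGaussianField.memLp_pairing (hT : IsIsotropicGaussianField P T)
    {f : S2 → ℝ} (hf : Continuous f) : MemLp (pairing T f) 2 P := by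
  rw [memLp_two_iff_integrable_sq (hT.measurable_pairing hf).aestronglyMeasurable]
  simpa only [sq] using hT.integrable_pairing_mul hf hf

/-- The field is square integrable over `S² × Ω`, its variance being constant. -/
lemma IsIsotropicGaussianField.memLp_uncurry (hT : IsIsotropicGaussianField P T) :
    MemLp (Function.uncurry T) 2 (surf.prod P) := by
  rw [memLp_two_iff_integrable_sq hT.measurable.aestronglyMeasurable,
    integrable_prod_iff (hT.measurable.pow_const 2).aestronglyMeasurable]
  refine ⟨ae_of_all _ fun x => (hT.memLp x).integrable_sq, ?_⟩
  rcases isEmpty_or_nonempty S2 with hS | ⟨⟨x₀⟩⟩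
  · exact Integrable.of_isEmpty
  refine (integrable_const (covKernel P T (x₀, x₀))).congr (ae_of_all _ fun x => ?_)
  rw [hT.covKernel_diag x₀ x]
  exact integral_congr_ae (ae_of_all _ fun ω => by simp [Function.uncurry, sq])

lemma IsIsotropicGaussianField.integrable_uncurry (hT : IsIsotropicGaussianField P T) :
    Integrable (Function.uncurry T) (surf.prod P) :=
  hT.memLp_uncurry.integrable (by norm_num)

/-- Almost every path of the field is integrable over the sphere. -/
lemma IsIsotropicGaussianField.ae_integrable (hT : IsIsotropicGaussianField P T) :
    ∀ᵐ ω ∂P, Integrable (fun x => T x ω) surf :=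
  hT.integrable_uncurry.prod_left_ae

end Field

/-! ### Decorrelation of the harmonic coefficients -/

/-- The component of degree `l` of the field, `T_l(x) = ∑_m a_{lm} Y_{lm}(x)`. -/
noncomputable def component {Ω : Type*} (Y : (l : ℕ) → Fin (2 * l + 1) → S2 → ℝ) (T : S2 → Ω → ℝ)
    (l : ℕ) (x : S2) (ω : Ω) : ℝ := ∑ m, harmonicCoeff Y T l m ω * Y l m x

/-- The component of degree `l` of the field at a rotated point is the component at the original
point of the rotated field. -/
lemma IsHarmonicBasis.component_rotate_symm {Ω : Type*} {T : S2 → Ω → ℝ}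
    {Y : (l : ℕ) → Fin (2 * l + 1) → S2 → ℝ} (hY : IsHarmonicBasis Y)
    (l : ℕ) (g : E3 ≃ₗᵢ[ℝ] E3) {ω : Ω} (hω : Integrable (fun x => T x ω) surf) (x : S2) :
    component Y T l (rotate g.symm x) ω =
      ∑ m, pairing T (fun z => Y l m (rotate g z)) ω * Y l m x := by
  obtain ⟨R, hR, hRR⟩ := hY.exists_rotation_matrix l g
  have h1 : ∀ m, pairing T (fun z => Y l m (rotate g z)) ω
      = ∑ m', R m m' * harmonicCoeff Y T l m' ω := by
    intro m
    simp only [hR]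
    exact pairing_sum hω _ _ _ (hY.continuous l)
  have h2 : ∀ m', Y l m' (rotate g.symm x) = ∑ m, R m m' * Y l m x := by
    intro m'
    have h3 : ∀ m, Y l m x = ∑ k, R m k * Y l k (rotate g.symm x) := by
      intro m
      rw [← hR, rotate_symm_apply]
    have h4 : ∀ k, ∑ m, R m m' * R m k = if m' = k then 1 else 0 := by
      intro k
      have := congrFun (congrFun hRR m') k
      rwa [Matrix.mul_apply, Matrix.one_apply] at this
    calc Y l m' (rotate g.symm x)
        = ∑ k, (∑ m, R m m' * R m k) * Y l k (rotate g.symm x) := by simp [h4]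
      _ = ∑ k, ∑ m, R m m' * (R m k * Y l k (rotate g.symm x)) := by
        simp only [Finset.sum_mul, mul_assoc]
      _ = ∑ m, R m m' * Y l m x := by
        rw [Finset.sum_comm]
        refine Finset.sum_congr rfl fun m _ => ?_
        rw [h3, Finset.mul_sum]
  simp only [component, h1, h2, Finset.mul_sum, Finset.sum_mul]
  rw [Finset.sum_comm]
  exact Finset.sum_congr rfl fun _ _ => Finset.sum_congr rfl fun _ _ => by ring

section Decorrelation

variable {Ω : Type*} [MeasurableSpace Ω] {P : Measure Ω} [IsProbabilityMeasure P]
  {T : S2 → Ω → ℝ} {Y : (l : ℕ) → Fin (2 * l + 1) → S2 → ℝ}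

lemma IsIsotropicGaussianField.integral_sum_mul_sum (hT : IsIsotropicGaussianField P T)
    {ι ι' : Type*} [Fintype ι] [Fintype ι'] {f : ι → S2 → ℝ} {f' : ι' → S2 → ℝ}
    (hf : ∀ i, Continuous (f i)) (hf' : ∀ i, Continuous (f' i)) (c : ι → ℝ) (c' : ι' → ℝ) :
    ∫ ω, (∑ i, pairing T (f i) ω * c i) * (∑ j, pairing T (f' j) ω * c' j) ∂P =
      ∑ i, ∑ j, (∫ ω, pairing T (f i) ω * pairing T (f' j) ω ∂P) * (c i * c' j) := by
  simp_rw [Finset.sum_mul_sum]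
  have hint : ∀ i j, Integrable
      (fun ω => pairing T (f i) ω * c i * (pairing T (f' j) ω * c' j)) P := by
    intro i j
    refine ((hT.integrable_pairing_mul (hf i) (hf' j)).mul_const (c i * c' j)).congr ?_
    exact ae_of_all _ fun ω => by simp only; ring
  rw [integral_finsetSum _ fun i _ => integrable_finsetSum _ fun j _ => hint i j]
  refine Finset.sum_congr rfl fun i _ => ?_
  rw [integral_finsetSum _ fun j _ => hint i j]
  refine Finset.sum_congr rfl fun j _ => ?_
  rw [← integral_mul_const]
  exact integral_congr_ae (ae_of_all _ fun ω => by simp only; ring)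

/-- The covariance of two components of the field is rotation invariant; since half-turns
exchange any two points, it is symmetric in the two points. -/
lemma IsIsotropicGaussianField.integral_component_mul_rotate
    (hT : IsIsotropicGaussianField P T) (hY : IsHarmonicBasis Y)
    {g : E3 ≃ₗᵢ[ℝ] E3} (hg : LinearMap.det (g.toLinearEquiv : E3 →ₗ[ℝ] E3) = 1)
    (l l' : ℕ) (x y : S2) :
    ∫ ω, component Y T l (rotate g.symm x) ω * component Y T l' (rotate g.symm y) ω ∂P =
      ∫ ω, component Y T l x ω * component Y T l' y ω ∂P := by
  have h1 : ∫ ω, component Y T l (rotate g.symm x) ω * component Y T l' (rotate g.symm y) ω ∂P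
      = ∫ ω, (∑ m, pairing T (fun z => Y l m (rotate g z)) ω * Y l m x) *
        (∑ m, pairing T (fun z => Y l' m (rotate g z)) ω * Y l' m y) ∂P := by
    refine integral_congr_ae ?_
    filter_upwards [hT.ae_integrable] with ω hω
    rw [hY.component_rotate_symm l g hω, hY.component_rotate_symm l' g hω]
  rw [h1, hT.integral_sum_mul_sum (f := fun m z => Y l m (rotate g z))
    (f' := fun m z => Y l' m (rotate g z)) (fun m => (hY.continuous l m).comp (continuous_rotate g))
    (fun m => (hY.continuous l' m).comp (continuous_rotate g))]
  simp only [hT.integral_pairing_mul_rotate hg (hY.continuous l _) (hY.continuous l' _)]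
  exact (hT.integral_sum_mul_sum (hY.continuous l) (hY.continuous l') _ _).symm

lemma IsIsotropicGaussianField.integral_component_mul (hT : IsIsotropicGaussianField P T)
    (hY : IsHarmonicBasis Y) (l l' : ℕ) (x y : S2) :
    ∫ ω, component Y T l x ω * component Y T l' y ω ∂P =
      ∑ m, ∑ m', (∫ ω, harmonicCoeff Y T l m ω * harmonicCoeff Y T l' m' ω ∂P) *
        (Y l m x * Y l' m' y) :=
  hT.integral_sum_mul_sum (hY.continuous l) (hY.continuous l') _ _

lemma IsIsotropicGaussianField.integral_component_mul_comm (hT : IsIsotropicGaussianField P T)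
    (hY : IsHarmonicBasis Y) (l l' : ℕ) (x y : S2) :
    ∫ ω, component Y T l x ω * component Y T l' y ω ∂P =
      ∫ ω, component Y T l y ω * component Y T l' x ω ∂P := by
  obtain ⟨g, hg, hxy, hyx⟩ := exists_rotation_swap x y
  rw [← hT.integral_component_mul_rotate hY hg l l' x y]
  have h1 : rotate g.symm x = y := by rw [← hyx, rotate_apply_symm]
  have h2 : rotate g.symm y = x := by rw [← hxy, rotate_apply_symm]
  rw [h1, h2]

/-- Harmonic coefficients of different degrees are uncorrelated: as a function of `x`, the
symmetric kernel `E T_l(x) T_l'(y) = E T_l(y) T_l'(x)` is at once a harmonic of degree `l` and of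
degree `l'`. -/
lemma IsIsotropicGaussianField.integral_harmonicCoeff_mul_of_ne
    (hT : IsIsotropicGaussianField P T) (hY : IsHarmonicBasis Y) {l l' : ℕ} (h : l ≠ l')
    (m : Fin (2 * l + 1)) (m' : Fin (2 * l' + 1)) :
    ∫ ω, harmonicCoeff Y T l m ω * harmonicCoeff Y T l' m' ω ∂P = 0 := by
  set Q : Fin (2 * l + 1) → Fin (2 * l' + 1) → ℝ := fun m m' =>
    ∫ ω, harmonicCoeff Y T l m ω * harmonicCoeff Y T l' m' ω ∂P with hQ
  have h1 : ∀ y x, ∑ m, (∑ m', Q m m' * Y l' m' y) * Y l m x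
      = ∑ m', (∑ m, Q m m' * Y l m y) * Y l' m' x := by
    intro y x
    have h2 := hT.integral_component_mul_comm hY l l' x y
    rw [hT.integral_component_mul hY, hT.integral_component_mul hY] at h2
    simp only [Finset.sum_mul]
    conv_rhs => rw [Finset.sum_comm]
    convert h2 using 1
    · exact Finset.sum_congr rfl fun _ _ => Finset.sum_congr rfl fun _ _ => by rw [hQ]; ring
    · exact Finset.sum_congr rfl fun _ _ => Finset.sum_congr rfl fun _ _ => by rw [hQ]; ring
  have h3 : ∀ y, ∑ m', Q m m' * Y l' m' y = 0 := by
    intro y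
    rw [← hY.integral_sum_mul_self l (fun m => ∑ m', Q m m' * Y l' m' y) m]
    simp only [h1 y]
    exact hY.integral_sum_mul_of_ne h.symm _ _
  change Q m m' = 0
  rw [← hY.integral_sum_mul_self l' (Q m) m']
  simp [h3]

/-- The variance of the component of degree `l` is the same at all points, and is positive if
`C l > 0`: its integral over the sphere is `(2 l + 1) C l`. -/
lemma IsIsotropicGaussianField.integral_component_sq_pos
    (hT : IsIsotropicGaussianField P T) (hY : IsHarmonicBasis Y) {C : ℕ → ℝ}
    (hC : HasAngularPowerSpectrum P Y T C) {l : ℕ} (hl : 0 < C l) (x : S2) :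
    0 < ∫ ω, component Y T l x ω * component Y T l x ω ∂P := by
  have hconst : ∀ y, ∫ ω, component Y T l y ω * component Y T l y ω ∂P
      = ∫ ω, component Y T l x ω * component Y T l x ω ∂P := by
    intro y
    obtain ⟨g, hg, hxy, hyx⟩ := exists_rotation_swap x y
    rw [← hT.integral_component_mul_rotate hY hg l l x x]
    have h1 : rotate g.symm x = y := by rw [← hyx, rotate_apply_symm]
    rw [h1]
  have hsum : ∫ y, ∫ ω, component Y T l y ω * component Y T l y ω ∂P ∂surf
      = ∑ _m : Fin (2 * l + 1), C l := by
    simp only [hT.integral_component_mul hY]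
    have hint : ∀ m m', Integrable (fun y => (∫ ω, harmonicCoeff Y T l m ω *
        harmonicCoeff Y T l m' ω ∂P) * (Y l m y * Y l m' y)) surf := fun m m' =>
      (integrable_of_continuous ((hY.continuous l m).mul (hY.continuous l m'))).const_mul _
    rw [integral_finsetSum _ fun m _ => integrable_finsetSum _ fun m' _ => hint m m']
    refine Finset.sum_congr rfl fun m _ => ?_
    rw [integral_finsetSum _ fun m' _ => hint m m']
    simp only [integral_const_mul, hY.orthonormal]
    rw [Finset.sum_eq_single m]
    · rw [if_pos rfl, mul_one, ← hC l m]
      exact integral_congr_ae (ae_of_all _ fun ω => (sq _).symm)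
    · intro m' _ hm
      rw [if_neg, mul_zero]
      intro h'
      exact hm (by simpa using h'.symm)
    · simp
  by_contra hneg
  push Not at hneg
  have h1 : ∫ y, ∫ ω, component Y T l y ω * component Y T l y ω ∂P ∂surf ≤ 0 :=
    integral_nonpos fun y => by rw [hconst y]; exact hneg
  rw [hsum] at h1
  simp only [Finset.sum_const, Finset.card_univ, Fintype.card_fin, nsmul_eq_mul] at h1
  have : (0 : ℝ) < ((2 * l + 1 : ℕ) : ℝ) * C l := by positivity
  linarith

end Decorrelation

/-! ### Linear functionals of the field are Gaussian -/

lemma integral_pow_four_gaussianReal (v : NNReal) :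
    ∫ x, x ^ 4 ∂(gaussianReal 0 v) = 3 * (v : ℝ) ^ 2 := by
  have h0 : (0 : ℝ) ∈ interior (integrableExpSet id (gaussianReal 0 v)) := by
    rw [integrableExpSet_id_gaussianReal]; simp
  have h1 := iteratedDeriv_mgf_zero h0 4
  rw [mgf_id_gaussianReal] at h1
  simp only [Pi.pow_apply, id_eq] at h1
  rw [← h1]
  -- four derivatives of the moment generating function `exp (c t² / 2)`
  set c := (v : ℝ)
  set f : ℝ → ℝ := fun t => Real.exp (0 * t + c * t ^ 2 / 2) with hf
  have hd : ∀ t, HasDerivAt f (c * t * f t) t := by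
    intro t
    have h2 : HasDerivAt (fun t : ℝ => 0 * t + c * t ^ 2 / 2) (c * t) t := by
      have h3 : (fun t : ℝ => 0 * t + c * t ^ 2 / 2) = fun t => c * t ^ 2 / 2 := by ext s; ring
      rw [h3]
      refine (((hasDerivAt_pow 2 t).const_mul c).div_const 2).congr_deriv ?_
      norm_num
      ring
    have := h2.exp
    rw [mul_comm] at this
    exact this
  have hp : ∀ (q : ℝ → ℝ) (q' : ℝ → ℝ), (∀ t, HasDerivAt q (q' t) t) →
      deriv (fun t => q t * f t) = fun t => (q' t + q t * (c * t)) * f t := by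
    intro q q' hq
    ext t
    exact (((hq t).mul (hd t)).congr_deriv (by ring)).deriv
  have h1 : ∀ t, HasDerivAt (fun t : ℝ => c * t) c t := fun t => by
    simpa using (hasDerivAt_id t).const_mul c
  have e1 : deriv f = fun t => (c * t) * f t := funext fun t => (hd t).deriv
  have e2 : deriv (fun t => (c * t) * f t) = fun t => (c + c * t * (c * t)) * f t :=
    hp _ (fun _ => c) h1
  have e3 : deriv (fun t => (c + c * t * (c * t)) * f t)
      = fun t => (2 * c ^ 2 * t + (c + c * t * (c * t)) * (c * t)) * f t := by
    refine hp _ (fun t => 2 * c ^ 2 * t) fun t => ?_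
    exact (((h1 t).mul (h1 t)).const_add c).congr_deriv (by ring)
  have e4 : deriv (fun t => (2 * c ^ 2 * t + (c + c * t * (c * t)) * (c * t)) * f t)
      = fun t => ((3 * c ^ 2 + 3 * c ^ 3 * t ^ 2) +
        (2 * c ^ 2 * t + (c + c * t * (c * t)) * (c * t)) * (c * t)) * f t := by
    refine hp _ (fun t => 3 * c ^ 2 + 3 * c ^ 3 * t ^ 2) fun t => ?_
    exact (((hasDerivAt_id t).const_mul (2 * c ^ 2)).add
      ((((h1 t).mul (h1 t)).const_add c).mul (h1 t))).congr_deriv (by simp; ring)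
  rw [iteratedDeriv_succ, iteratedDeriv_succ, iteratedDeriv_succ, iteratedDeriv_one, e1, e2, e3,
    e4]
  simp [hf]

section Gaussian

variable {Ω : Type*} [MeasurableSpace Ω] {P : Measure Ω}

lemma norm_sq_toLp {X : Ω → ℝ} (hX : MemLp X 2 P) : ‖hX.toLp X‖ ^ 2 = ∫ ω, X ω ^ 2 ∂P := by
  rw [← real_inner_self_eq_norm_sq, L2.inner_def]
  refine integral_congr_ae ?_
  filter_upwards [hX.coeFn_toLp] with ω hω
  rw [hω]
  simp [sq]

lemma norm_cexp_mul_I_sub_le (x y : ℝ) :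
    ‖Complex.exp (x * Complex.I) - Complex.exp (y * Complex.I)‖ ≤ |x - y| := by
  have h : Complex.exp (x * Complex.I) - Complex.exp (y * Complex.I)
      = Complex.exp (y * Complex.I) * (Complex.exp (Complex.I * ((x - y : ℝ) : ℂ)) - 1) := by
    rw [mul_sub, ← Complex.exp_add, mul_one]
    congr 2
    push_cast
    ring
  rw [h, norm_mul, Complex.norm_exp_ofReal_mul_I, one_mul]
  simpa using Real.norm_exp_I_mul_ofReal_sub_one_le (x := x - y)

/-- The characteristic function at a fixed frequency is a Lipschitz function on `L²`. -/
lemma continuous_integral_cexp (P : Measure Ω) [IsProbabilityMeasure P] (t : ℝ) :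
    Continuous fun v : Lp ℝ 2 P => ∫ ω, Complex.exp (((t * v ω : ℝ) : ℂ) * Complex.I) ∂P := by
  have hint : ∀ v : Lp ℝ 2 P,
      Integrable (fun ω => Complex.exp (((t * v ω : ℝ) : ℂ) * Complex.I)) P := by
    intro v
    have hm : AEStronglyMeasurable
        (fun ω => Complex.exp (((t * v ω : ℝ) : ℂ) * Complex.I)) P := by
      have := (Lp.aestronglyMeasurable v).const_mul t
      exact (Complex.continuous_exp.comp (Complex.continuous_ofReal.mul
        continuous_const)).comp_aestronglyMeasurable this
    refine Integrable.mono' (integrable_const 1) hm (ae_of_all _ fun ω => ?_)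
    rw [Complex.norm_exp_ofReal_mul_I]
  refine (LipschitzWith.of_dist_le_mul (K := ⟨|t|, abs_nonneg t⟩) fun v w => ?_).continuous
  rw [dist_eq_norm, ← integral_sub (hint v) (hint w)]
  refine (norm_integral_le_integral_norm _).trans ?_
  have h1 : Integrable (fun ω => v ω - w ω) P :=
    ((Lp.memLp v).sub (Lp.memLp w)).integrable (by norm_num)
  calc ∫ ω, ‖Complex.exp (((t * v ω : ℝ) : ℂ) * Complex.I) -
        Complex.exp (((t * w ω : ℝ) : ℂ) * Complex.I)‖ ∂P
      ≤ ∫ ω, |t| * ‖v ω - w ω‖ ∂P := by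
        refine integral_mono ((hint v).sub (hint w)).norm (h1.norm.const_mul _) fun ω => ?_
        refine (norm_cexp_mul_I_sub_le _ _).trans ?_
        rw [← mul_sub, abs_mul, Real.norm_eq_abs]
    _ = |t| * (eLpNorm (fun ω => v ω - w ω) 1 P).toReal := by
        rw [integral_const_mul, integral_norm_eq_lintegral_enorm h1.aestronglyMeasurable,
          eLpNorm_one_eq_lintegral_enorm]
    _ ≤ |t| * (eLpNorm (fun ω => v ω - w ω) 2 P).toReal := by
        gcongr
        · exact ((Lp.memLp v).sub (Lp.memLp w)).eLpNorm_ne_top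
        · exact eLpNorm_le_eLpNorm_of_exponent_le (by norm_num) h1.aestronglyMeasurable
    _ = _ := by
        rw [Lp.dist_def]
        rfl

/-- The elements of `L²` with a centred Gaussian law, described by characteristic functions. -/
def centredGaussianSet (P : Measure Ω) : Set (Lp ℝ 2 P) :=
  {v | ∀ t : ℝ, ∫ ω, Complex.exp (((t * v ω : ℝ) : ℂ) * Complex.I) ∂P =
    Complex.exp ((-(t ^ 2 * ‖v‖ ^ 2) / 2 : ℝ) : ℂ)}

lemma isClosed_centredGaussianSet [IsProbabilityMeasure P] :
    IsClosed (centredGaussianSet P) := by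
  simp only [centredGaussianSet, ofPred_forall]
  refine isClosed_iInter fun t => isClosed_eq (continuous_integral_cexp P t) ?_
  exact Complex.continuous_exp.comp (Complex.continuous_ofReal.comp (by fun_prop))

lemma toLp_mem_centredGaussianSet {X : Ω → ℝ} (hX : HasGaussianLaw X P) (h0 : ∫ ω, X ω ∂P = 0) :
    hX.memLp_two.toLp X ∈ centredGaussianSet P := by
  intro t
  have h1 := hX.map_eq_gaussianReal
  rw [h0] at h1
  have h2 : ∫ ω, Complex.exp (((t * hX.memLp_two.toLp X ω : ℝ) : ℂ) * Complex.I) ∂P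
      = charFun (P.map X) t := by
    rw [charFun_apply_real, integral_map hX.aemeasurable (by fun_prop)]
    refine integral_congr_ae ?_
    filter_upwards [hX.memLp_two.coeFn_toLp] with ω hω
    rw [hω]
    push_cast
    rfl
  rw [h2, h1, charFun_gaussianReal, norm_sq_toLp, Real.coe_toNNReal _ (variance_nonneg _ _),
    variance_of_integral_eq_zero hX.aemeasurable h0]
  push_cast
  congr 1
  simp
  ring

variable [IsProbabilityMeasure P]

lemma hasLaw_of_mem_centredGaussianSet {X : Ω → ℝ} (hX : MemLp X 2 P)
    (h : hX.toLp X ∈ centredGaussianSet P) :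
    HasLaw X (gaussianReal 0 (∫ ω, X ω ^ 2 ∂P).toNNReal) P := by
  have hm : AEMeasurable X P := hX.aestronglyMeasurable.aemeasurable
  refine ⟨hm, ?_⟩
  have : IsProbabilityMeasure (P.map X) := Measure.isProbabilityMeasure_map hm
  refine Measure.ext_of_charFun (funext fun t => ?_)
  rw [charFun_gaussianReal, charFun_apply_real, integral_map hm (by fun_prop),
    Real.coe_toNNReal _ (integral_nonneg fun _ => sq_nonneg _), ← norm_sq_toLp hX]
  have h2 := h t
  have h3 : ∫ ω, Complex.exp (((t * hX.toLp X ω : ℝ) : ℂ) * Complex.I) ∂P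
      = ∫ ω, Complex.exp (t * X ω * Complex.I) ∂P := by
    refine integral_congr_ae ?_
    filter_upwards [hX.coeFn_toLp] with ω hω
    rw [hω]
    push_cast
    rfl
  rw [← h3, h2]
  push_cast
  congr 1
  simp
  ring

variable {T : S2 → Ω → ℝ}

lemma IsIsotropicGaussianField.toLp_sum_mem (hT : IsIsotropicGaussianField P T) (c : S2 →₀ ℝ) :
    (c.sum fun x r => r • (hT.memLp x).toLp (T x)) ∈ centredGaussianSet P := by
  have hg : HasGaussianLaw (fun ω => ∑ x ∈ c.support, c x • T x ω) P :=
    (hT.gaussian.smul c).hasGaussianLaw_fun_sum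
  have h0 : ∫ ω, ∑ x ∈ c.support, c x • T x ω ∂P = 0 := by
    have hi : ∀ x ∈ c.support, Integrable (fun ω => c x • T x ω) P := fun x _ =>
      ((hT.memLp x).integrable (by norm_num)).smul (c x)
    rw [integral_finsetSum _ hi]
    refine Finset.sum_eq_zero fun x _ => ?_
    rw [integral_smul, hT.centred, smul_zero]
  convert toLp_mem_centredGaussianSet hg h0
  rw [Finsupp.sum]
  apply Lp.ext
  refine EventuallyEq.trans ?_ (MemLp.coeFn_toLp _).symm
  refine (Lp.coeFn_finsetSum _ _).trans ?_
  have hx : ∀ x ∈ c.support, (c x • (hT.memLp x).toLp (T x) : Lp ℝ 2 P) =ᵐ[P] c x • T x := by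
    intro x _
    refine (Lp.coeFn_smul _ _).trans ?_
    filter_upwards [(hT.memLp x).coeFn_toLp] with ω hω
    simp [hω]
  have hx' := (Filter.eventually_all_finset c.support).2 hx
  filter_upwards [hx'] with ω hω
  rw [Finset.sum_apply]
  exact Finset.sum_congr rfl fun x hx => by rw [hω x hx]; rfl

/-- Every continuous linear functional `∫ T f` of the field is a centred Gaussian variable: it is
orthogonal to everything that is orthogonal to all `T x`, so it lies in their closed span. -/
lemma IsIsotropicGaussianField.hasLaw_pairing (hT : IsIsotropicGaussianField P T)
    {f : S2 → ℝ} (hf : Continuous f) :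
    HasLaw (pairing T f) (gaussianReal 0 (∫ ω, pairing T f ω ^ 2 ∂P).toNNReal) P := by
  refine hasLaw_of_mem_centredGaussianSet (hT.memLp_pairing hf) ?_
  set V : Submodule ℝ (Lp ℝ 2 P) :=
    Submodule.span ℝ (range fun x => (hT.memLp x).toLp (T x)) with hV
  have hVsub : (V.topologicalClosure : Set (Lp ℝ 2 P)) ⊆ centredGaussianSet P := by
    rw [Submodule.topologicalClosure_coe]
    refine closure_minimal (fun v hv => ?_) isClosed_centredGaussianSet
    rw [hV, SetLike.mem_coe, Finsupp.mem_span_range_iff_exists_finsupp] at hv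
    obtain ⟨c, rfl⟩ := hv
    exact hT.toLp_sum_mem c
  apply hVsub
  rw [SetLike.mem_coe, ← Submodule.orthogonal_orthogonal_eq_closure, Submodule.mem_orthogonal]
  intro η hη
  have hη' : ∀ x, ∫ ω, T x ω * η ω ∂P = 0 := by
    intro x
    have h1 := (Submodule.mem_orthogonal _ _).1 hη _ (Submodule.subset_span ⟨x, rfl⟩)
    rw [L2.inner_def] at h1
    rw [← h1]
    refine integral_congr_ae ?_
    filter_upwards [(hT.memLp x).coeFn_toLp] with ω hω
    simp [hω, mul_comm]
  have hint : Integrable (Function.uncurry fun (x : S2) (ω : Ω) => f x * (T x ω * η ω))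
      (surf.prod P) := by
    have h1 : MemLp (fun p : S2 × Ω => η p.2) 2 (surf.prod P) := (Lp.memLp η).comp_snd surf
    have h2 := hT.memLp_uncurry.integrable_mul h1
    obtain ⟨c, hc⟩ := exists_bound_of_continuous hf
    exact h2.bdd_mul (c := c) (hf.measurable.comp measurable_fst).aestronglyMeasurable
      (ae_of_all _ fun p => hc p.1)
  rw [L2.inner_def]
  calc ∫ ω, inner ℝ (η ω) ((hT.memLp_pairing hf).toLp (pairing T f) ω) ∂P
      = ∫ ω, ∫ x, f x * (T x ω * η ω) ∂surf ∂P := by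
        refine integral_congr_ae ?_
        filter_upwards [(hT.memLp_pairing hf).coeFn_toLp] with ω hω
        rw [hω]
        simp only [pairing, RCLike.inner_apply, conj_trivial]
        rw [mul_comm, ← integral_const_mul]
        exact integral_congr_ae (ae_of_all _ fun x => by simp only; ring)
    _ = ∫ x, ∫ ω, f x * (T x ω * η ω) ∂P ∂surf := (integral_integral_swap hint).symm
    _ = 0 := by simp [integral_const_mul, hη']

lemma IsIsotropicGaussianField.memLp_pairing_four (hT : IsIsotropicGaussianField P T)
    {f : S2 → ℝ} (hf : Continuous f) : MemLp (pairing T f) 4 P := by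
  have h := hT.hasLaw_pairing hf
  exact h.hasGaussianLaw.memLp (by norm_num)

lemma IsIsotropicGaussianField.integral_pairing_pow_four (hT : IsIsotropicGaussianField P T)
    {f : S2 → ℝ} (hf : Continuous f) :
    ∫ ω, pairing T f ω ^ 4 ∂P = 3 * (∫ ω, pairing T f ω ^ 2 ∂P) ^ 2 := by
  have h := hT.hasLaw_pairing hf
  have h1 := h.integral_comp (f := fun x : ℝ => x ^ 4) (by fun_prop)
  simp only [Function.comp_def] at h1
  rw [h1, integral_pow_four_gaussianReal,
    Real.coe_toNNReal _ (integral_nonneg fun _ => sq_nonneg _)]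

lemma IsIsotropicGaussianField.ae_pairing_ne_zero (hT : IsIsotropicGaussianField P T)
    {f : S2 → ℝ} (hf : Continuous f) (h0 : 0 < ∫ ω, pairing T f ω ^ 2 ∂P) :
    ∀ᵐ ω ∂P, pairing T f ω ≠ 0 := by
  have h := hT.hasLaw_pairing hf
  have : NullSingletonClass (gaussianReal 0 (∫ ω, pairing T f ω ^ 2 ∂P).toNNReal) :=
    nullSingletonClass_gaussianReal (by simpa using h0)
  have h1 : ∀ᵐ x ∂(P.map (pairing T f)), x ≠ 0 := by
    rw [h.map_eq]
    exact measure_mono_null (fun x hx => by simpa using hx) (measure_singleton (0 : ℝ))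
  exact ae_of_ae_map h.aemeasurable h1

end Gaussian

/-! ### The energy of the needlet coefficients at one level -/

/-- The energy `∑_l b²(l / B^j) ∑_m a_{lm}²` at level `j`. -/
noncomputable def energy {Ω : Type*} (B : ℝ) (b : ℝ → ℝ) (Y : (l : ℕ) → Fin (2 * l + 1) → S2 → ℝ)
    (T : S2 → Ω → ℝ) (j : ℕ) (ω : Ω) : ℝ :=
  ∑ l ∈ band B j, b (l / B ^ j) ^ 2 * ∑ m, harmonicCoeff Y T l m ω ^ 2

section Deterministic

variable {B : ℝ} {b : ℝ → ℝ} {Y : (l : ℕ) → Fin (2 * l + 1) → S2 → ℝ}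

lemma IsHarmonicBasis.continuous_needlet (hY : IsHarmonicBasis Y) (X : Cubature B) (j : ℕ)
    (k : Fin (X.N j)) : Continuous (needlet b Y X j k) := by
  unfold needlet
  refine continuous_const.mul (continuous_finsetSum _ fun l _ => continuous_const.mul
    (continuous_finsetSum _ fun m _ => (hY.continuous l m).mul continuous_const))

lemma needletCoeff_eq_pairing {Ω : Type*} (X : Cubature B) (T : S2 → Ω → ℝ) (j : ℕ)
    (k : Fin (X.N j)) (ω : Ω) :
    needletCoeff b Y X T j k ω = pairing T (needlet b Y X j k) ω := by
  simp only [needletCoeff, pairing, mul_comm]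

lemma IsHarmonicBasis.needletCoeff_eq (hY : IsHarmonicBasis Y) {Ω : Type*} {T : S2 → Ω → ℝ}
    (X : Cubature B) (j : ℕ) (k : Fin (X.N j)) {ω : Ω}
    (hω : Integrable (fun x => T x ω) surf) :
    needletCoeff b Y X T j k ω =
      √(X.w j k) * ∑ l ∈ band B j, b (l / B ^ j) * component Y T l (X.ξ j k) ω := by
  have h1 : needlet b Y X j k = fun x => ∑ i ∈ (band B j).sigma
      fun l => (Finset.univ : Finset (Fin (2 * l + 1))),
      (√(X.w j k) * (b (i.1 / B ^ j) * Y i.1 i.2 (X.ξ j k))) * Y i.1 i.2 x := by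
    ext x
    simp only [needlet, Finset.sum_sigma, Finset.mul_sum]
    exact Finset.sum_congr rfl fun _ _ => Finset.sum_congr rfl fun _ _ => by ring
  rw [needletCoeff_eq_pairing, h1,
    pairing_sum hω _ _ (fun i : (l : ℕ) × Fin (2 * l + 1) => Y i.1 i.2)
      fun i => hY.continuous _ _]
  simp only [component, Finset.sum_sigma, Finset.mul_sum]
  exact Finset.sum_congr rfl fun _ _ => Finset.sum_congr rfl fun _ _ => by
    simp only [harmonicCoeff, pairing]
    ring

/-- The cubature formula applied to the square of a harmonic sum of degrees in the band:
together with orthonormality it is a discrete Parseval identity. -/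
lemma IsHarmonicBasis.cubature_sq (hY : IsHarmonicBasis Y) (X : Cubature B) (j : ℕ)
    (v : (l : ℕ) → Fin (2 * l + 1) → ℝ) :
    ∑ k, X.w j k * (∑ l ∈ band B j, ∑ m, v l m * Y l m (X.ξ j k)) ^ 2 =
      ∑ l ∈ band B j, ∑ m, v l m ^ 2 := by
  choose p hp _ hpY using hY.harmonic
  set q : MvPolynomial (Fin 3) ℝ :=
    ∑ l ∈ band B j, ∑ m, MvPolynomial.C (v l m) * p l m with hq
  have hqdeg : q.totalDegree ≤ ⌊B ^ (j + 1)⌋₊ := by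
    refine MvPolynomial.totalDegree_finsetSum_le fun l hl => ?_
    refine MvPolynomial.totalDegree_finsetSum_le fun m _ => ?_
    have hl' : l ≤ ⌊B ^ (j + 1)⌋₊ := by
      simp only [band, Finset.mem_range] at hl
      omega
    refine (MvPolynomial.totalDegree_mul _ _).trans ?_
    rw [MvPolynomial.totalDegree_C, zero_add]
    exact (hp l m).totalDegree_le.trans hl'
  have hqY : ∀ x : S2, polyFun q x.1 = ∑ l ∈ band B j, ∑ m, v l m * Y l m x := by
    intro x
    simp only [hq, polyFun, map_sum, map_mul, MvPolynomial.eval_C]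
    exact Finset.sum_congr rfl fun l _ => Finset.sum_congr rfl fun m _ => by
      rw [hpY l m x]; rfl
  have hex := X.exact j (q * q) ((MvPolynomial.totalDegree_mul _ _).trans (by omega))
  have hmul : ∀ x : E3, polyFun (q * q) x = polyFun q x ^ 2 := fun x => by
    simp [polyFun, sq]
  simp only [hmul, hqY] at hex
  rw [hex]
  set s := (band B j).sigma fun l => (Finset.univ : Finset (Fin (2 * l + 1))) with hs
  have hsum : ∀ f : (l : ℕ) → Fin (2 * l + 1) → ℝ,
      ∑ l ∈ band B j, ∑ m, f l m = ∑ i ∈ s, f i.1 i.2 := fun f => by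
    rw [hs, Finset.sum_sigma]
  simp only [hsum, sq, Finset.sum_mul_sum]
  have hint : ∀ i i' : (l : ℕ) × Fin (2 * l + 1), Integrable
      (fun x => v i.1 i.2 * Y i.1 i.2 x * (v i'.1 i'.2 * Y i'.1 i'.2 x)) surf := fun i i' =>
    integrable_of_continuous ((continuous_const.mul (hY.continuous _ _)).mul
      (continuous_const.mul (hY.continuous _ _)))
  rw [integral_finsetSum _ fun i _ => integrable_finsetSum _ fun i' _ => hint i i']
  refine Finset.sum_congr rfl fun i hi => ?_
  rw [integral_finsetSum _ fun i' _ => hint i i', Finset.sum_eq_single_of_mem i hi]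
  · have : ∀ x, v i.1 i.2 * Y i.1 i.2 x * (v i.1 i.2 * Y i.1 i.2 x)
        = (v i.1 i.2 * v i.1 i.2) * (Y i.1 i.2 x * Y i.1 i.2 x) := fun x => by ring
    simp only [this]
    rw [integral_const_mul, hY.orthonormal, if_pos rfl, mul_one]
  · intro i' _ hi'
    have : ∀ x, v i.1 i.2 * Y i.1 i.2 x * (v i'.1 i'.2 * Y i'.1 i'.2 x)
        = (v i.1 i.2 * v i'.1 i'.2) * (Y i.1 i.2 x * Y i'.1 i'.2 x) := fun x => by ring
    simp only [this]
    rw [integral_const_mul, hY.orthonormal, if_neg, mul_zero]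
    exact fun h => hi' h.symm

/-- The sum of the squared needlet coefficients at level `j` is the energy at level `j`. -/
lemma IsHarmonicBasis.sum_needletCoeff_sq (hY : IsHarmonicBasis Y) {Ω : Type*} {T : S2 → Ω → ℝ}
    (X : Cubature B) (j : ℕ) {ω : Ω} (hω : Integrable (fun x => T x ω) surf) :
    ∑ k, needletCoeff b Y X T j k ω ^ 2 = energy B b Y T j ω := by
  have h := hY.cubature_sq X j fun l m => b (l / B ^ j) * harmonicCoeff Y T l m ω
  simp only [mul_pow, ← Finset.mul_sum] at h
  rw [energy, ← h]
  refine Finset.sum_congr rfl fun k _ => ?_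
  rw [hY.needletCoeff_eq X j k hω, mul_pow, Real.sq_sqrt (X.w_pos j k).le]
  simp only [component, Finset.mul_sum, mul_assoc]

end Deterministic

lemma memLp_sq_of_memLp_four {Ω : Type*} [MeasurableSpace Ω] {P : Measure Ω} {w : Ω → ℝ}
    (hw : MemLp w 4 P) : MemLp (fun ω => w ω ^ 2) 2 P := by
  have h : w * w = fun ω => w ω ^ 2 := funext fun ω => (sq (w ω)).symm
  rw [← h]
  exact hw.mul hw (hpqr := ⟨by
    rw [← two_mul, show (4 : ENNReal) = 2 * 2 by norm_num,
      ENNReal.mul_inv (by norm_num) (by norm_num), ← mul_assoc,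
      ENNReal.mul_inv_cancel (by norm_num) (by norm_num), one_mul]⟩)

section Moments

variable {Ω : Type*} [MeasurableSpace Ω] {P : Measure Ω} [IsProbabilityMeasure P]
  {T : S2 → Ω → ℝ} {Y : (l : ℕ) → Fin (2 * l + 1) → S2 → ℝ}

/-- For uncorrelated linear functionals `u`, `v`, the fourth moments of the Gaussian variables
`u ± v`, `u`, `v` determine `E u² v² = E u² E v²`. -/
lemma IsIsotropicGaussianField.covariance_pairing_sq (hT : IsIsotropicGaussianField P T)
    {f f' : S2 → ℝ} (hf : Continuous f) (hf' : Continuous f')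
    (h0 : ∫ ω, pairing T f ω * pairing T f' ω ∂P = 0) :
    cov[fun ω => pairing T f ω ^ 2, fun ω => pairing T f' ω ^ 2; P] = 0 := by
  set u := pairing T f with hu
  set v := pairing T f' with hv
  have hu4 : MemLp u 4 P := hT.memLp_pairing_four hf
  have hv4 : MemLp v 4 P := hT.memLp_pairing_four hf'
  have hsq : ∀ {w : Ω → ℝ}, MemLp w 4 P → MemLp (fun ω => w ω ^ 2) 2 P := memLp_sq_of_memLp_four
  have hadd : pairing T (fun x => f x + f' x) =ᵐ[P] fun ω => u ω + v ω := by
    filter_upwards [hT.ae_integrable] with ω hω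
    simp only [hu, hv, pairing, mul_add]
    exact integral_add (integrable_mul_of_continuous hω hf) (integrable_mul_of_continuous hω hf')
  have hsub : pairing T (fun x => f x - f' x) =ᵐ[P] fun ω => u ω - v ω := by
    filter_upwards [hT.ae_integrable] with ω hω
    simp only [hu, hv, pairing, mul_sub]
    exact integral_sub (integrable_mul_of_continuous hω hf) (integrable_mul_of_continuous hω hf')
  have iu2 := hu4.mono_exponent (p := 2) (by norm_num) |>.integrable_sq
  have iv2 := hv4.mono_exponent (p := 2) (by norm_num) |>.integrable_sq
  have iuv : Integrable (fun ω => u ω * v ω) P := hT.integrable_pairing_mul hf hf'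
  have iu4 : Integrable (fun ω => u ω ^ 4) P := by
    simpa only [← pow_mul] using (hsq hu4).integrable_sq
  have iv4 : Integrable (fun ω => v ω ^ 4) P := by
    simpa only [← pow_mul] using (hsq hv4).integrable_sq
  have iuv2 : Integrable (fun ω => u ω ^ 2 * v ω ^ 2) P :=
    (hsq hu4).integrable_mul (hsq hv4)
  have eu := hT.integral_pairing_pow_four hf
  have ev := hT.integral_pairing_pow_four hf'
  have iuv' : Integrable (fun ω => u ω ^ 2 + v ω ^ 2) P := iu2.add iv2
  have iuv4 : Integrable (fun ω => 2 * u ω ^ 4 + 2 * v ω ^ 4) P :=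
    (iu4.const_mul 2).add (iv4.const_mul 2)
  have ea := hT.integral_pairing_pow_four (f := fun x => f x + f' x) (hf.add hf')
  have es := hT.integral_pairing_pow_four (f := fun x => f x - f' x) (hf.sub hf')
  have ea2 : ∫ ω, pairing T (fun x => f x + f' x) ω ^ 2 ∂P
      = ∫ ω, u ω ^ 2 ∂P + ∫ ω, v ω ^ 2 ∂P := by
    calc ∫ ω, pairing T (fun x => f x + f' x) ω ^ 2 ∂P
        = ∫ ω, (u ω ^ 2 + v ω ^ 2 + 2 * (u ω * v ω)) ∂P := by
          refine integral_congr_ae ?_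
          filter_upwards [hadd] with ω hω
          rw [hω]; ring
      _ = _ := by
          rw [integral_add iuv' (iuv.const_mul 2), integral_add iu2 iv2,
            integral_const_mul, h0]
          ring
  have es2 : ∫ ω, pairing T (fun x => f x - f' x) ω ^ 2 ∂P
      = ∫ ω, u ω ^ 2 ∂P + ∫ ω, v ω ^ 2 ∂P := by
    calc ∫ ω, pairing T (fun x => f x - f' x) ω ^ 2 ∂P
        = ∫ ω, (u ω ^ 2 + v ω ^ 2 - 2 * (u ω * v ω)) ∂P := by
          refine integral_congr_ae ?_
          filter_upwards [hsub] with ω hω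
          rw [hω]; ring
      _ = _ := by
          rw [integral_sub iuv' (iuv.const_mul 2), integral_add iu2 iv2,
            integral_const_mul, h0]
          ring
  have hsum : ∫ ω, pairing T (fun x => f x + f' x) ω ^ 4 ∂P
      + ∫ ω, pairing T (fun x => f x - f' x) ω ^ 4 ∂P
      = 2 * ∫ ω, u ω ^ 4 ∂P + 2 * ∫ ω, v ω ^ 4 ∂P + 12 * ∫ ω, u ω ^ 2 * v ω ^ 2 ∂P := by
    have ia : Integrable (fun ω => pairing T (fun x => f x + f' x) ω ^ 4) P := by
      simpa only [← pow_mul] using (hsq (hT.memLp_pairing_four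
        (f := fun x => f x + f' x) (hf.add hf'))).integrable_sq
    have is : Integrable (fun ω => pairing T (fun x => f x - f' x) ω ^ 4) P := by
      simpa only [← pow_mul] using (hsq (hT.memLp_pairing_four
        (f := fun x => f x - f' x) (hf.sub hf'))).integrable_sq
    rw [← integral_add ia is, ← integral_const_mul, ← integral_const_mul, ← integral_const_mul,
      ← integral_add (iu4.const_mul _) (iv4.const_mul _),
      ← integral_add iuv4 (iuv2.const_mul _)]
    refine integral_congr_ae ?_
    filter_upwards [hadd, hsub] with ω h1 h2
    rw [h1, h2]
    ring
  rw [covariance_eq_sub (hsq hu4) (hsq hv4)]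
  simp only [Pi.mul_apply]
  rw [ea, es, eu, ev, ea2, es2] at hsum
  linarith

lemma IsIsotropicGaussianField.memLp_harmonicCoeff_sq (hT : IsIsotropicGaussianField P T)
    (hY : IsHarmonicBasis Y) (l : ℕ) (m : Fin (2 * l + 1)) :
    MemLp (fun ω => harmonicCoeff Y T l m ω ^ 2) 2 P := by
  exact memLp_sq_of_memLp_four (hT.memLp_pairing_four (hY.continuous l m))

lemma IsIsotropicGaussianField.memLp_energy (hT : IsIsotropicGaussianField P T)
    (hY : IsHarmonicBasis Y) (B : ℝ) (b : ℝ → ℝ) (j : ℕ) : MemLp (energy B b Y T j) 2 P := by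
  unfold energy
  exact memLp_finsetSum _ fun l _ => (memLp_finsetSum _ fun m _ =>
    hT.memLp_harmonicCoeff_sq hY l m).const_mul _

lemma IsIsotropicGaussianField.integral_energy (hT : IsIsotropicGaussianField P T)
    (hY : IsHarmonicBasis Y) {C : ℕ → ℝ} (hC : HasAngularPowerSpectrum P Y T C)
    (B : ℝ) (b : ℝ → ℝ) (j : ℕ) :
    ∫ ω, energy B b Y T j ω ∂P = ∑ l ∈ band B j, b (l / B ^ j) ^ 2 * ((2 * l + 1) * C l) := by
  have hi : ∀ l m, Integrable (fun ω => harmonicCoeff Y T l m ω ^ 2) P := fun l m =>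
    (hT.memLp_harmonicCoeff_sq hY l m).integrable (by norm_num)
  simp only [energy]
  rw [integral_finsetSum _ fun l _ => (integrable_finsetSum _ fun m _ => hi l m).const_mul _]
  refine Finset.sum_congr rfl fun l _ => ?_
  rw [integral_const_mul, integral_finsetSum _ fun m _ => hi l m]
  simp only [hC l, Finset.sum_const, Finset.card_univ, Fintype.card_fin, nsmul_eq_mul]
  push_cast
  rfl

/-- The variance of the energy. Different degrees do not contribute covariances, and within one
degree the fourth moments of a Gaussian variable give a bound. -/
lemma IsIsotropicGaussianField.variance_energy_le (hT : IsIsotropicGaussianField P T)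
    (hY : IsHarmonicBasis Y) {C : ℕ → ℝ} (hC : HasAngularPowerSpectrum P Y T C)
    (B : ℝ) (b : ℝ → ℝ) (j : ℕ) :
    Var[energy B b Y T j; P] ≤
      3 * ∑ l ∈ band B j, (b (l / B ^ j) ^ 2 * ((2 * l + 1) * C l)) ^ 2 := by
  have hsq := fun l m => hT.memLp_harmonicCoeff_sq hY l m
  have hU : ∀ l, MemLp (fun ω => ∑ m, harmonicCoeff Y T l m ω ^ 2) 2 P := fun l =>
    memLp_finsetSum _ fun m _ => hsq l m
  have h4 : ∀ l m, ∫ ω, (harmonicCoeff Y T l m ω ^ 2) ^ 2 ∂P = 3 * C l ^ 2 := by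
    intro l m
    rw [← hC l m]
    simp only [← pow_mul]
    exact hT.integral_pairing_pow_four (hY.continuous l m)
  unfold energy
  rw [variance_fun_sum' fun l _ => (hU l).const_mul _, Finset.mul_sum]
  refine Finset.sum_le_sum fun l hl => ?_
  rw [Finset.sum_eq_single_of_mem l hl]
  · rw [covariance_self ((hU l).const_mul _).aestronglyMeasurable.aemeasurable,
      variance_const_mul, mul_pow, ← mul_assoc, mul_comm 3, mul_assoc]
    refine mul_le_mul_of_nonneg_left ?_ (sq_nonneg _)
    refine (variance_le_expectation_sq (hU l).aestronglyMeasurable).trans ?_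
    calc ∫ ω, (∑ m, harmonicCoeff Y T l m ω ^ 2) ^ 2 ∂P
        ≤ ∫ ω, (2 * l + 1) * ∑ m, (harmonicCoeff Y T l m ω ^ 2) ^ 2 ∂P := by
          refine integral_mono (hU l).integrable_sq
            ((integrable_finsetSum _ fun m _ => (hsq l m).integrable_sq).const_mul _) fun ω => ?_
          have := sq_sum_le_card_mul_sum_sq (s := (Finset.univ : Finset (Fin (2 * l + 1))))
            (f := fun m => harmonicCoeff Y T l m ω ^ 2)
          simpa using this
      _ = 3 * ((2 * l + 1) * C l) ^ 2 := by
          rw [integral_const_mul, integral_finsetSum _ fun m _ => (hsq l m).integrable_sq]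
          simp only [h4, Finset.sum_const, Finset.card_univ, Fintype.card_fin, nsmul_eq_mul]
          push_cast
          ring
  · intro l' _ hl'
    rw [covariance_const_mul_left, covariance_const_mul_right,
      covariance_fun_sum_fun_sum (fun m => hsq l m) fun m => hsq l' m]
    have : ∀ m m', cov[fun ω => harmonicCoeff Y T l m ω ^ 2,
        fun ω => harmonicCoeff Y T l' m' ω ^ 2; P] = 0 := fun m m' =>
      hT.covariance_pairing_sq (hY.continuous l m) (hY.continuous l' m')
        (hT.integral_harmonicCoeff_mul_of_ne hY hl'.symm m m')
    simp [this]

/-- At a level whose band contains a degree seen by the window, all needlet coefficients are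
nondegenerate Gaussian variables. -/
lemma IsIsotropicGaussianField.ae_needletCoeff_ne_zero (hT : IsIsotropicGaussianField P T)
    (hY : IsHarmonicBasis Y) {C : ℕ → ℝ} (hC : HasAngularPowerSpectrum P Y T C) {B : ℝ}
    {b : ℝ → ℝ} (X : Cubature B) {j l₀ : ℕ} (hl₀ : l₀ ∈ band B j) (hb : b (l₀ / B ^ j) ≠ 0)
    (hpos : 0 < C l₀) (k : Fin (X.N j)) :
    ∀ᵐ ω ∂P, needletCoeff b Y X T j k ω ≠ 0 := by
  simp only [needletCoeff_eq_pairing]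
  apply hT.ae_pairing_ne_zero (hY.continuous_needlet X j k)
  have hcomp : ∀ l l', Integrable
      (fun ω => component Y T l (X.ξ j k) ω * component Y T l' (X.ξ j k) ω) P := by
    intro l l'
    have : ∀ l, MemLp (fun ω => component Y T l (X.ξ j k) ω) 2 P := fun l => by
      unfold component
      exact memLp_finsetSum _ fun m _ => (hT.memLp_pairing (hY.continuous l m)).mul_const _
    exact (this l).integrable_mul (this l')
  have hne : ∀ l l', l ≠ l' → ∫ ω, component Y T l (X.ξ j k) ω *
      component Y T l' (X.ξ j k) ω ∂P = 0 := by
    intro l l' h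
    rw [hT.integral_component_mul hY]
    simp [hT.integral_harmonicCoeff_mul_of_ne hY h]
  have h1 : ∫ ω, pairing T (needlet b Y X j k) ω ^ 2 ∂P = X.w j k * ∑ l ∈ band B j,
      b (l / B ^ j) ^ 2 * ∫ ω, component Y T l (X.ξ j k) ω * component Y T l (X.ξ j k) ω ∂P := by
    have h2 : ∫ ω, pairing T (needlet b Y X j k) ω ^ 2 ∂P
        = ∫ ω, X.w j k * ∑ l ∈ band B j, ∑ l' ∈ band B j, b (l / B ^ j) * b (l' / B ^ j) *
          (component Y T l (X.ξ j k) ω * component Y T l' (X.ξ j k) ω) ∂P := by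
      refine integral_congr_ae ?_
      filter_upwards [hT.ae_integrable] with ω hω
      rw [← needletCoeff_eq_pairing, hY.needletCoeff_eq X j k hω, mul_pow,
        Real.sq_sqrt (X.w_pos j k).le, sq, Finset.sum_mul_sum]
      congr 1
      exact Finset.sum_congr rfl fun _ _ => Finset.sum_congr rfl fun _ _ => by ring
    rw [h2, integral_const_mul, integral_finsetSum _ fun l _ =>
      integrable_finsetSum _ fun l' _ => (hcomp l l').const_mul _]
    congr 1
    refine Finset.sum_congr rfl fun l hl => ?_
    rw [integral_finsetSum _ fun l' _ => (hcomp l l').const_mul _,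
      Finset.sum_eq_single_of_mem l hl, integral_const_mul]
    · ring
    · intro l' _ hl'
      rw [integral_const_mul, hne l l' hl'.symm, mul_zero]
  rw [h1]
  refine mul_pos (X.w_pos j k) (Finset.sum_pos' (fun l _ => mul_nonneg (sq_nonneg _)
    (integral_nonneg fun ω => mul_self_nonneg _)) ⟨l₀, hl₀, mul_pos (by positivity) ?_⟩)
  exact hT.integral_component_sq_pos hY hC hpos _

end Moments

/-! ### The sums `N_j K_j(α)` -/

/-- The sum `N_j K_j(α) = ∑_l b²(l / B^j) (2 l + 1) l ^ (-α)`. -/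
noncomputable def bandSum (B : ℝ) (b : ℝ → ℝ) (j : ℕ) (α : ℝ) : ℝ :=
  ∑ l ∈ band B j, b (l / B ^ j) ^ 2 * (2 * l + 1) * (l : ℝ) ^ (-α)

/-- A level is active if the window sees some degree there. The other levels, at which all the
needlets vanish, are finite in number. -/
def IsActive (B : ℝ) (b : ℝ → ℝ) (j : ℕ) : Prop := ∃ l ∈ band B j, b (l / B ^ j) ≠ 0

lemma K_eq {B : ℝ} (b : ℝ → ℝ) (X : Cubature B) (j : ℕ) (α : ℝ) :
    K b X j α = (X.N j : ℝ)⁻¹ * bandSum B b j α := rfl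

section Window

variable {B : ℝ} {b : ℝ → ℝ}

lemma IsWindow.bounds (hB : 1 < B) (hb : IsWindow B b) {j l : ℕ} (h : b (l / B ^ j) ≠ 0) :
    B ^ j ≤ B * l ∧ (l : ℝ) ≤ B * B ^ j := by
  have h1 := hb.support (Function.mem_support.2 h)
  have hx : 0 < B ^ j := by positivity
  have hB0 : 0 < B := by linarith
  obtain ⟨h2, h3⟩ := h1
  constructor
  · rw [le_div_iff₀ hx, inv_mul_le_iff₀ hB0] at h2
    exact h2
  · rwa [div_le_iff₀ hx] at h3

lemma IsWindow.one_le (hB : 1 < B) (hb : IsWindow B b) {j l : ℕ} (h : b (l / B ^ j) ≠ 0) :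
    1 ≤ l := by
  rcases Nat.eq_zero_or_pos l with rfl | h0
  · have h1 := (hb.bounds hB h).1
    have : 0 < B ^ j := by positivity
    simp at h1
    linarith
  · exact h0

lemma IsWindow.mem_band (hB : 1 < B) (hb : IsWindow B b) {j l : ℕ} (h : b (l / B ^ j) ≠ 0) :
    l ∈ band B j := by
  have h1 := (hb.bounds hB h).2
  rw [band, Finset.mem_range, Nat.lt_succ_iff]
  exact Nat.le_floor (by rw [pow_succ, mul_comm]; exact h1)

lemma bandSum_term_nonneg (j l : ℕ) (α : ℝ) :
    0 ≤ b (l / B ^ j) ^ 2 * (2 * l + 1) * (l : ℝ) ^ (-α) := by positivity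

lemma bandSum_nonneg (j : ℕ) (α : ℝ) : 0 ≤ bandSum B b j α :=
  Finset.sum_nonneg fun l _ => bandSum_term_nonneg j l α

lemma IsWindow.bandSum_pos (hB : 1 < B) (hb : IsWindow B b) {j : ℕ} (h : IsActive B b j)
    (α : ℝ) : 0 < bandSum B b j α := by
  obtain ⟨l, hl, hbl⟩ := h
  have h1 : (0 : ℝ) < l := by exact_mod_cast hb.one_le hB hbl
  exact Finset.sum_pos' (fun l _ => bandSum_term_nonneg j l α) ⟨l, hl, by positivity⟩

lemma bandSum_eq_zero {j : ℕ} (h : ¬ IsActive B b j) (α : ℝ) : bandSum B b j α = 0 := by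
  refine Finset.sum_eq_zero fun l hl => ?_
  have : b (l / B ^ j) = 0 := by
    by_contra h0
    exact h ⟨l, hl, h0⟩
  simp [this]

lemma energy_eq_zero {Ω : Type*} {Y : (l : ℕ) → Fin (2 * l + 1) → S2 → ℝ} {T : S2 → Ω → ℝ}
    {j : ℕ} (h : ¬ IsActive B b j) (ω : Ω) : energy B b Y T j ω = 0 := by
  refine Finset.sum_eq_zero fun l hl => ?_
  have : b (l / B ^ j) = 0 := by
    by_contra h0
    exact h ⟨l, hl, h0⟩
  simp [this]

/-- Since `B ^ (j - 1) ≤ l ≤ B ^ (j + 1)` in the band, changing the exponent by `h` changes the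
sum by a factor between `B ^ (j h - |h|)` and `B ^ (j h + |h|)`. -/
lemma IsWindow.bandSum_le_exp_mul (hB : 1 < B) (hb : IsWindow B b) (j : ℕ) (α α' : ℝ) :
    bandSum B b j α' ≤
      Real.exp (j * (α - α') * Real.log B + |α - α'| * Real.log B) * bandSum B b j α := by
  rw [bandSum, bandSum, Finset.mul_sum]
  refine Finset.sum_le_sum fun l _ => ?_
  by_cases h0 : b (l / B ^ j) = 0
  · simp [h0]
  have hl : (0 : ℝ) < l := by exact_mod_cast hb.one_le hB h0
  obtain ⟨h1, h2⟩ := hb.bounds hB h0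
  have hB0 : 0 < B := by linarith
  have hx : 0 < B ^ j := by positivity
  have e1 : j * Real.log B ≤ Real.log B + Real.log l := by
    rw [← Real.log_pow, ← Real.log_mul hB0.ne' hl.ne']
    exact Real.log_le_log hx h1
  have e2 : Real.log l ≤ Real.log B + j * Real.log B := by
    rw [← Real.log_pow, ← Real.log_mul hB0.ne' hx.ne']
    exact Real.log_le_log hl h2
  have e3 : (α - α') * (Real.log l - j * Real.log B) ≤ |α - α'| * Real.log B := by
    refine (le_abs_self _).trans ?_
    rw [abs_mul]
    exact mul_le_mul_of_nonneg_left (abs_le.2 ⟨by linarith, by linarith⟩) (abs_nonneg _)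
  have e4 : (l : ℝ) ^ (-α') ≤
      Real.exp (j * (α - α') * Real.log B + |α - α'| * Real.log B) * (l : ℝ) ^ (-α) := by
    rw [Real.rpow_def_of_pos hl, Real.rpow_def_of_pos hl, ← Real.exp_add]
    apply Real.exp_le_exp.2
    nlinarith
  calc b (l / B ^ j) ^ 2 * (2 * l + 1) * (l : ℝ) ^ (-α')
      ≤ b (l / B ^ j) ^ 2 * (2 * l + 1) *
        (Real.exp (j * (α - α') * Real.log B + |α - α'| * Real.log B) * (l : ℝ) ^ (-α)) := by
        gcongr
    _ = _ := by ring

/-- The logarithm `x_j(α)` of the ratio `K_j(α₀) / K_j(α)`. At inactive levels it is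
`log (0 / 0) = 0`. -/
noncomputable def logRatio (B : ℝ) (b : ℝ → ℝ) (α₀ α : ℝ) (j : ℕ) : ℝ :=
  Real.log (bandSum B b j α₀ / bandSum B b j α)

lemma IsWindow.abs_logRatio_sub_le (hB : 1 < B) (hb : IsWindow B b) {j : ℕ} (h : IsActive B b j)
    (α₀ α : ℝ) :
    |logRatio B b α₀ α j - j * (α - α₀) * Real.log B| ≤ |α - α₀| * Real.log B := by
  have h1 := hb.bandSum_pos hB h α
  have h0 := hb.bandSum_pos hB h α₀
  have e1 := hb.bandSum_le_exp_mul hB j α α₀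
  have e2 := hb.bandSum_le_exp_mul hB j α₀ α
  have e1' : logRatio B b α₀ α j ≤ j * (α - α₀) * Real.log B + |α - α₀| * Real.log B := by
    rw [logRatio, Real.log_le_iff_le_exp (by positivity), div_le_iff₀ h1]
    exact e1
  have e2' : -logRatio B b α₀ α j ≤ j * (α₀ - α) * Real.log B + |α₀ - α| * Real.log B := by
    rw [logRatio, ← Real.log_inv, inv_div, Real.log_le_iff_le_exp (by positivity),
      div_le_iff₀ h0]
    exact e2
  rw [abs_sub_comm α₀ α] at e2'
  rw [abs_le]
  constructor <;> linarith

lemma IsWindow.abs_logRatio_le (hB : 1 < B) (hb : IsWindow B b) (j : ℕ) (α₀ α : ℝ) :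
    |logRatio B b α₀ α j| ≤ (j + 1) * |α - α₀| * Real.log B := by
  have hL : 0 < Real.log B := Real.log_pos hB
  by_cases h : IsActive B b j
  · have h1 := hb.abs_logRatio_sub_le hB h α₀ α
    have h2 := abs_sub_abs_le_abs_sub (logRatio B b α₀ α j) (j * (α - α₀) * Real.log B)
    rw [abs_mul, abs_mul, abs_of_pos hL, Nat.abs_cast] at h2
    linarith
  · rw [logRatio, bandSum_eq_zero h, zero_div, Real.log_zero, abs_zero]
    positivity

lemma IsWindow.continuousOn (hb : IsWindow B b) : ContinuousOn b (Ioi 0) :=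
  hb.smooth.continuousOn

lemma IsWindow.exists_bound (hB : 1 < B) (hb : IsWindow B b) : ∃ M : ℝ, 0 < M ∧
    ∀ u, b u ^ 2 ≤ M := by
  have hB0 : 0 < B⁻¹ := by positivity
  obtain ⟨c, hc⟩ := isCompact_Icc.exists_bound_of_continuousOn (s := Icc B⁻¹ B)
    (hb.continuousOn.mono fun u hu => hB0.trans_le hu.1)
  refine ⟨c ^ 2 + 1, by positivity, fun u => ?_⟩
  by_cases hu : b u = 0
  · rw [hu, zero_pow two_ne_zero]; positivity
  · have := hc u (hb.support hu)
    rw [Real.norm_eq_abs] at this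
    have h2 := sq_le_sq' (by linarith [abs_nonneg (b u)]) this
    rw [sq_abs] at h2
    linarith

lemma IsWindow.exists_ne_zero (hB : 1 < B) (hb : IsWindow B b) : ∃ u, 0 < u ∧ b u ≠ 0 := by
  obtain ⟨l, hl⟩ := exists_nat_gt B
  by_contra! h
  have h1 := hb.partition l hl
  have h2 : ∀ j : ℕ, b (l / B ^ j) ^ 2 = 0 := fun j => by
    rw [h _ (div_pos (by linarith) (by positivity)), zero_pow two_ne_zero]
  simp [h2] at h1

/-- From some level on, the band contains at least of the order of `B ^ j` degrees at which the
window is bounded away from zero. -/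
lemma IsWindow.exists_bandSum_ge (hB : 1 < B) (hb : IsWindow B b) (α : ℝ) (hα : 0 ≤ α) :
    ∃ c : ℝ, 0 < c ∧ ∃ j₀ : ℕ, ∀ j, j₀ ≤ j →
      IsActive B b j ∧ c * (B ^ j) ^ 2 * (B ^ j) ^ (-α) ≤ bandSum B b j α := by
  have hB0 : 0 < B := by linarith
  obtain ⟨u, hu, hbu⟩ := hb.exists_ne_zero hB
  have hpos : 0 < b u ^ 2 := by positivity
  have hev : ∀ᶠ v in 𝓝 u, b u ^ 2 / 2 < b v ^ 2 := by
    have hc : ContinuousAt (fun v => b v ^ 2) u :=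
      (hb.continuousOn.continuousAt (Ioi_mem_nhds hu)).pow 2
    exact hc.eventually_const_lt (by linarith)
  obtain ⟨δ, hδ, hball⟩ := Metric.eventually_nhds_iff.1 hev
  set ε := b u ^ 2 / 2 with hε
  have hε0 : 0 < ε := by positivity
  have hd : 0 < δ / 2 := by positivity
  obtain ⟨j₀, hj₀⟩ := ((tendsto_pow_atTop_atTop_of_one_lt hB).eventually_ge_atTop
    (2 / (δ / 2))).exists_forall_of_atTop
  refine ⟨δ / 4 * (ε * (2 * u) * B ^ (-α)), by positivity, j₀, fun j hj => ?_⟩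
  set x := B ^ j with hx
  have hx0 : 0 < x := by positivity
  have hxbig : 2 ≤ δ / 2 * x := by
    have := hj₀ j hj
    rwa [div_le_iff₀ hd, mul_comm] at this
  set I := Finset.Ioc ⌊u * x⌋₊ ⌊(u + δ / 2) * x⌋₊ with hI
  have hIb : ∀ l ∈ I, u * x ≤ l ∧ ε ≤ b (l / x) ^ 2 := by
    intro l hl
    rw [hI, Finset.mem_Ioc] at hl
    have h1 : u * x < l := (Nat.floor_lt (by positivity)).1 hl.1
    have h2 : (l : ℝ) ≤ (u + δ / 2) * x := (Nat.le_floor_iff (by positivity)).1 hl.2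
    refine ⟨h1.le, (hball ?_).le⟩
    rw [Real.dist_eq, abs_lt]
    constructor
    · have : u < l / x := by rwa [lt_div_iff₀ hx0]
      linarith
    · have : l / x ≤ u + δ / 2 := by rwa [div_le_iff₀ hx0]
      linarith
  have hne : ∀ l ∈ I, b (l / x) ≠ 0 := fun l hl h0 => by
    have := (hIb l hl).2
    rw [h0] at this
    simp at this
    linarith
  have hcard : δ / 4 * x ≤ (I.card : ℝ) := by
    rw [hI, Nat.card_Ioc]
    have h1 := Nat.sub_one_lt_floor ((u + δ / 2) * x)
    have h2 := Nat.floor_le (show 0 ≤ u * x by positivity)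
    have h3 : ((⌊(u + δ / 2) * x⌋₊ : ℕ) : ℝ) - (⌊u * x⌋₊ : ℕ) ≤
        ((⌊(u + δ / 2) * x⌋₊ - ⌊u * x⌋₊ : ℕ) : ℝ) := by
      rw [sub_le_iff_le_add]
      exact_mod_cast le_tsub_add
    nlinarith
  have hterm : ∀ l ∈ I, ε * (2 * (u * x)) * (B ^ (-α) * x ^ (-α)) ≤
      b (l / x) ^ 2 * (2 * l + 1) * (l : ℝ) ^ (-α) := by
    intro l hl
    obtain ⟨h1, h2⟩ := hIb l hl
    have hl0 : (0 : ℝ) < l := by exact_mod_cast hb.one_le hB (hne l hl)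
    have h3 : B ^ (-α) * x ^ (-α) ≤ (l : ℝ) ^ (-α) := by
      rw [← Real.mul_rpow hB0.le hx0.le]
      exact Real.rpow_le_rpow_of_nonpos hl0 (hb.bounds hB (hne l hl)).2 (by linarith)
    have h4 : 2 * (u * x) ≤ 2 * (l : ℝ) + 1 := by linarith
    gcongr
  have hsub : I ⊆ band B j := fun l hl => hb.mem_band hB (hne l hl)
  have hIne : I.Nonempty := by
    rw [← Finset.card_pos]
    have : (0 : ℝ) < I.card := by
      have : 0 < δ / 4 * x := by positivity
      linarith
    exact_mod_cast this
  refine ⟨?_, ?_⟩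
  · obtain ⟨l, hl⟩ := hIne
    exact ⟨l, hsub hl, hne l hl⟩
  · calc δ / 4 * (ε * (2 * u) * B ^ (-α)) * x ^ 2 * x ^ (-α)
        = (δ / 4 * x) * (ε * (2 * (u * x)) * (B ^ (-α) * x ^ (-α))) := by ring
      _ ≤ I.card * (ε * (2 * (u * x)) * (B ^ (-α) * x ^ (-α))) := by gcongr
      _ = ∑ l ∈ I, ε * (2 * (u * x)) * (B ^ (-α) * x ^ (-α)) := by
        rw [Finset.sum_const, nsmul_eq_mul]
      _ ≤ ∑ l ∈ I, b (l / x) ^ 2 * (2 * l + 1) * (l : ℝ) ^ (-α) := Finset.sum_le_sum hterm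
      _ ≤ bandSum B b j α := Finset.sum_le_sum_of_subset_of_nonneg hsub
        fun l _ _ => bandSum_term_nonneg j l α

/-- The terms of the sum are at most of the order of `B ^ (j (1 - α))`. -/
lemma IsWindow.exists_term_le (hB : 1 < B) (hb : IsWindow B b) (α : ℝ) (hα : 0 ≤ α) :
    ∃ c : ℝ, 0 < c ∧ ∀ j l : ℕ,
      b (l / B ^ j) ^ 2 * (2 * l + 1) * (l : ℝ) ^ (-α) ≤ c * B ^ j * (B ^ j) ^ (-α) := by
  have hB0 : 0 < B := by linarith
  obtain ⟨M, hM, hbM⟩ := hb.exists_bound hB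
  refine ⟨M * (3 * B) * B⁻¹ ^ (-α), by positivity, fun j l => ?_⟩
  have hx0 : 0 < B ^ j := by positivity
  by_cases h0 : b (l / B ^ j) = 0
  · rw [h0]
    simp only [ne_eq, OfNat.ofNat_ne_zero, not_false_eq_true, zero_pow, zero_mul]
    positivity
  obtain ⟨h1, h2⟩ := hb.bounds hB h0
  have hl : (1 : ℝ) ≤ l := by exact_mod_cast hb.one_le hB h0
  have h3 : (l : ℝ) ^ (-α) ≤ B⁻¹ ^ (-α) * (B ^ j) ^ (-α) := by
    rw [← Real.mul_rpow (by positivity) hx0.le]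
    refine Real.rpow_le_rpow_of_nonpos (by positivity) ?_ (by linarith)
    rw [inv_mul_le_iff₀ hB0]
    exact h1
  calc b (l / B ^ j) ^ 2 * (2 * l + 1) * (l : ℝ) ^ (-α)
      ≤ M * (3 * (B * B ^ j)) * (B⁻¹ ^ (-α) * (B ^ j) ^ (-α)) := by
        have := hbM (l / B ^ j)
        have h4 : 2 * (l : ℝ) + 1 ≤ 3 * (B * B ^ j) := by linarith
        gcongr
    _ = _ := by ring

end Window

/-! ### Concentration of the normalized energies -/

/-- The normalized energy `W_j = ∑_k β_{jk}² / (N_j K_j(α₀))`, equal to `0` at inactive levels. -/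
noncomputable def normEnergy {Ω : Type*} (B : ℝ) (b : ℝ → ℝ)
    (Y : (l : ℕ) → Fin (2 * l + 1) → S2 → ℝ) (T : S2 → Ω → ℝ) (α₀ : ℝ) (j : ℕ) (ω : Ω) : ℝ :=
  energy B b Y T j ω / bandSum B b j α₀

lemma IsRegularSpectrum.exists_abs_sub_le {C : ℕ → ℝ} {α₀ G₀ : ℝ} {G : ℝ → ℝ}
    (hreg : IsRegularSpectrum C α₀ G₀ G) :
    ∃ D : ℝ, 0 < D ∧ ∀ l : ℕ, 1 ≤ l → |G l - G₀| ≤ D / l := by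
  obtain ⟨c, hc0, hc⟩ := hreg.expansion.exists_pos
  obtain ⟨l₀, hl₀⟩ := hc.bound.exists_forall_of_atTop
  obtain ⟨c₀, hc₀, hG⟩ := hreg.bounded
  have hG0 := hreg.G₀_pos
  refine ⟨c * G₀ + (c₀ + G₀) * l₀, by positivity, fun l hl => ?_⟩
  have hl' : (0 : ℝ) < l := by exact_mod_cast hl
  rw [le_div_iff₀ hl']
  rcases le_total l₀ l with h | h
  · have h1 := hl₀ l h
    rw [Real.norm_eq_abs, Real.norm_eq_abs, abs_inv, Nat.abs_cast, div_sub_one hG0.ne', abs_div,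
      abs_of_pos hG0, div_le_iff₀ hG0] at h1
    calc |G l - G₀| * l ≤ c * (l : ℝ)⁻¹ * G₀ * l := by gcongr
      _ = c * G₀ := by field_simp
      _ ≤ _ := by linarith [show 0 ≤ (c₀ + G₀) * l₀ by positivity]
  · have h1 : |G l - G₀| ≤ c₀ + G₀ := by
      have h2 := hG l hl
      have h3 : 0 < c₀⁻¹ := by positivity
      rw [abs_le]
      constructor <;> linarith
    have h2 : (l : ℝ) ≤ l₀ := by exact_mod_cast h
    calc |G l - G₀| * l ≤ (c₀ + G₀) * l₀ := by gcongr
      _ ≤ _ := by linarith [show 0 ≤ c * G₀ by positivity]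

section Concentration

variable {Ω : Type*} [MeasurableSpace Ω] {P : Measure Ω} [IsProbabilityMeasure P]
  {B : ℝ} {b : ℝ → ℝ} {T : S2 → Ω → ℝ} {Y : (l : ℕ) → Fin (2 * l + 1) → S2 → ℝ}
  {C : ℕ → ℝ} {α₀ G₀ : ℝ} {G : ℝ → ℝ}

lemma IsIsotropicGaussianField.memLp_normEnergy (hT : IsIsotropicGaussianField P T)
    (hY : IsHarmonicBasis Y) (B : ℝ) (b : ℝ → ℝ) (α₀ : ℝ) (j : ℕ) :
    MemLp (normEnergy B b Y T α₀ j) 2 P := by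
  unfold normEnergy
  simp only [div_eq_mul_inv]
  exact (hT.memLp_energy hY B b j).mul_const _

lemma integral_sub_const_sq {W : Ω → ℝ} (hW : MemLp W 2 P) (c : ℝ) :
    ∫ ω, (W ω - c) ^ 2 ∂P = Var[W; P] + (∫ ω, W ω ∂P - c) ^ 2 := by
  have hWc : MemLp (fun ω => W ω - c) 2 P := hW.sub (memLp_const c)
  rw [← variance_sub_const hW.aestronglyMeasurable c, variance_eq_sub hWc,
    integral_sub (hW.integrable (by norm_num)) (integrable_const c)]
  simp

/-- The normalized energies converge to `G₀` in mean square, at a geometric rate. -/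
lemma IsIsotropicGaussianField.exists_integral_normEnergy_sub_sq_le
    (hT : IsIsotropicGaussianField P T) (hB : 1 < B) (hb : IsWindow B b) (hY : IsHarmonicBasis Y)
    (hC : HasAngularPowerSpectrum P Y T C) (hreg : IsRegularSpectrum C α₀ G₀ G) :
    ∃ D : ℝ, 0 < D ∧ ∀ j, ∫ ω, (normEnergy B b Y T α₀ j ω - G₀) ^ 2 ∂P ≤ D / B ^ j := by
  have hB0 : 0 < B := by linarith
  have hα : 0 ≤ α₀ := by linarith [hreg.two_lt]
  obtain ⟨c₁, hc₁, j₀, hlow⟩ := hb.exists_bandSum_ge hB α₀ hα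
  obtain ⟨c₂, hc₂, hterm⟩ := hb.exists_term_le hB α₀ hα
  obtain ⟨D, hD, hGD⟩ := hreg.exists_abs_sub_le
  obtain ⟨c₀, hc₀, hG⟩ := hreg.bounded
  set A : ℝ := 3 * c₀ ^ 2 * c₂ / c₁ + (D * B) ^ 2 with hA
  have hA0 : 0 < A := by positivity
  have hmain : ∀ j, j₀ ≤ j →
      ∫ ω, (normEnergy B b Y T α₀ j ω - G₀) ^ 2 ∂P ≤ A / B ^ j := by
    intro j hj
    obtain ⟨hact, hlowj⟩ := hlow j hj
    have hκ := hb.bandSum_pos hB hact α₀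
    set κ := bandSum B b j α₀ with hκdef
    set x := B ^ j with hx
    have hx0 : 0 < x := by positivity
    have hx1 : 1 ≤ x := one_le_pow₀ hB.le
    set t : ℕ → ℝ := fun l => b (l / x) ^ 2 * (2 * l + 1) * (l : ℝ) ^ (-α₀) with ht
    have ht0 : ∀ l, 0 ≤ t l := fun l => bandSum_term_nonneg j l α₀
    have htC : ∀ l : ℕ, b (l / x) ^ 2 * ((2 * l + 1) * C l) = t l * G l := by
      intro l
      by_cases h0 : b (l / x) = 0
      · simp [ht, h0]
      · rw [hreg.spectrum l (hb.one_le hB h0), ht]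
        ring
    have hvar : Var[energy B b Y T j; P] ≤ 3 * (c₀ ^ 2 * (c₂ * x * x ^ (-α₀)) * κ) := by
      refine (hT.variance_energy_le hY hC B b j).trans ?_
      refine mul_le_mul_of_nonneg_left ?_ (by norm_num)
      rw [hκdef, bandSum, Finset.mul_sum]
      refine Finset.sum_le_sum fun l _ => ?_
      rw [htC]
      by_cases h0 : b (l / x) = 0
      · have : t l = 0 := by simp [ht, h0]
        rw [this, h0]
        simp
      · have h1 := hG l (hb.one_le hB h0)
        have h2 : 0 < c₀⁻¹ := by positivity
        have h3 : (G l) ^ 2 ≤ c₀ ^ 2 := by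
          apply pow_le_pow_left₀ (by linarith) h1.2
        calc (t l * G l) ^ 2 = (G l) ^ 2 * (t l * t l) := by ring
          _ ≤ c₀ ^ 2 * (c₂ * x * x ^ (-α₀) * t l) := by
            have := hterm j l
            have h4 := ht0 l
            gcongr
          _ = c₀ ^ 2 * (c₂ * x * x ^ (-α₀)) * t l := by ring
    have hbias : |∫ ω, energy B b Y T j ω ∂P - G₀ * κ| ≤ D * B / x * κ := by
      rw [hT.integral_energy hY hC, hκdef, bandSum, Finset.mul_sum, ← Finset.sum_sub_distrib,
        Finset.mul_sum]
      refine (Finset.abs_sum_le_sum_abs _ _).trans (Finset.sum_le_sum fun l _ => ?_)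
      rw [htC]
      change |t l * G l - G₀ * t l| ≤ D * B / x * t l
      rw [mul_comm G₀, ← mul_sub, abs_mul, abs_of_nonneg (ht0 l), mul_comm]
      by_cases h0 : b (l / x) = 0
      · have : t l = 0 := by simp [ht, h0]
        simp [this]
      · have hl := hb.one_le hB h0
        have hl' : (0 : ℝ) < l := by exact_mod_cast hl
        refine mul_le_mul_of_nonneg_right ((hGD l hl).trans ?_) (ht0 l)
        rw [div_le_div_iff₀ hl' hx0, mul_assoc]
        exact mul_le_mul_of_nonneg_left (hb.bounds hB h0).1 hD.le
    have hW : normEnergy B b Y T α₀ j = fun ω => κ⁻¹ * energy B b Y T j ω := by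
      ext ω
      rw [normEnergy, div_eq_inv_mul]
    rw [integral_sub_const_sq (hT.memLp_normEnergy hY B b α₀ j), hW, variance_const_mul,
      integral_const_mul]
    have h1 : (κ⁻¹) ^ 2 * Var[energy B b Y T j; P] ≤ 3 * c₀ ^ 2 * c₂ / c₁ / x := by
      calc (κ⁻¹) ^ 2 * Var[energy B b Y T j; P]
          ≤ (κ⁻¹) ^ 2 * (3 * (c₀ ^ 2 * (c₂ * x * x ^ (-α₀)) * κ)) := by gcongr
        _ = 3 * c₀ ^ 2 * c₂ * (x * x ^ (-α₀)) / κ := by field_simp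
        _ ≤ 3 * c₀ ^ 2 * c₂ * (x * x ^ (-α₀)) / (c₁ * x ^ 2 * x ^ (-α₀)) := by
          gcongr
        _ = _ := by
          have : x ^ (-α₀) ≠ 0 := (Real.rpow_pos_of_pos hx0 _).ne'
          field_simp
    have h2 : (κ⁻¹ * ∫ ω, energy B b Y T j ω ∂P - G₀) ^ 2 ≤ (D * B) ^ 2 / x := by
      have h3 : |κ⁻¹ * ∫ ω, energy B b Y T j ω ∂P - G₀| ≤ D * B / x := by
        have : κ⁻¹ * ∫ ω, energy B b Y T j ω ∂P - G₀
            = κ⁻¹ * (∫ ω, energy B b Y T j ω ∂P - G₀ * κ) := by field_simp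
        rw [this, abs_mul, abs_of_pos (inv_pos.2 hκ), inv_mul_le_iff₀ hκ, mul_comm κ]
        exact hbias
      rw [← sq_abs]
      calc |κ⁻¹ * ∫ ω, energy B b Y T j ω ∂P - G₀| ^ 2 ≤ (D * B / x) ^ 2 := by gcongr
        _ = (D * B) ^ 2 / x / x := by field_simp
        _ ≤ (D * B) ^ 2 / x := div_le_self (by positivity) hx1
    rw [hA, add_div]
    exact add_le_add h1 h2
  set v : ℕ → ℝ := fun j => ∫ ω, (normEnergy B b Y T α₀ j ω - G₀) ^ 2 ∂P with hv
  have hv0 : ∀ j, 0 ≤ v j := fun j => integral_nonneg fun _ => sq_nonneg _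
  refine ⟨A + ∑ j ∈ Finset.range j₀, v j * B ^ j,
    add_pos_of_pos_of_nonneg hA0 (Finset.sum_nonneg fun j _ => mul_nonneg (hv0 j) (by positivity)),
    fun j => ?_⟩
  have hx0 : 0 < B ^ j := by positivity
  have hs : 0 ≤ ∑ j ∈ Finset.range j₀, v j * B ^ j :=
    Finset.sum_nonneg fun j _ => mul_nonneg (hv0 j) (by positivity)
  rcases le_or_gt j₀ j with h | h
  · refine (hmain j h).trans ?_
    gcongr
    linarith
  · rw [le_div_iff₀ hx0]
    have := Finset.single_le_sum (f := fun j => v j * B ^ j)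
      (fun j _ => mul_nonneg (hv0 j) (by positivity)) (Finset.mem_range.2 h)
    simp only [hv] at this ⊢
    linarith

/-- The `L¹` form of the rate, written with `r ^ (2 j) = B ^ (-j / 2)`. -/
lemma IsIsotropicGaussianField.exists_integral_abs_normEnergy_sub_le
    (hT : IsIsotropicGaussianField P T) (hB : 1 < B) (hb : IsWindow B b) (hY : IsHarmonicBasis Y)
    (hC : HasAngularPowerSpectrum P Y T C) (hreg : IsRegularSpectrum C α₀ G₀ G) :
    ∃ D r : ℝ, 0 < D ∧ 0 < r ∧ r < 1 ∧
      ∀ j, ∫ ω, |normEnergy B b Y T α₀ j ω - G₀| ∂P ≤ D * r ^ (2 * j) := by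
  obtain ⟨D, hD, h⟩ := hT.exists_integral_normEnergy_sub_sq_le hB hb hY hC hreg
  have hB0 : 0 < B := by linarith
  refine ⟨√D, √√B⁻¹, by positivity, by positivity, ?_, fun j => ?_⟩
  · rw [Real.sqrt_lt' one_pos, one_pow, Real.sqrt_lt' one_pos, one_pow]
    exact inv_lt_one_of_one_lt₀ hB
  · have hW : MemLp (fun ω => normEnergy B b Y T α₀ j ω - G₀) 2 P :=
      (hT.memLp_normEnergy hY B b α₀ j).sub (memLp_const _)
    have hv := variance_nonneg (fun ω => |normEnergy B b Y T α₀ j ω - G₀|) P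
    have hWabs : MemLp (fun ω => |normEnergy B b Y T α₀ j ω - G₀|) 2 P := hW.abs
    rw [variance_eq_sub hWabs] at hv
    have h1 : (∫ ω, |normEnergy B b Y T α₀ j ω - G₀| ∂P) ^ 2 ≤ D / B ^ j := by
      refine le_trans ?_ (h j)
      simpa using hv
    have h2 : (√D * √√B⁻¹ ^ (2 * j)) ^ 2 = D / B ^ j := by
      rw [mul_pow, Real.sq_sqrt hD.le, pow_mul, Real.sq_sqrt (Real.sqrt_nonneg _), ← pow_mul,
        mul_comm j 2, pow_mul, Real.sq_sqrt (by positivity), inv_pow, div_eq_mul_inv]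
    rw [← h2] at h1
    exact le_of_sq_le_sq h1 (by positivity)

end Concentration

/-! ### A quantitative Jensen inequality -/

/-- A lower bound for the convexity gap of `exp` at `0`; it grows only linearly at `-∞`, whence the
division by the bound `D` on the argument. -/
lemma sq_div_le_exp_sub {t d D : ℝ} (hd : 0 ≤ d) (hdt : d ≤ 2 * |t|) (hdD : d ≤ D) (hD : 1 ≤ D) :
    d ^ 2 / (16 * D) ≤ Real.exp t - 1 - t := by
  have h16 : d ^ 2 / (16 * D) ≤ d ^ 2 / 16 :=
    div_le_div_of_nonneg_left (sq_nonneg d) (by norm_num) (by linarith)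
  have hsq : d ^ 2 ≤ 4 * t ^ 2 := by
    have := pow_le_pow_left₀ hd hdt 2
    rw [mul_pow, sq_abs] at this
    linarith
  rcases le_total 0 t with ht | ht
  · have := Real.quadratic_le_exp_of_nonneg ht
    linarith [sq_nonneg t]
  · rw [abs_of_nonpos ht] at hdt
    rcases le_total (-2) t with h2 | h2
    · have h3 := Real.add_one_le_exp (t / 2)
      have h4 : Real.exp t = Real.exp (t / 2) ^ 2 := by
        rw [← Real.exp_nat_mul]; congr 1; push_cast; ring
      have h5 := pow_le_pow_left₀ (by linarith) h3 2
      rw [h4]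
      linarith
    · have h3 := Real.exp_pos t
      have h4 : d ^ 2 / (16 * D) ≤ d / 16 := by
        rw [div_le_div_iff₀ (by linarith) (by norm_num)]
        nlinarith
      linarith

/-- A quantitative Jensen inequality with perturbed weights. The two indices `i`, `k`, of weight at
least `π`, at which `x` takes distant values produce the strict gain; the values `w` are only
controlled where `q` holds, and the rest of the index set enters through its weight. -/
lemma jensen_gap {ι : Type*} [DecidableEq ι] (s : Finset ι) (q : ι → Prop) [DecidablePred q]
    (p x w : ι → ℝ)
    {g π d D₁ D : ℝ} {i k : ι} (hp : ∀ j ∈ s, 0 ≤ p j) (hp1 : ∑ j ∈ s, p j = 1)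
    (hw : ∀ j ∈ s, 0 ≤ w j) (hg : 0 ≤ g) (hgw : ∀ j ∈ s, q j → g ≤ w j)
    (hi : i ∈ s) (hqi : q i) (hpi : π ≤ p i) (hk : k ∈ s) (hqk : q k) (hpk : π ≤ p k)
    (hd : 0 ≤ d) (hdik : d ≤ |x i - x k|) (hdD : d ≤ D₁) (hD₁ : 1 ≤ D₁)
    (hD : ∀ j ∈ s, ∀ j' ∈ s, |x j - x j'| ≤ D) :
    g * (1 - (∑ j ∈ s with ¬ q j, p j) * (1 + D) + π * (d ^ 2 / (16 * D₁))) ≤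
      ∑ j ∈ s, p j * Real.exp (x j - ∑ j' ∈ s, p j' * x j') * w j := by
  set μ := ∑ j ∈ s, p j * x j with hμ
  have hsum0 : ∑ j ∈ s, p j * (1 + (x j - μ)) = 1 := by
    have : ∀ j, p j * (1 + (x j - μ)) = p j + p j * x j - p j * μ := fun j => by ring
    simp only [this, Finset.sum_sub_distrib, Finset.sum_add_distrib, ← Finset.sum_mul, hp1, ← hμ]
    ring
  have ht : ∀ j ∈ s, x j - μ ≤ D := by
    intro j hj
    have : x j - μ = ∑ j' ∈ s, p j' * (x j - x j') := by
      simp only [mul_sub, Finset.sum_sub_distrib, ← Finset.sum_mul, hp1, ← hμ, one_mul]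
    rw [this]
    calc ∑ j' ∈ s, p j' * (x j - x j') ≤ ∑ j' ∈ s, p j' * D := by
          refine Finset.sum_le_sum fun j' hj' => mul_le_mul_of_nonneg_left ?_ (hp j' hj')
          exact (le_abs_self _).trans (hD j hj j' hj')
      _ = D := by rw [← Finset.sum_mul, hp1, one_mul]
  -- one of the two indices is at distance at least `d / 2` from the mean
  obtain ⟨m, hm, hqm, hpm, hdm⟩ : ∃ m ∈ s, q m ∧ π ≤ p m ∧ d ≤ 2 * |x m - μ| := by
    by_contra! hcon
    have h1 := hcon i hi hqi hpi
    have h2 := hcon k hk hqk hpk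
    have h3 : |x i - x k| ≤ |x i - μ| + |x k - μ| := by
      have := abs_sub (x i - μ) (x k - μ)
      rwa [sub_sub_sub_cancel_right] at this
    linarith
  have hgain := sq_div_le_exp_sub hd hdm hdD hD₁
  have hgain0 : 0 ≤ d ^ 2 / (16 * D₁) := by positivity
  have hgood : ∑ j ∈ s with q j, p j * (1 + (x j - μ)) + π * (d ^ 2 / (16 * D₁)) ≤
      ∑ j ∈ s with q j, p j * Real.exp (x j - μ) := by
    have hmem : m ∈ s.filter q := Finset.mem_filter.2 ⟨hm, hqm⟩
    rw [← Finset.add_sum_erase _ _ hmem, ← Finset.add_sum_erase _ _ hmem]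
    have h1 : ∑ j ∈ (s.filter q).erase m, p j * (1 + (x j - μ)) ≤
        ∑ j ∈ (s.filter q).erase m, p j * Real.exp (x j - μ) := by
      refine Finset.sum_le_sum fun j hj => mul_le_mul_of_nonneg_left ?_ (hp j ?_)
      · linarith [Real.add_one_le_exp (x j - μ)]
      · exact (Finset.mem_filter.1 (Finset.mem_of_mem_erase hj)).1
    have h2 : p m * (1 + (x m - μ)) + π * (d ^ 2 / (16 * D₁)) ≤ p m * Real.exp (x m - μ) := by
      have h3 : π * (d ^ 2 / (16 * D₁)) ≤ p m * (Real.exp (x m - μ) - 1 - (x m - μ)) :=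
        mul_le_mul hpm hgain hgain0 (hp m hm)
      linarith
    linarith
  have hbad : ∑ j ∈ s with ¬ q j, p j * (1 + (x j - μ)) ≤ (∑ j ∈ s with ¬ q j, p j) * (1 + D) := by
    rw [Finset.sum_mul]
    refine Finset.sum_le_sum fun j hj => ?_
    have hjs := (Finset.mem_filter.1 hj).1
    exact mul_le_mul_of_nonneg_left (by linarith [ht j hjs]) (hp j hjs)
  have hsplit := Finset.sum_filter_add_sum_filter_not s q fun j => p j * (1 + (x j - μ))
  rw [hsum0] at hsplit
  calc g * (1 - (∑ j ∈ s with ¬ q j, p j) * (1 + D) + π * (d ^ 2 / (16 * D₁)))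
      ≤ g * ∑ j ∈ s with q j, p j * Real.exp (x j - μ) := by
        refine mul_le_mul_of_nonneg_left ?_ hg
        linarith
    _ = ∑ j ∈ s with q j, p j * Real.exp (x j - μ) * g := by
        rw [mul_comm, Finset.sum_mul]
    _ ≤ ∑ j ∈ s with q j, p j * Real.exp (x j - μ) * w j := by
        refine Finset.sum_le_sum fun j hj => ?_
        obtain ⟨hjs, hjq⟩ := Finset.mem_filter.1 hj
        exact mul_le_mul_of_nonneg_left (hgw j hjs hjq)
          (mul_nonneg (hp j hjs) (Real.exp_pos _).le)
    _ ≤ _ := by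
        refine Finset.sum_le_sum_of_subset_of_nonneg (Finset.filter_subset _ _) fun j hj _ => ?_
        exact mul_nonneg (mul_nonneg (hp j hj) (Real.exp_pos _).le) (hw j hj)

/-! ### The weights of the levels -/

section Weights

variable {B : ℝ} (X : Cubature B)

/-- The share `p_j = N_j / ∑_{i ≤ J} N_i` of level `j` among the levels up to `J`. -/
noncomputable def weight (J j : ℕ) : ℝ := X.N j / total X J

/-- The total share of the levels `j ≤ J / 2`. -/
noncomputable def lowWeight (J : ℕ) : ℝ := ∑ j ∈ Finset.Icc 1 J with ¬ J < 2 * j, weight X J j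

variable {X}

lemma N_pos (hB : 1 < B) (j : ℕ) : (0 : ℝ) < X.N j := by
  obtain ⟨c₁, c₂, hc₁, -, h⟩ := X.N_size
  exact lt_of_lt_of_le (by positivity) (h j).1

lemma total_pos (hB : 1 < B) {J : ℕ} (hJ : 1 ≤ J) : 0 < total X J :=
  Finset.sum_pos (fun j _ => N_pos hB j) ⟨1, by simp [hJ]⟩

lemma weight_nonneg (J j : ℕ) : 0 ≤ weight X J j :=
  div_nonneg (Nat.cast_nonneg _) (Finset.sum_nonneg fun _ _ => Nat.cast_nonneg _)

lemma sum_weight (hB : 1 < B) {J : ℕ} (hJ : 1 ≤ J) : ∑ j ∈ Finset.Icc 1 J, weight X J j = 1 := by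
  simp only [weight]
  rw [← Finset.sum_div]
  exact div_self (total_pos hB hJ).ne'

lemma weight_le_one (hB : 1 < B) {J j : ℕ} (hj : j ∈ Finset.Icc 1 J) : weight X J j ≤ 1 := by
  have hJ : 1 ≤ J := (Finset.mem_Icc.1 hj).1.trans (Finset.mem_Icc.1 hj).2
  rw [← sum_weight (X := X) hB hJ]
  exact Finset.single_le_sum (fun i _ => weight_nonneg J i) hj

lemma lowWeight_nonneg (J : ℕ) : 0 ≤ lowWeight X J :=
  Finset.sum_nonneg fun _ _ => weight_nonneg _ _

/-- The levels `J` and `J - 3` keep a fixed share, since `N_j` grows geometrically. -/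
lemma exists_le_weight (hB : 1 < B) : ∃ π : ℝ, 0 < π ∧ ∀ J, 4 ≤ J →
    π ≤ weight X J J ∧ π ≤ weight X J (J - 3) := by
  obtain ⟨c₁, c₂, hc₁, hc₂, hN⟩ := X.N_size
  have hB0 : 0 < B := by linarith
  set β := B ^ 2 with hβ
  have hβ1 : 1 < β := one_lt_pow₀ hB two_ne_zero
  have hpow : ∀ j, B ^ (2 * j) = β ^ j := fun j => pow_mul B 2 j
  have htot : ∀ J, total X J ≤ c₂ * (β / (β - 1)) * β ^ J := by
    intro J
    have hgeom : ∑ j ∈ Finset.range (J + 1), β ^ j ≤ β / (β - 1) * β ^ J := by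
      rw [geom_sum_eq hβ1.ne', div_mul_eq_mul_div, pow_succ]
      apply div_le_div_of_nonneg_right _ (by linarith)
      linarith [mul_comm (β ^ J) β]
    calc total X J ≤ ∑ j ∈ Finset.Icc 1 J, c₂ * β ^ j :=
          Finset.sum_le_sum fun j _ => by rw [← hpow]; exact (hN j).2
      _ = c₂ * ∑ j ∈ Finset.Icc 1 J, β ^ j := by rw [Finset.mul_sum]
      _ ≤ c₂ * ∑ j ∈ Finset.range (J + 1), β ^ j := by
          refine mul_le_mul_of_nonneg_left ?_ hc₂.le
          refine Finset.sum_le_sum_of_subset_of_nonneg (fun j hj => ?_) fun j _ _ => by positivity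
          rw [Finset.mem_Icc] at hj
          rw [Finset.mem_range]
          omega
      _ ≤ c₂ * (β / (β - 1) * β ^ J) := by gcongr
      _ = _ := by ring
  have hβ' : 0 < β - 1 := by linarith
  refine ⟨c₁ / (c₂ * (β / (β - 1)) * β ^ 3), by positivity, fun J hJ => ?_⟩
  have ht := total_pos (X := X) hB (J := J) (by omega)
  have key : ∀ j, J ≤ j + 3 → c₁ / (c₂ * (β / (β - 1)) * β ^ 3) ≤ weight X J j := by
    intro j hj
    rw [weight, div_le_div_iff₀ (by positivity) ht]
    calc c₁ * total X J ≤ c₁ * (c₂ * (β / (β - 1)) * β ^ J) := by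
          gcongr; exact htot J
      _ ≤ c₁ * (c₂ * (β / (β - 1)) * β ^ (j + 3)) := by
          gcongr
          exact hβ1.le
      _ = c₁ * β ^ j * (c₂ * (β / (β - 1)) * β ^ 3) := by ring
      _ ≤ _ := by
          gcongr
          rw [← hpow]
          exact (hN j).1
  exact ⟨key J (by omega), key (J - 3) (by omega)⟩

/-- The levels `j ≤ J / 2` have an exponentially small share. -/
lemma exists_lowWeight_le (hB : 1 < B) : ∃ c : ℝ, 0 < c ∧ ∀ J, 1 ≤ J →
    lowWeight X J ≤ c * (J * (B⁻¹) ^ J) := by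
  obtain ⟨c₁, c₂, hc₁, hc₂, hN⟩ := X.N_size
  have hB0 : 0 < B := by linarith
  refine ⟨c₂ / c₁, by positivity, fun J hJ => ?_⟩
  have ht := total_pos (X := X) hB hJ
  have htot : c₁ * B ^ (2 * J) ≤ total X J :=
    (hN J).1.trans (Finset.single_le_sum (f := fun j => (X.N j : ℝ))
      (fun i _ => Nat.cast_nonneg _) (Finset.mem_Icc.2 ⟨hJ, le_rfl⟩))
  have hterm : ∀ j ∈ (Finset.Icc 1 J).filter fun j => ¬ J < 2 * j,
      weight X J j ≤ c₂ / c₁ * (B⁻¹) ^ J := by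
    intro j hj
    have hj2 : 2 * j ≤ J := not_lt.1 (Finset.mem_filter.1 hj).2
    calc weight X J j ≤ c₂ * B ^ J / (c₁ * B ^ (2 * J)) := by
          rw [weight]
          have h1 : (X.N j : ℝ) ≤ c₂ * B ^ J := (hN j).2.trans (by gcongr; exact hB.le)
          gcongr
      _ = _ := by
          rw [two_mul, pow_add, inv_pow]
          field_simp
  calc lowWeight X J ≤ ∑ _j ∈ (Finset.Icc 1 J).filter fun j => ¬ J < 2 * j,
        c₂ / c₁ * (B⁻¹) ^ J := Finset.sum_le_sum hterm
    _ = (((Finset.Icc 1 J).filter fun j => ¬ J < 2 * j).card : ℝ) * (c₂ / c₁ * (B⁻¹) ^ J) := by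
        rw [Finset.sum_const, nsmul_eq_mul]
    _ ≤ J * (c₂ / c₁ * (B⁻¹) ^ J) := by
        gcongr
        calc _ ≤ (Finset.Icc 1 J).card := Finset.card_filter_le _ _
          _ = J := by simp
    _ = _ := by ring

end Weights

/-! ### The profile estimate for given normalized energies -/

section Consistency

variable {B : ℝ} (X : Cubature B) (b : ℝ → ℝ) (α₀ : ℝ)

/-- The deviation of the normalized energies `w` from `G₀`: the levels `j > J / 2` count fully,
the levels `j ≤ J / 2` only with their small shares. -/
noncomputable def fluctuation (G₀ : ℝ) (w : ℕ → ℝ) (J : ℕ) : ℝ :=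
  ∑ j ∈ Finset.Icc 1 J with J < 2 * j, |w j - G₀| +
    ∑ j ∈ Finset.Icc 1 J with ¬ J < 2 * j, weight X J j * |w j - G₀|

/-- The profile estimate `Ĝ(α) = ∑_j p_j exp(x_j(α)) w_j` in terms of normalized energies. -/
noncomputable def fitted (w : ℕ → ℝ) (J : ℕ) (α : ℝ) : ℝ :=
  ∑ j ∈ Finset.Icc 1 J, weight X J j * Real.exp (logRatio B b α₀ α j) * w j

/-- The mean `∑_j p_j x_j(α)` of the log-ratios. -/
noncomputable def meanLogRatio (J : ℕ) (α : ℝ) : ℝ :=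
  ∑ j ∈ Finset.Icc 1 J, weight X J j * logRatio B b α₀ α j

variable {X b α₀}

lemma fluctuation_nonneg (G₀ : ℝ) (w : ℕ → ℝ) (J : ℕ) : 0 ≤ fluctuation X G₀ w J :=
  add_nonneg (Finset.sum_nonneg fun _ _ => abs_nonneg _)
    (Finset.sum_nonneg fun _ _ => mul_nonneg (weight_nonneg _ _) (abs_nonneg _))

lemma abs_sub_le_fluctuation (G₀ : ℝ) (w : ℕ → ℝ) {J j : ℕ} (hj : j ∈ Finset.Icc 1 J)
    (hJ : J < 2 * j) : |w j - G₀| ≤ fluctuation X G₀ w J := by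
  have h1 := Finset.single_le_sum (f := fun j => |w j - G₀|) (fun i _ => abs_nonneg _)
    ((Finset.mem_filter (p := fun j => J < 2 * j)).2 ⟨hj, hJ⟩)
  have h2 : 0 ≤ ∑ j ∈ Finset.Icc 1 J with ¬ J < 2 * j, weight X J j * |w j - G₀| :=
    Finset.sum_nonneg fun _ _ => mul_nonneg (weight_nonneg _ _) (abs_nonneg _)
  simp only [fluctuation]
  linarith

lemma abs_sum_weight_sub_le (hB : 1 < B) (G₀ : ℝ) (w : ℕ → ℝ) {J : ℕ} (hJ : 1 ≤ J) :
    |∑ j ∈ Finset.Icc 1 J, weight X J j * w j - G₀| ≤ fluctuation X G₀ w J := by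
  have h1 : ∑ j ∈ Finset.Icc 1 J, weight X J j * w j - G₀
      = ∑ j ∈ Finset.Icc 1 J, weight X J j * (w j - G₀) := by
    simp only [mul_sub, Finset.sum_sub_distrib, ← Finset.sum_mul, sum_weight hB hJ, one_mul]
  rw [h1]
  refine (Finset.abs_sum_le_sum_abs _ _).trans ?_
  simp only [abs_mul, abs_of_nonneg (weight_nonneg (X := X) J _)]
  rw [← Finset.sum_filter_add_sum_filter_not _ fun j => J < 2 * j, fluctuation]
  refine add_le_add_left (Finset.sum_le_sum fun j hj => ?_) _
  have := weight_le_one (X := X) hB (Finset.mem_filter.1 hj).1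
  exact mul_le_of_le_one_left (abs_nonneg _) this

lemma meanLogRatio_self (J : ℕ) : meanLogRatio X b α₀ J α₀ = 0 := by
  refine Finset.sum_eq_zero fun j _ => ?_
  rw [logRatio]
  rcases eq_or_ne (bandSum B b j α₀) 0 with h | h
  · simp [h]
  · simp [div_self h]

lemma fitted_self (w : ℕ → ℝ) (J : ℕ) :
    fitted X b α₀ w J α₀ = ∑ j ∈ Finset.Icc 1 J, weight X J j * w j := by
  refine Finset.sum_congr rfl fun j _ => ?_
  rw [logRatio]
  rcases eq_or_ne (bandSum B b j α₀) 0 with h | h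
  · simp [h]
  · simp [div_self h]

/-- As long as `J |α - α₀|` is small, the profile estimate at `α` is close to that at `α₀`. -/
lemma abs_fitted_sub_le (hB : 1 < B) (hb : IsWindow B b) {w : ℕ → ℝ} (hw : ∀ j, 0 ≤ w j)
    (J : ℕ) (α : ℝ) :
    |fitted X b α₀ w J α - fitted X b α₀ w J α₀| ≤
      (Real.exp ((J + 1) * |α - α₀| * Real.log B) - 1) * fitted X b α₀ w J α₀ := by
  have hL : 0 < Real.log B := Real.log_pos hB
  rw [fitted_self, fitted, ← Finset.sum_sub_distrib, Finset.mul_sum]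
  refine (Finset.abs_sum_le_sum_abs _ _).trans (Finset.sum_le_sum fun j hj => ?_)
  have h0 : 0 ≤ weight X J j * w j := mul_nonneg (weight_nonneg _ _) (hw j)
  have h1 : weight X J j * Real.exp (logRatio B b α₀ α j) * w j - weight X J j * w j
      = (Real.exp (logRatio B b α₀ α j) - 1) * (weight X J j * w j) := by ring
  rw [h1, abs_mul, abs_of_nonneg h0]
  refine mul_le_mul_of_nonneg_right ?_ h0
  have h2 := hb.abs_logRatio_le hB j α₀ α
  have hjJ : (j : ℝ) ≤ J := by exact_mod_cast (Finset.mem_Icc.1 hj).2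
  have h3 : |logRatio B b α₀ α j| ≤ (J + 1) * |α - α₀| * Real.log B := by
    refine h2.trans ?_
    gcongr
  set x := logRatio B b α₀ α j
  set y := (J + 1) * |α - α₀| * Real.log B
  have h4 : Real.exp x ≤ Real.exp y := Real.exp_le_exp.2 ((le_abs_self x).trans h3)
  have h5 : 1 - Real.exp x ≤ Real.exp y - 1 := by
    have h6 : Real.exp (-y) ≤ Real.exp x := Real.exp_le_exp.2 (by linarith [neg_abs_le x])
    have h7 : 2 ≤ Real.exp y + Real.exp (-y) := by
      nlinarith [Real.add_one_le_exp y, Real.add_one_le_exp (-y)]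
    linarith
  rw [abs_le]
  constructor <;> linarith

/-- The loss caused by the levels `j ≤ J / 2` in the Jensen inequality. -/
noncomputable def lowLoss (X : Cubature B) (H : ℝ) (J : ℕ) : ℝ :=
  lowWeight X J * (1 + 2 * (J + 1) * H * Real.log B)

lemma tendsto_sq_mul_lowWeight_mul (hB : 1 < B) {D : ℝ} (hD : 0 ≤ D) :
    Tendsto (fun J : ℕ => (J : ℝ) ^ 2 * (lowWeight X J * (1 + D * (J + 1)))) atTop (𝓝 0) := by
  obtain ⟨c, hc, h⟩ := exists_lowWeight_le (X := X) hB
  have hlim := (tendsto_pow_const_mul_const_pow_of_abs_lt_one 4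
    (r := B⁻¹) (by rw [abs_of_pos (by positivity)]; exact inv_lt_one_of_one_lt₀ hB)).const_mul
    (c * (1 + 2 * D))
  rw [mul_zero] at hlim
  refine tendsto_of_tendsto_of_tendsto_of_le_of_le' tendsto_const_nhds hlim ?_ ?_
  · refine Eventually.of_forall fun J => ?_
    have := lowWeight_nonneg (X := X) J
    positivity
  · filter_upwards [eventually_ge_atTop 1] with J hJ
    have h1 := h J hJ
    have hJ' : (1 : ℝ) ≤ J := by exact_mod_cast hJ
    have hB' : 0 < B⁻¹ := by positivity
    calc (J : ℝ) ^ 2 * (lowWeight X J * (1 + D * (J + 1)))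
        ≤ (J : ℝ) ^ 2 * (c * (J * B⁻¹ ^ J) * ((1 + 2 * D) * J)) := by
          have h2 : 1 + D * ((J : ℝ) + 1) ≤ (1 + 2 * D) * J := by nlinarith
          gcongr
      _ = _ := by ring

lemma tendsto_sq_mul_lowLoss (hB : 1 < B) {H : ℝ} (hH : 0 ≤ H) :
    Tendsto (fun J : ℕ => (J : ℝ) ^ 2 * lowLoss X H J) atTop (𝓝 0) := by
  have hL : 0 < Real.log B := Real.log_pos hB
  have := tendsto_sq_mul_lowWeight_mul (X := X) hB (D := 2 * H * Real.log B) (by positivity)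
  refine this.congr fun J => ?_
  rw [lowLoss]
  ring

lemma tendsto_sq_mul_lowWeight (hB : 1 < B) :
    Tendsto (fun J : ℕ => (J : ℝ) ^ 2 * lowWeight X J) atTop (𝓝 0) := by
  have := tendsto_sq_mul_lowWeight_mul (X := X) hB le_rfl
  simpa using this

/-- The profiled pseudo-likelihood separates `α` from `α₀` quadratically. The log-ratios at the
levels `J` and `J - 3` differ by at least `|α - α₀| log B`, and the levels `j ≤ J / 2`, where the
normalized energies need not be close to `G₀`, have a negligible share. -/
lemma exists_le_fitted_mul_exp (hB : 1 < B) (hb : IsWindow B b) {H : ℝ} (hH : 0 ≤ H)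
    (hα₀ : 0 ≤ α₀) : ∃ a : ℝ, 0 < a ∧ ∃ J₀ : ℕ, ∀ J, J₀ ≤ J → ∀ (G₀ : ℝ) (w : ℕ → ℝ),
      (∀ j, 0 ≤ w j) → fluctuation X G₀ w J ≤ G₀ → ∀ α, |α - α₀| ≤ H →
      (G₀ - fluctuation X G₀ w J) * (1 - lowLoss X H J + a * (α - α₀) ^ 2) ≤
        fitted X b α₀ w J α * Real.exp (-meanLogRatio X b α₀ J α) := by
  have hL : 0 < Real.log B := Real.log_pos hB
  set L := Real.log B with hLdef
  obtain ⟨π, hπ, hweight⟩ := exists_le_weight (X := X) hB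
  obtain ⟨c, -, j₀, hact⟩ := hb.exists_bandSum_ge hB α₀ hα₀
  set D₁ := 1 + H * L with hD₁
  have hD₁1 : 1 ≤ D₁ := by
    have : 0 ≤ H * L := by positivity
    linarith
  refine ⟨π * (L ^ 2 / (16 * D₁)), by positivity, max 8 (j₀ + 3), fun J hJ G₀ w hw he α hα => ?_⟩
  have hJ8 : 8 ≤ J := (le_max_left _ _).trans hJ
  have hJj : j₀ + 3 ≤ J := (le_max_right _ _).trans hJ
  obtain ⟨hwJ, hwJ3⟩ := hweight J (by omega)
  set h := |α - α₀| with hh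
  have hh0 : 0 ≤ h := abs_nonneg _
  have hgap := jensen_gap (Finset.Icc 1 J) (fun j => J < 2 * j) (weight X J)
    (logRatio B b α₀ α) w (g := G₀ - fluctuation X G₀ w J) (π := π) (d := h * L) (D₁ := D₁)
    (D := 2 * (J + 1) * H * L) (i := J) (k := J - 3)
    (fun j _ => weight_nonneg J j) (sum_weight hB (by omega)) (fun j _ => hw j) (by linarith)
    (fun j hj hJj => by linarith [(abs_le.1 (abs_sub_le_fluctuation (X := X) G₀ w hj hJj)).1])
    (Finset.mem_Icc.2 ⟨by omega, le_rfl⟩) (by omega) hwJ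
    (Finset.mem_Icc.2 ⟨by omega, by omega⟩) (by omega) hwJ3 (by positivity)
    ?_ ?_ hD₁1 ?_
  · have e1 : (h * L) ^ 2 = L ^ 2 * (α - α₀) ^ 2 := by rw [mul_pow, hh, sq_abs]; ring
    rw [e1] at hgap
    calc (G₀ - fluctuation X G₀ w J) *
          (1 - lowLoss X H J + π * (L ^ 2 / (16 * D₁)) * (α - α₀) ^ 2)
        = (G₀ - fluctuation X G₀ w J) * (1 - (∑ j ∈ Finset.Icc 1 J with ¬ J < 2 * j,
          weight X J j) * (1 + 2 * (J + 1) * H * L) +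
          π * (L ^ 2 * (α - α₀) ^ 2 / (16 * D₁))) := by
          rw [lowLoss, lowWeight]; ring
      _ ≤ _ := hgap
      _ = _ := by
          rw [fitted, Finset.sum_mul]
          refine Finset.sum_congr rfl fun j _ => ?_
          rw [sub_eq_add_neg, Real.exp_add]
          change weight X J j * (Real.exp (logRatio B b α₀ α j) *
            Real.exp (-meanLogRatio X b α₀ J α)) * w j = _
          ring
  · -- each of the two log-ratios is off by at most `|α - α₀| log B`, and `3 - 2 = 1`
    have h1 := hb.abs_logRatio_sub_le hB (hact J (by omega)).1 α₀ α
    have h2 := hb.abs_logRatio_sub_le hB (hact (J - 3) (by omega)).1 α₀ α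
    have h3 : ((J - 3 : ℕ) : ℝ) = J - 3 := by
      rw [Nat.cast_sub (by omega)]; norm_num
    rw [h3] at h2
    rw [abs_le] at h1 h2
    rcases abs_cases (α - α₀) with ⟨h4, -⟩ | ⟨h4, -⟩
    · rw [h4] at h1 h2 hh
      refine le_trans ?_ (le_abs_self _)
      rw [hh]
      linarith
    · rw [h4] at h1 h2 hh
      refine le_trans ?_ (neg_le_abs _)
      rw [hh]
      linarith
  · rw [hD₁]
    have : h * L ≤ H * L := by gcongr
    linarith
  · intro j hj j' hj'
    have hb1 : ∀ i ∈ Finset.Icc 1 J, |logRatio B b α₀ α i| ≤ (J + 1) * H * L := by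
      intro i hi
      refine (hb.abs_logRatio_le hB i α₀ α).trans ?_
      have : (i : ℝ) ≤ J := by exact_mod_cast (Finset.mem_Icc.1 hi).2
      gcongr
    have h1 := hb1 j hj
    have h2 := hb1 j' hj'
    have := abs_sub (logRatio B b α₀ α j) (logRatio B b α₀ α j')
    linarith

end Consistency

/-! ### Consistency for given normalized energies -/

section Consistency

variable {B : ℝ} {X : Cubature B} {b : ℝ → ℝ} {α₀ G₀ : ℝ}

/-- A quadratic separation with constant `a`, fluctuations `o(J⁻²)` and an objective function
exceeding its minimum by `o(J⁻²)` force `J |α - α₀| → 0`, whence the profile estimate at `α`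
is close to `G₀`. -/
lemma exists_forall_close (hB : 1 < B) (hb : IsWindow B b) (hG₀ : 0 < G₀) {H a : ℝ}
    (hH : 0 ≤ H) (ha : 0 < a) {ε : ℝ} (hε : 0 < ε) :
    ∃ ρ : ℝ, 0 < ρ ∧ ∃ J₁ : ℕ, ∀ J, J₁ ≤ J → ∀ w : ℕ → ℝ, (∀ j, 0 ≤ w j) →
      (J : ℝ) ^ 2 * fluctuation X G₀ w J ≤ ρ → ∀ α ρ' : ℝ, 0 ≤ ρ' → (J : ℝ) ^ 2 * ρ' ≤ ρ →
      (1 - fluctuation X G₀ w J / G₀) * (1 - lowLoss X H J + a * (α - α₀) ^ 2) ≤ 1 + ρ' →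
      |α - α₀| < ε ∧ |fitted X b α₀ w J α - G₀| < ε := by
  have hL : 0 < Real.log B := Real.log_pos hB
  set L := Real.log B with hLdef
  set K₀ : ℝ := (3 + 2 / G₀) / a with hK₀
  have hK₀0 : 0 < K₀ := by positivity
  -- the three quantities below bound the errors in terms of `ρ`
  have hev : ∀ᶠ ρ : ℝ in 𝓝[>] 0, √(K₀ * ρ) < ε ∧
      (Real.exp (2 * √(K₀ * ρ) * L) - 1) * (G₀ + ρ) + ρ < ε ∧ ρ < G₀ / 2 := by
    have h1 : Tendsto (fun ρ : ℝ => √(K₀ * ρ)) (𝓝[>] 0) (𝓝 0) := by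
      have : Continuous fun ρ : ℝ => √(K₀ * ρ) := by fun_prop
      simpa using (this.tendsto 0).mono_left nhdsWithin_le_nhds
    have h2 : Tendsto (fun ρ : ℝ => (Real.exp (2 * √(K₀ * ρ) * L) - 1) * (G₀ + ρ) + ρ)
        (𝓝[>] 0) (𝓝 0) := by
      have : Continuous fun ρ : ℝ => (Real.exp (2 * √(K₀ * ρ) * L) - 1) * (G₀ + ρ) + ρ := by
        fun_prop
      simpa using (this.tendsto 0).mono_left nhdsWithin_le_nhds
    have h3 : Tendsto (fun ρ : ℝ => ρ) (𝓝[>] 0) (𝓝 0) := nhdsWithin_le_nhds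
    exact (h1.eventually_lt_const hε).and ((h2.eventually_lt_const hε).and
      (h3.eventually_lt_const (by positivity)))
  obtain ⟨ρ, ⟨hρ1, hρ2, hρ3⟩, hρ0⟩ := (hev.and self_mem_nhdsWithin).exists
  have hρ0' : 0 < ρ := hρ0
  obtain ⟨J₁, hJ₁⟩ := ((tendsto_sq_mul_lowLoss (X := X) hB hH).eventually_le_const
    hρ0').exists_forall_of_atTop
  refine ⟨ρ, hρ0', max 1 J₁, fun J hJ w hw he α ρ' hρ' hJρ' hineq => ?_⟩
  have hJ1 : 1 ≤ J := (le_max_left _ _).trans hJ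
  have hJ1' : (1 : ℝ) ≤ J := by exact_mod_cast hJ1
  have hJsq : (1 : ℝ) ≤ (J : ℝ) ^ 2 := one_le_pow₀ hJ1'
  have hlow := hJ₁ J ((le_max_right _ _).trans hJ)
  have he0 := fluctuation_nonneg (X := X) G₀ w J
  set e := fluctuation X G₀ w J with hedef
  set τ := lowLoss X H J with hτ
  have heρ : e ≤ ρ := by nlinarith
  set u := e / G₀ with hu
  have hu0 : 0 ≤ u := by positivity
  have hu2 : u ≤ 1 / 2 := by
    rw [hu, div_le_iff₀ hG₀]
    linarith
  -- solve the separation inequality for `(α - α₀)²`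
  have h1 : a * (α - α₀) ^ 2 ≤ τ + 2 * (ρ' + u) := by
    by_contra! hcon
    have h2 : (1 - u) * (1 + 2 * (ρ' + u)) < (1 - u) * (1 - τ + a * (α - α₀) ^ 2) := by
      apply mul_lt_mul_of_pos_left _ (by linarith)
      linarith
    nlinarith [mul_nonneg hρ' hu0]
  have h2 : ((J : ℝ) * |α - α₀|) ^ 2 ≤ K₀ * ρ := by
    have h3 : (J : ℝ) ^ 2 * u ≤ ρ / G₀ := by
      rw [hu, mul_div_assoc']
      gcongr
    have h4 : (J : ℝ) ^ 2 * (a * (α - α₀) ^ 2) ≤ (J : ℝ) ^ 2 * (τ + 2 * (ρ' + u)) := by gcongr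
    rw [mul_pow, sq_abs, hK₀, div_mul_eq_mul_div, le_div_iff₀ ha]
    have h5 : (3 + 2 / G₀) * ρ = ρ + 2 * ρ + 2 * (ρ / G₀) := by ring
    rw [h5]
    linarith
  have h3 : (J : ℝ) * |α - α₀| ≤ √(K₀ * ρ) := Real.le_sqrt_of_sq_le h2
  have h4 : |α - α₀| ≤ J * |α - α₀| := le_mul_of_one_le_left (abs_nonneg _) hJ1'
  refine ⟨by linarith, ?_⟩
  have h5 := abs_fitted_sub_le (X := X) hB hb hw J α (α₀ := α₀)
  have h6 := abs_sum_weight_sub_le (X := X) hB G₀ w hJ1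
  rw [← fitted_self (b := b) (α₀ := α₀)] at h6
  set V := fitted X b α₀ w J α₀ with hV
  have h7 : V ≤ G₀ + ρ := by linarith [(abs_le.1 h6).2]
  have h8 : Real.exp ((J + 1) * |α - α₀| * L) ≤ Real.exp (2 * √(K₀ * ρ) * L) := by
    apply Real.exp_le_exp.2
    apply mul_le_mul_of_nonneg_right _ hL.le
    linarith
  have hV0 : 0 ≤ V := by
    rw [hV, fitted_self]
    exact Finset.sum_nonneg fun j _ => mul_nonneg (weight_nonneg _ _) (hw j)
  have h9 : (Real.exp ((J + 1) * |α - α₀| * L) - 1) * V ≤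
      (Real.exp (2 * √(K₀ * ρ) * L) - 1) * (G₀ + ρ) := by
    refine mul_le_mul (by linarith) h7 hV0 ?_
    have : 0 ≤ 2 * √(K₀ * ρ) * L := by positivity
    linarith [Real.one_le_exp this]
  have h10 : |fitted X b α₀ w J α - G₀| ≤ |fitted X b α₀ w J α - V| + |V - G₀| :=
    abs_sub_le _ _ _
  linarith

/-- Consistency of the concentrated form, for given normalized energies `w`. -/
lemma exists_forall_concentrated_close (hB : 1 < B) (hb : IsWindow B b) (hG₀ : 0 < G₀)
    (hα₀ : 0 ≤ α₀) {H : ℝ} (hH : 0 ≤ H) {ε : ℝ} (hε : 0 < ε) :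
    ∃ ρ : ℝ, 0 < ρ ∧ ∃ J₁ : ℕ, ∀ J, J₁ ≤ J → ∀ w : ℕ → ℝ, (∀ j, 0 ≤ w j) →
      (J : ℝ) ^ 2 * fluctuation X G₀ w J ≤ ρ → ∀ α, |α - α₀| ≤ H →
      Real.log (fitted X b α₀ w J α) - meanLogRatio X b α₀ J α ≤
        Real.log (fitted X b α₀ w J α₀) →
      |α - α₀| < ε ∧ |fitted X b α₀ w J α - G₀| < ε := by
  obtain ⟨a, ha, J₀, hsep⟩ := exists_le_fitted_mul_exp (X := X) hB hb hH hα₀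
  obtain ⟨ρ, hρ, J₁, hclose⟩ := exists_forall_close (X := X) (α₀ := α₀) hB hb hG₀ hH ha hε
  obtain ⟨J₂, hJ₂⟩ := ((tendsto_sq_mul_lowLoss (X := X) hB hH).eventually_le_const
    (show (0 : ℝ) < 1 / 2 by norm_num)).exists_forall_of_atTop
  refine ⟨min (min ρ (ρ * G₀)) (G₀ / 2), by positivity, max 1 (max J₀ (max J₁ J₂)),
    fun J hJ w hw he α hα hmin => ?_⟩
  simp only [max_le_iff] at hJ
  obtain ⟨hJ1, hJ0, hJ1', hJ2⟩ := hJ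
  simp only [le_min_iff] at he
  obtain ⟨⟨he1, he2⟩, he3⟩ := he
  have hJr : (1 : ℝ) ≤ J := by exact_mod_cast hJ1
  have hJsq : (1 : ℝ) ≤ (J : ℝ) ^ 2 := one_le_pow₀ hJr
  have he0 := fluctuation_nonneg (X := X) G₀ w J
  have hle : fluctuation X G₀ w J ≤ G₀ / 2 := by nlinarith
  have h1 := hsep J hJ0 G₀ w hw (by linarith) α hα
  have hτ : lowLoss X H J ≤ 1 / 2 := by
    by_contra! hcon
    have := hJ₂ J hJ2
    nlinarith
  set e := fluctuation X G₀ w J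
  set Γ := fitted X b α₀ w J α
  set V := fitted X b α₀ w J α₀ with hV
  have h6 := abs_sum_weight_sub_le (X := X) hB G₀ w hJ1
  rw [← fitted_self (b := b) (α₀ := α₀), ← hV] at h6
  have hVpos : 0 < V := by linarith [(abs_le.1 h6).1]
  have hΓ : 0 < Γ * Real.exp (-meanLogRatio X b α₀ J α) := by
    refine lt_of_lt_of_le (mul_pos (by linarith) ?_) h1
    have : 0 ≤ a * (α - α₀) ^ 2 := by positivity
    linarith
  have hΓ' : 0 < Γ := pos_of_mul_pos_left hΓ (Real.exp_pos _).le
  have h7 : Γ * Real.exp (-meanLogRatio X b α₀ J α) ≤ V := by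
    rw [← Real.log_le_log_iff hΓ hVpos, Real.log_mul hΓ'.ne' (Real.exp_pos _).ne', Real.log_exp]
    linarith
  refine hclose J hJ1' w hw he1 α (e / G₀) (by positivity) ?_ ?_
  · rw [mul_div_assoc', div_le_iff₀ hG₀]
    exact he2
  · have h8 : (G₀ - e) * (1 - lowLoss X H J + a * (α - α₀) ^ 2) ≤ G₀ + e := by
      linarith [(abs_le.1 h6).2]
    have h9 : (1 - e / G₀) * (1 - lowLoss X H J + a * (α - α₀) ^ 2)
        = (G₀ - e) * (1 - lowLoss X H J + a * (α - α₀) ^ 2) / G₀ := by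
      field_simp
    rw [h9, div_le_iff₀ hG₀]
    have h10 : (1 + e / G₀) * G₀ = G₀ + e := by field_simp
    rw [h10]
    exact h8

/-- The excess of the two-parameter objective function over its minimum, with the convex function
`exp t - 1 - t` of `t = log (Γ / G)` split off. -/
lemma exp_sub_add_log_le {Γ G G₀ θ μ q V u κ : ℝ} (hG₀ : 0 < G₀) (hG : 0 < G) (hθ : 0 < θ)
    (hsep : G₀ * θ ≤ Γ * Real.exp (-μ)) (hV : V / G₀ ≤ 1 + u)
    (hq : (1 - q) * (Real.log G - Real.log G₀) ≤ κ)
    (hmin : Γ / G + q * Real.log G - μ ≤ V / G₀ + q * Real.log G₀) :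
    0 < Γ ∧ Real.exp (Real.log Γ - Real.log G) - 1 - (Real.log Γ - Real.log G) + Real.log θ ≤
      u + κ := by
  have hΓ : 0 < Γ := by
    have : 0 < Γ * Real.exp (-μ) := lt_of_lt_of_le (by positivity) hsep
    exact pos_of_mul_pos_left this (Real.exp_pos _).le
  have hlog : Real.log G₀ + Real.log θ ≤ Real.log Γ - μ := by
    have := Real.log_le_log (by positivity) hsep
    rwa [Real.log_mul hG₀.ne' hθ.ne', Real.log_mul hΓ.ne' (Real.exp_pos _).ne', Real.log_exp,
      ← sub_eq_add_neg] at this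
  rw [Real.exp_sub, Real.exp_log hΓ, Real.exp_log hG]
  exact ⟨hΓ, by linarith⟩

lemma one_sub_two_mul_le {u τ s δ : ℝ} (hu : u ≤ δ) (hτ : τ ≤ δ) (hδ : δ ≤ 1) (hs : 0 ≤ s) :
    1 - 2 * δ ≤ (1 - u) * (1 - τ + s) := by
  have h1 : (1 - δ) * (1 - δ) ≤ (1 - u) * (1 - τ + s) :=
    mul_le_mul (by linarith) (by linarith) (by linarith) (by linarith)
  nlinarith [sq_nonneg δ]

/-- As `exp t - 1 - t` is at least of the order of `t²` near `0`, a small value of it forces `t` to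
be small. -/
lemma abs_lt_of_exp_sub_add_log_le {t θ η δ : ℝ} (hη : 0 < η) (hη1 : η ≤ 1) (hδ : δ ≤ 1 / 4)
    (hδη : δ ≤ η ^ 2 / 50) (hθ : 1 - 2 * δ ≤ θ)
    (h : Real.exp t - 1 - t + Real.log θ ≤ 2 * δ) : |t| < η := by
  have hθ0 : 0 < θ := by linarith
  by_contra! hcon
  have h1 := sq_div_le_exp_sub (t := t) (d := 2 * η) (D := 2) (by positivity) (by linarith)
    (by linarith) (by norm_num)
  have hη2 : 0 < η ^ 2 := by positivity
  have h5 : (2 * η) ^ 2 / (16 * 2) = η ^ 2 / 8 := by ring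
  rw [h5] at h1
  have hθlog := Real.one_sub_inv_le_log_of_pos hθ0
  rcases le_total 0 δ with hδ0 | hδ0
  · have h4 : θ⁻¹ ≤ 1 + 4 * δ := by
      rw [inv_le_iff_one_le_mul₀ hθ0]
      nlinarith
    linarith
  · have h4 : θ⁻¹ ≤ 1 := inv_le_one_of_one_le₀ (by linarith)
    linarith

/-- Consistency of the two-parameter form, for given normalized energies `w`. Here `q` is the
share of the active levels; with `v = Γ / G`, the minimization bounds `v - 1 - log v`, which
vanishes only at `v = 1`. -/
lemma exists_forall_objective_close (hB : 1 < B) (hb : IsWindow B b) (hG₀ : 0 < G₀)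
    (hα₀ : 0 ≤ α₀) {H : ℝ} (hH : 0 ≤ H) {γ₁ γ₂ : ℝ} (hγ₁ : 0 < γ₁) (hG₀γ : G₀ ∈ Icc γ₁ γ₂)
    {ε : ℝ} (hε : 0 < ε) :
    ∃ ρ : ℝ, 0 < ρ ∧ ∃ J₁ : ℕ, ∀ J, J₁ ≤ J → ∀ w : ℕ → ℝ, (∀ j, 0 ≤ w j) →
      (J : ℝ) ^ 2 * fluctuation X G₀ w J ≤ ρ → ∀ α, |α - α₀| ≤ H → ∀ G ∈ Icc γ₁ γ₂, ∀ q : ℝ,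
      q ≤ 1 → 1 - q ≤ lowWeight X J →
      fitted X b α₀ w J α / G + q * Real.log G - meanLogRatio X b α₀ J α ≤
        fitted X b α₀ w J α₀ / G₀ + q * Real.log G₀ →
      |α - α₀| < ε ∧ |G - G₀| < ε := by
  have hγ₂ : 0 < γ₂ := hγ₁.trans_le (hG₀γ.1.trans hG₀γ.2)
  set Λ := Real.log γ₂ - Real.log γ₁ with hΛ
  have hΛ0 : 0 ≤ Λ := sub_nonneg.2 (Real.log_le_log hγ₁ (hG₀γ.1.trans hG₀γ.2))
  obtain ⟨a, ha, J₀, hsep⟩ := exists_le_fitted_mul_exp (X := X) hB hb hH hα₀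
  obtain ⟨ρ, hρ, J₁, hclose⟩ := exists_forall_close (X := X) (α₀ := α₀) hB hb hG₀ hH ha
    (half_pos hε)
  obtain ⟨η, hη0, hη1, hηε'⟩ : ∃ η : ℝ, 0 < η ∧ η ≤ 1 ∧ η ≤ ε / (4 * γ₂) :=
    ⟨min 1 (ε / (4 * γ₂)), by positivity, min_le_left _ _, min_le_right _ _⟩
  have hηε : η * (4 * γ₂) ≤ ε := by
    rwa [le_div_iff₀ (by positivity)] at hηε'
  obtain ⟨δ, hδ0, hδρ, hδ4, hδη⟩ : ∃ δ : ℝ, 0 < δ ∧ δ ≤ ρ / 4 ∧ δ ≤ 1 / 4 ∧ δ ≤ η ^ 2 / 50 :=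
    ⟨min (min (ρ / 4) (1 / 4)) (η ^ 2 / 50), by positivity,
      (min_le_left _ _).trans (min_le_left _ _), (min_le_left _ _).trans (min_le_right _ _),
      min_le_right _ _⟩
  obtain ⟨J₂, hJ₂⟩ := ((tendsto_sq_mul_lowLoss (X := X) hB hH).eventually_le_const
    hδ0).exists_forall_of_atTop
  have htw : Tendsto (fun J : ℕ => (J : ℝ) ^ 2 * lowWeight X J * Λ) atTop (𝓝 0) := by
    simpa using (tendsto_sq_mul_lowWeight (X := X) hB).mul_const Λ
  obtain ⟨J₃, hJ₃⟩ := (htw.eventually_le_const hδ0).exists_forall_of_atTop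
  refine ⟨min ρ (δ * G₀), by positivity, max 1 (max J₀ (max J₁ (max J₂ J₃))),
    fun J hJ w hw he α hα G hG q hq hq' hmin => ?_⟩
  simp only [max_le_iff] at hJ
  obtain ⟨hJ1, hJ0, hJ1', hJ2, hJ3⟩ := hJ
  simp only [le_min_iff] at he
  obtain ⟨he1, he2⟩ := he
  have hJr : (1 : ℝ) ≤ J := by exact_mod_cast hJ1
  have hJsq : (1 : ℝ) ≤ (J : ℝ) ^ 2 := one_le_pow₀ hJr
  have he0 := fluctuation_nonneg (X := X) G₀ w J
  set e := fluctuation X G₀ w J with hedef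
  set u := e / G₀ with hu
  have hu0 : 0 ≤ u := by positivity
  have hJu : (J : ℝ) ^ 2 * u ≤ δ := by
    rw [hu, mul_div_assoc', div_le_iff₀ hG₀]
    exact he2
  have huδ : u ≤ δ := le_trans (le_mul_of_one_le_left hu0 hJsq) hJu
  have hL : 0 < Real.log B := Real.log_pos hB
  have hlow0 := lowWeight_nonneg (X := X) J
  have hτ0 : 0 ≤ lowLoss X H J := by
    rw [lowLoss]
    positivity
  have hτδ : lowLoss X H J ≤ δ := le_trans (le_mul_of_one_le_left hτ0 hJsq) (hJ₂ J hJ2)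
  have hJΛ : (J : ℝ) ^ 2 * (lowWeight X J * Λ) ≤ δ := by
    rw [← mul_assoc]
    exact hJ₃ J hJ3
  have hΛδ : lowWeight X J * Λ ≤ δ :=
    le_trans (le_mul_of_one_le_left (by positivity) hJsq) hJΛ
  have heG : e = u * G₀ := by rw [hu]; field_simp
  have hsepJ := hsep J hJ0 G₀ w hw (by rw [← hedef, heG]; nlinarith) α hα
  rw [← hedef] at hsepJ
  set τ := lowLoss X H J with hτ
  set Γ := fitted X b α₀ w J α with hΓdef
  set V := fitted X b α₀ w J α₀ with hV
  set μ := meanLogRatio X b α₀ J α with hμ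
  have h6 := abs_sum_weight_sub_le (X := X) hB G₀ w hJ1
  rw [← fitted_self (b := b) (α₀ := α₀), ← hV, ← hedef] at h6
  have hVle : V / G₀ ≤ 1 + u := by
    rw [div_le_iff₀ hG₀, add_mul, ← heG]
    linarith [(abs_le.1 h6).2]
  have hG0 : 0 < G := hγ₁.trans_le hG.1
  set θ := (1 - u) * (1 - τ + a * (α - α₀) ^ 2) with hθ
  have hsq0 : 0 ≤ a * (α - α₀) ^ 2 := by positivity
  have hθge : 1 - 2 * δ ≤ θ := by
    exact one_sub_two_mul_le huδ hτδ (by linarith) hsq0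
  have hθ0 : 0 < θ := by linarith
  have hsep' : G₀ * θ ≤ Γ * Real.exp (-μ) := by
    refine le_trans (le_of_eq ?_) hsepJ
    rw [hθ, heG]
    ring
  have hlogG : Real.log G - Real.log G₀ ≤ Λ := by
    have h1 := Real.log_le_log hG0 hG.2
    have h2 := Real.log_le_log hγ₁ hG₀γ.1
    rw [hΛ]; linarith
  have hqΛ : (1 - q) * (Real.log G - Real.log G₀) ≤ lowWeight X J * Λ := by
    calc (1 - q) * (Real.log G - Real.log G₀) ≤ (1 - q) * Λ := by
          apply mul_le_mul_of_nonneg_left hlogG (by linarith)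
      _ ≤ _ := by gcongr
  obtain ⟨hΓ0, hkey⟩ := exp_sub_add_log_le hG₀ hG0 hθ0 hsep' hVle hqΛ hmin
  set t := Real.log Γ - Real.log G with ht
  have hexpt : Real.exp t = Γ / G := by
    rw [ht, Real.exp_sub, Real.exp_log hΓ0, Real.exp_log hG0]
  set err := u + lowWeight X J * Λ with herr
  have herr0 : 0 ≤ err := by positivity
  have herrδ : err ≤ 2 * δ := by linarith
  have hconv : 0 ≤ Real.exp t - 1 - t := by linarith [Real.add_one_le_exp t]
  have hθle : θ ≤ 1 + 2 * err := by
    have h1 : θ ≤ Real.exp err := (Real.log_le_iff_le_exp hθ0).1 (by linarith)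
    have h2 := Real.abs_exp_sub_one_le (x := err) (by rw [abs_of_nonneg herr0]; linarith)
    rw [abs_of_nonneg herr0] at h2
    linarith [(abs_le.1 h2).2]
  obtain ⟨hα', hΓ'⟩ := hclose J hJ1' w hw he1 α (2 * err) (by positivity)
    (by rw [herr]; linarith) hθle
  refine ⟨by linarith, ?_⟩
  have htη : |t| < η := abs_lt_of_exp_sub_add_log_le hη0 hη1 hδ4 hδη hθge (by linarith)
  have hGΓ : |G - Γ| ≤ γ₂ * (2 * η) := by
    have h1 : G - Γ = -(G * (Real.exp t - 1)) := by
      rw [hexpt]; field_simp; ring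
    rw [h1, abs_neg, abs_mul, abs_of_pos hG0]
    have h2 := Real.abs_exp_sub_one_le (x := t) (by linarith)
    exact mul_le_mul hG.2 (by linarith) (abs_nonneg _) hγ₂.le
  have h10 : |G - G₀| ≤ |G - Γ| + |Γ - G₀| := abs_sub_le _ _ _
  linarith

end Consistency

/-! ### The objective functions in terms of the normalized energies -/

section Formulas

variable {B : ℝ} {X : Cubature B} {b : ℝ → ℝ} {α₀ : ℝ} {Ω : Type*} {T : S2 → Ω → ℝ}
  {Y : (l : ℕ) → Fin (2 * l + 1) → S2 → ℝ}

lemma normEnergy_nonneg (j : ℕ) (ω : Ω) : 0 ≤ normEnergy B b Y T α₀ j ω :=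
  div_nonneg (Finset.sum_nonneg fun _ _ => mul_nonneg (sq_nonneg _)
    (Finset.sum_nonneg fun _ _ => sq_nonneg _)) (bandSum_nonneg j α₀)

lemma IsWindow.log_K (hB : 1 < B) (hb : IsWindow B b) (X : Cubature B) (j : ℕ) (α₀ α : ℝ) :
    Real.log (K b X j α) = Real.log (K b X j α₀) - logRatio B b α₀ α j := by
  rw [K_eq, K_eq, logRatio]
  by_cases h : IsActive B b j
  · have h1 := (hb.bandSum_pos hB h α).ne'
    have h2 := (hb.bandSum_pos hB h α₀).ne'
    have h3 := (inv_pos.2 (N_pos (X := X) hB j)).ne'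
    rw [Real.log_mul h3 h1, Real.log_mul h3 h2, Real.log_div h2 h1]
    ring
  · simp [bandSum_eq_zero h]

lemma IsWindow.energy_div_K (hB : 1 < B) (hb : IsWindow B b) (j : ℕ) (α₀ α : ℝ) (ω : Ω) :
    energy B b Y T j ω / K b X j α =
      X.N j * (Real.exp (logRatio B b α₀ α j) * normEnergy B b Y T α₀ j ω) := by
  rw [normEnergy]
  by_cases h : IsActive B b j
  · have h1 := hb.bandSum_pos hB h α
    have h2 := hb.bandSum_pos hB h α₀
    have h3 := N_pos (X := X) hB j
    rw [logRatio, Real.exp_log (by positivity), K_eq]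
    field_simp
  · simp [energy_eq_zero h]

lemma sum_div_total (s : Finset ℕ) (J : ℕ) (f : ℕ → ℝ) :
    (total X J)⁻¹ * ∑ j ∈ s, X.N j * f j = ∑ j ∈ s, weight X J j * f j := by
  rw [Finset.mul_sum]
  exact Finset.sum_congr rfl fun j _ => by rw [weight, div_eq_mul_inv]; ring

lemma sum_eq_total_mul (hB : 1 < B) (s : Finset ℕ) {J : ℕ} (hJ : 1 ≤ J) (f : ℕ → ℝ) :
    ∑ j ∈ s, X.N j * f j = total X J * ∑ j ∈ s, weight X J j * f j := by
  rw [← sum_div_total, mul_inv_cancel_left₀ (total_pos hB hJ).ne']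

lemma IsWindow.sum_energy_div_K (hB : 1 < B) (hb : IsWindow B b) {J : ℕ} (hJ : 1 ≤ J)
    (α₀ α : ℝ) (ω : Ω) :
    ∑ j ∈ Finset.Icc 1 J, energy B b Y T j ω / K b X j α =
      total X J * fitted X b α₀ (fun j => normEnergy B b Y T α₀ j ω) J α := by
  simp only [hb.energy_div_K hB _ α₀ α ω]
  rw [sum_eq_total_mul hB _ hJ, fitted]
  simp only [mul_assoc]

lemma fitted_pos {w : ℕ → ℝ} (hw : ∀ j, 0 ≤ w j) {J : ℕ} (h : 0 < fitted X b α₀ w J α₀)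
    (α : ℝ) : 0 < fitted X b α₀ w J α := by
  rw [fitted_self] at h
  obtain ⟨j, hj, hpos⟩ := Finset.exists_lt_of_sum_lt
    (show ∑ _j ∈ Finset.Icc 1 J, (0 : ℝ) < ∑ j ∈ Finset.Icc 1 J, weight X J j * w j by simpa)
  have hnn : ∀ j ∈ Finset.Icc 1 J,
      0 ≤ weight X J j * Real.exp (logRatio B b α₀ α j) * w j := fun j _ =>
    mul_nonneg (mul_nonneg (weight_nonneg J j) (Real.exp_pos _).le) (hw j)
  refine Finset.sum_pos' hnn ⟨j, hj, ?_⟩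
  rw [mul_right_comm]
  exact mul_pos hpos (Real.exp_pos _)

lemma profileG_eq_fitted (hB : 1 < B) (hb : IsWindow B b) (hY : IsHarmonicBasis Y) {J : ℕ}
    (hJ : 1 ≤ J) {ω : Ω} (hω : Integrable (fun x => T x ω) surf) (α₀ α : ℝ) :
    profileG b X (fun j k => needletCoeff b Y X T j k ω) J α =
      fitted X b α₀ (fun j => normEnergy B b Y T α₀ j ω) J α := by
  rw [profileG]
  simp only [hY.sum_needletCoeff_sq X _ hω]
  rw [hb.sum_energy_div_K hB hJ α₀, inv_mul_cancel_left₀ (total_pos hB hJ).ne']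

lemma concentrated_eq (hB : 1 < B) (hb : IsWindow B b) (hY : IsHarmonicBasis Y) {J : ℕ}
    (hJ : 1 ≤ J) {ω : Ω} (hω : Integrable (fun x => T x ω) surf) (α₀ α : ℝ) :
    concentrated b X (fun j k => needletCoeff b Y X T j k ω) J α =
      Real.log (total X J * fitted X b α₀ (fun j => normEnergy B b Y T α₀ j ω) J α) +
        (∑ j ∈ Finset.Icc 1 J, weight X J j * Real.log (K b X j α₀) -
          meanLogRatio X b α₀ J α) := by
  rw [concentrated]
  simp only [hY.sum_needletCoeff_sq X _ hω]
  rw [hb.sum_energy_div_K hB hJ α₀, sum_div_total, meanLogRatio, ← Finset.sum_sub_distrib]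
  simp only [hb.log_K hB X _ α₀ α, mul_sub]

open Classical in
/-- The share of the active levels. -/
noncomputable def activeWeight (X : Cubature B) (b : ℝ → ℝ) (J : ℕ) : ℝ :=
  ∑ j ∈ Finset.Icc 1 J with IsActive B b j, weight X J j

lemma activeWeight_le_one (hB : 1 < B) {J : ℕ} (hJ : 1 ≤ J) : activeWeight X b J ≤ 1 := by
  classical
  rw [← sum_weight (X := X) hB hJ, activeWeight]
  exact Finset.sum_le_sum_of_subset_of_nonneg (Finset.filter_subset _ _)
    fun j _ _ => weight_nonneg J j

lemma one_sub_activeWeight_le (hB : 1 < B) {J j₀ : ℕ} (hJ : 1 ≤ J) (hJ0 : 2 * j₀ ≤ J)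
    (hact : ∀ j, j₀ ≤ j → IsActive B b j) : 1 - activeWeight X b J ≤ lowWeight X J := by
  classical
  have h := Finset.sum_filter_add_sum_filter_not (Finset.Icc 1 J) (IsActive B b) (weight X J)
  rw [sum_weight hB hJ] at h
  have h1 : 1 - activeWeight X b J = ∑ j ∈ Finset.Icc 1 J with ¬ IsActive B b j, weight X J j := by
    rw [← h, activeWeight]
    ring
  rw [h1, lowWeight]
  refine Finset.sum_le_sum_of_subset_of_nonneg (fun j hj => ?_) fun j _ _ => weight_nonneg J j
  rw [Finset.mem_filter] at hj ⊢
  refine ⟨hj.1, fun hlt => hj.2 (hact j (by omega))⟩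

open Classical in
/-- The two-parameter objective function, up to a term that depends on neither parameter. The
coefficients at active levels must not vanish, because `Real.log 0 = 0`. -/
lemma objective_eq (hB : 1 < B) (hb : IsWindow B b) (hY : IsHarmonicBasis Y) {J : ℕ}
    (hJ : 1 ≤ J) {ω : Ω} (hω : Integrable (fun x => T x ω) surf)
    (hne : ∀ j, IsActive B b j → ∀ k, needletCoeff b Y X T j k ω ≠ 0) (α₀ α : ℝ) {G : ℝ}
    (hG : 0 < G) :
    objective b X (fun j k => needletCoeff b Y X T j k ω) J α G =
      total X J * (fitted X b α₀ (fun j => normEnergy B b Y T α₀ j ω) J α / G +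
        activeWeight X b J * Real.log G - meanLogRatio X b α₀ J α) +
      ∑ j ∈ Finset.Icc 1 J with IsActive B b j, (X.N j * Real.log (K b X j α₀) -
        ∑ k, Real.log (needletCoeff b Y X T j k ω ^ 2)) := by
  have hlog : ∀ j, ∑ k, Real.log (needletCoeff b Y X T j k ω ^ 2 / (G * K b X j α)) =
      X.N j * logRatio B b α₀ α j - if IsActive B b j then X.N j * Real.log G +
        (X.N j * Real.log (K b X j α₀) - ∑ k, Real.log (needletCoeff b Y X T j k ω ^ 2))
        else 0 := by
    intro j
    by_cases h : IsActive B b j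
    · have hK : K b X j α ≠ 0 := by
        rw [K_eq]
        exact mul_ne_zero (inv_pos.2 (N_pos (X := X) hB j)).ne' (hb.bandSum_pos hB h α).ne'
      have h1 : ∀ k, Real.log (needletCoeff b Y X T j k ω ^ 2 / (G * K b X j α)) =
          Real.log (needletCoeff b Y X T j k ω ^ 2) -
            (Real.log G + (Real.log (K b X j α₀) - logRatio B b α₀ α j)) := fun k => by
        rw [Real.log_div (pow_ne_zero 2 (hne j h k)) (mul_ne_zero hG.ne' hK),
          Real.log_mul hG.ne' hK, hb.log_K hB X j α₀ α]
      simp only [h1, Finset.sum_sub_distrib, Finset.sum_const, Finset.card_univ,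
        Fintype.card_fin, nsmul_eq_mul, if_pos h]
      ring
    · simp [K_eq, bandSum_eq_zero h, if_neg h, logRatio]
  have hterm : ∀ j, (∑ k, needletCoeff b Y X T j k ω ^ 2) / (G * K b X j α) =
      energy B b Y T j ω / K b X j α / G := fun j => by
    rw [hY.sum_needletCoeff_sq X j hω, mul_comm, div_div]
  rw [objective]
  simp only [hlog, hterm]
  rw [Finset.sum_sub_distrib, Finset.sum_sub_distrib, ← Finset.sum_div,
    hb.sum_energy_div_K hB hJ α₀, sum_eq_total_mul hB _ hJ, ← Finset.sum_filter,
    Finset.sum_add_distrib, sum_eq_total_mul hB _ hJ, ← Finset.sum_mul, meanLogRatio, activeWeight]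
  ring

end Formulas

/-! ### Convergence in probability -/

section Probability

variable {Ω : Type*} [MeasurableSpace Ω] {P : Measure Ω} [IsProbabilityMeasure P]
  {B : ℝ} {X : Cubature B} {b : ℝ → ℝ} {T : S2 → Ω → ℝ}
  {Y : (l : ℕ) → Fin (2 * l + 1) → S2 → ℝ} {C : ℕ → ℝ} {α₀ G₀ : ℝ} {G : ℝ → ℝ}

/-- The fluctuations are `o(J⁻²)` in probability, being geometrically small in mean. -/
lemma IsIsotropicGaussianField.tendsto_measure_fluctuation (hT : IsIsotropicGaussianField P T)
    (hB : 1 < B) (hb : IsWindow B b) (hY : IsHarmonicBasis Y)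
    (hC : HasAngularPowerSpectrum P Y T C) (hreg : IsRegularSpectrum C α₀ G₀ G)
    {ρ : ℝ} (hρ : 0 < ρ) :
    Tendsto (fun J : ℕ => P.real {ω | ρ ≤ (J : ℝ) ^ 2 *
      fluctuation X G₀ (fun j => normEnergy B b Y T α₀ j ω) J}) atTop (𝓝 0) := by
  obtain ⟨D, r, hD, hr0, hr1, hW⟩ := hT.exists_integral_abs_normEnergy_sub_le hB hb hY hC hreg
  have hint : ∀ j, Integrable (fun ω => |normEnergy B b Y T α₀ j ω - G₀|) P := fun j =>
    (((hT.memLp_normEnergy hY B b α₀ j).integrable (by norm_num)).sub (integrable_const G₀)).abs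
  have hintA : ∀ J : ℕ, Integrable
      (fun ω => ∑ j ∈ Finset.Icc 1 J with J < 2 * j, |normEnergy B b Y T α₀ j ω - G₀|) P :=
    fun J => integrable_finsetSum _ fun j _ => hint j
  have hintB : ∀ J : ℕ, Integrable (fun ω => ∑ j ∈ Finset.Icc 1 J with ¬ J < 2 * j,
      weight X J j * |normEnergy B b Y T α₀ j ω - G₀|) P :=
    fun J => integrable_finsetSum _ fun j _ => (hint j).const_mul _
  have hmean : ∀ J : ℕ, ∫ ω, fluctuation X G₀ (fun j => normEnergy B b Y T α₀ j ω) J ∂P ≤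
      D * (J * r ^ J) + D * lowWeight X J := by
    intro J
    simp only [fluctuation]
    rw [integral_add (hintA J) (hintB J)]
    refine add_le_add ?_ ?_
    · rw [integral_finsetSum _ fun j _ => hint j]
      calc ∑ j ∈ Finset.Icc 1 J with J < 2 * j, ∫ ω, |normEnergy B b Y T α₀ j ω - G₀| ∂P
          ≤ ∑ _j ∈ Finset.Icc 1 J with J < 2 * _j, D * r ^ J := by
            refine Finset.sum_le_sum fun j hj => (hW j).trans ?_
            refine mul_le_mul_of_nonneg_left ?_ hD.le
            exact pow_le_pow_of_le_one hr0.le hr1.le (Finset.mem_filter.1 hj).2.le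
        _ ≤ J * (D * r ^ J) := by
            rw [Finset.sum_const, nsmul_eq_mul]
            gcongr
            calc _ ≤ (Finset.Icc 1 J).card := Finset.card_filter_le _ _
              _ = J := by simp
        _ = _ := by ring
    · rw [integral_finsetSum _ fun j _ => (hint j).const_mul _, lowWeight, Finset.mul_sum]
      refine Finset.sum_le_sum fun j _ => ?_
      rw [integral_const_mul, mul_comm]
      refine mul_le_mul_of_nonneg_right ((hW j).trans ?_) (weight_nonneg J j)
      exact mul_le_of_le_one_right hD.le (pow_le_one₀ hr0.le hr1.le)
  have hlim : Tendsto (fun J : ℕ => ρ⁻¹ * (D * ((J : ℝ) ^ 3 * r ^ J) +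
      D * ((J : ℝ) ^ 2 * lowWeight X J))) atTop (𝓝 0) := by
    have h1 := tendsto_pow_const_mul_const_pow_of_abs_lt_one 3 (r := r)
      (by rwa [abs_of_pos hr0])
    have h2 := tendsto_sq_mul_lowWeight (X := X) hB
    simpa using ((h1.const_mul D).add (h2.const_mul D)).const_mul ρ⁻¹
  refine squeeze_zero (fun J => measureReal_nonneg) (fun J => ?_) hlim
  have hmarkov := mul_meas_ge_le_integral_of_nonneg (μ := P)
    (f := fun ω => (J : ℝ) ^ 2 * fluctuation X G₀ (fun j => normEnergy B b Y T α₀ j ω) J)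
    (ae_of_all _ fun ω => mul_nonneg (sq_nonneg _) (fluctuation_nonneg _ _ _))
    (((hintA J).add (hintB J)).const_mul _) ρ
  rw [le_inv_mul_iff₀ hρ]
  refine hmarkov.trans ?_
  rw [integral_const_mul]
  calc (J : ℝ) ^ 2 * ∫ ω, fluctuation X G₀ (fun j => normEnergy B b Y T α₀ j ω) J ∂P
      ≤ (J : ℝ) ^ 2 * (D * (J * r ^ J) + D * lowWeight X J) := by
        have := hmean J
        gcongr
    _ = _ := by ring

/-- An estimator that is close to its target whenever the fluctuations are `o(J⁻²)` is
consistent. No measurability of the estimator is needed. -/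
lemma IsIsotropicGaussianField.tendstoInMeasure_of_fluctuation
    (hT : IsIsotropicGaussianField P T) (hB : 1 < B) (hb : IsWindow B b) (hY : IsHarmonicBasis Y)
    (hC : HasAngularPowerSpectrum P Y T C) (hreg : IsRegularSpectrum C α₀ G₀ G)
    {f : ℕ → Ω → ℝ × ℝ} {z : ℝ × ℝ}
    (h : ∀ ε : ℝ, 0 < ε → ∃ ρ : ℝ, 0 < ρ ∧ ∃ J₁ : ℕ, ∀ J, J₁ ≤ J → ∀ᵐ ω ∂P,
      (J : ℝ) ^ 2 * fluctuation X G₀ (fun j => normEnergy B b Y T α₀ j ω) J ≤ ρ →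
      dist (f J ω) z < ε) :
    TendstoInMeasure P f atTop fun _ => z := by
  rw [tendstoInMeasure_iff_measureReal_dist]
  intro ε hε
  obtain ⟨ρ, hρ, J₁, hJ₁⟩ := h ε hε
  have hlim := hT.tendsto_measure_fluctuation (X := X) hB hb hY hC hreg hρ
  refine tendsto_of_tendsto_of_tendsto_of_le_of_le' tendsto_const_nhds hlim
    (Eventually.of_forall fun J => measureReal_nonneg) ?_
  filter_upwards [eventually_ge_atTop J₁] with J hJ
  refine ENNReal.toReal_mono (measure_ne_top _ _) (measure_mono_ae ?_)
  filter_upwards [hJ₁ J hJ] with ω hω hdist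
  by_contra hlt
  have hlt' := lt_of_not_ge hlt
  exact absurd (hω hlt'.le) (not_lt.2 hdist)

end Probability

end Needlet

open Needlet in
theorem theorem1 {Ω : Type*} [MeasurableSpace Ω] (P : Measure Ω) [IsProbabilityMeasure P]
    (B : ℝ) (hB : 1 < B) (b : ℝ → ℝ) (hb : Needlet.IsWindow B b)
    (Y : (l : ℕ) → Fin (2 * l + 1) → Needlet.S2 → ℝ) (hY : Needlet.IsHarmonicBasis Y)
    (X : Needlet.Cubature B)
    (T : Needlet.S2 → Ω → ℝ) (hT : Needlet.IsIsotropicGaussianField P T)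
    (C : ℕ → ℝ) (hC : Needlet.HasAngularPowerSpectrum P Y T C)
    (α₀ G₀ : ℝ) (G : ℝ → ℝ) (hreg : Needlet.IsRegularSpectrum C α₀ G₀ G)
    (a₁ a₂ γ₁ γ₂ : ℝ) (ha₁ : 2 < a₁) (ha : a₁ < a₂) (hγ₁ : 0 < γ₁) (hγ : γ₁ < γ₂)
    (hα₀ : α₀ ∈ Icc a₁ a₂) (hG₀ : G₀ ∈ Icc γ₁ γ₂) :
    -- every minimizer of the objective function over `[a₁, a₂] × [γ₁, γ₂]` is consistent
    (∀ αhat Ghat : ℕ → Ω → ℝ,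
      (∀ J : ℕ, 1 ≤ J → ∀ᵐ ω ∂P, (αhat J ω, Ghat J ω) ∈ Icc a₁ a₂ ×ˢ Icc γ₁ γ₂ ∧
        IsMinOn (fun q : ℝ × ℝ => Needlet.objective b X
            (fun j k => Needlet.needletCoeff b Y X T j k ω) J q.1 q.2)
          (Icc a₁ a₂ ×ˢ Icc γ₁ γ₂) (αhat J ω, Ghat J ω)) →
      TendstoInMeasure P (fun J ω => (αhat J ω, Ghat J ω)) atTop (fun _ => (α₀, G₀))) ∧
    -- so is every minimizer of the concentrated objective function, with `Ĝ = Ĝ(α̂)`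
    (∀ αhat : ℕ → Ω → ℝ,
      (∀ J : ℕ, 1 ≤ J → ∀ᵐ ω ∂P, αhat J ω ∈ Icc a₁ a₂ ∧
        IsMinOn (Needlet.concentrated b X
            (fun j k => Needlet.needletCoeff b Y X T j k ω) J) (Icc a₁ a₂) (αhat J ω)) →
      TendstoInMeasure P
        (fun J ω => (αhat J ω, Needlet.profileG b X
          (fun j k => Needlet.needletCoeff b Y X T j k ω) J (αhat J ω)))
        atTop (fun _ => (α₀, G₀))) := by
  have hα₀' : 0 ≤ α₀ := by linarith [hreg.two_lt]
  have hG₀' := hreg.G₀_pos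
  have hH : 0 ≤ a₂ - a₁ := by linarith
  have habs : ∀ α ∈ Icc a₁ a₂, |α - α₀| ≤ a₂ - a₁ := fun α hα =>
    abs_sub_le_of_le_of_le hα.1 hα.2 hα₀.1 hα₀.2
  obtain ⟨_, -, j₀, hact⟩ := hb.exists_bandSum_ge hB α₀ hα₀'
  -- active levels have positive variance, so the coefficients there avoid `Real.log 0 = 0`
  have hne : ∀ᵐ ω ∂P, ∀ j, IsActive B b j → ∀ k, needletCoeff b Y X T j k ω ≠ 0 := by
    rw [ae_all_iff]
    intro j
    by_cases hj : IsActive B b j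
    · obtain ⟨l, hl, hbl⟩ := id hj
      have hl1 := hb.one_le hB hbl
      have hCl : 0 < C l := by
        obtain ⟨c₀, hc₀, hG⟩ := hreg.bounded
        have h1 : 0 < G l := lt_of_lt_of_le (by positivity) (hG l hl1).1
        have h2 : (0 : ℝ) < l := by exact_mod_cast hl1
        rw [hreg.spectrum l hl1]
        positivity
      filter_upwards [ae_all_iff.2 fun k => hT.ae_needletCoeff_ne_zero hY hC X hl hbl hCl k]
        with ω hω _ using hω
    · exact ae_of_all _ fun ω h => absurd h hj
  constructor
  · intro αhat Ghat hmin
    refine hT.tendstoInMeasure_of_fluctuation (X := X) hB hb hY hC hreg fun ε hε => ?_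
    obtain ⟨ρ, hρ, J₁, hclose⟩ := exists_forall_objective_close (X := X) hB hb hG₀' hα₀' hH hγ₁
      hG₀ hε
    refine ⟨ρ, hρ, max (max 1 (2 * j₀)) J₁, fun J hJ => ?_⟩
    simp only [max_le_iff] at hJ
    filter_upwards [hmin J hJ.1.1, hT.ae_integrable, hne] with ω hω hint hneω hfl
    obtain ⟨hmem, hminω⟩ := hω
    have hGpos : 0 < Ghat J ω := hγ₁.trans_le hmem.2.1
    have h1 := isMinOn_iff.1 hminω (α₀, G₀) ⟨hα₀, hG₀⟩
    simp only at h1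
    rw [objective_eq hB hb hY hJ.1.1 hint hneω α₀ _ hGpos,
      objective_eq hB hb hY hJ.1.1 hint hneω α₀ _ hG₀', add_le_add_iff_right,
      mul_le_mul_iff_right₀ (total_pos hB hJ.1.1), meanLogRatio_self, sub_zero] at h1
    have h2 := hclose J hJ.2 _ (fun j => normEnergy_nonneg j ω) hfl (αhat J ω)
      (habs _ hmem.1) (Ghat J ω) hmem.2 _ (activeWeight_le_one hB hJ.1.1)
      (one_sub_activeWeight_le hB hJ.1.1 hJ.1.2 fun j hj => (hact j hj).1) h1
    rw [Prod.dist_eq, Real.dist_eq, Real.dist_eq]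
    exact max_lt h2.1 h2.2
  · intro αhat hmin
    refine hT.tendstoInMeasure_of_fluctuation (X := X) hB hb hY hC hreg fun ε hε => ?_
    obtain ⟨ρ, hρ, J₁, hclose⟩ := exists_forall_concentrated_close (X := X) hB hb hG₀' hα₀' hH hε
    refine ⟨min ρ (G₀ / 2), by positivity, max 1 J₁, fun J hJ => ?_⟩
    obtain ⟨hJ1, hJ2⟩ := max_le_iff.1 hJ
    filter_upwards [hmin J hJ1, hT.ae_integrable] with ω hω hint hfl
    obtain ⟨hmem, hminω⟩ := hω
    obtain ⟨hfl1, hfl2⟩ := le_min_iff.1 hfl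
    have hw : ∀ j, 0 ≤ normEnergy B b Y T α₀ j ω := fun j => normEnergy_nonneg j ω
    -- both logarithms have positive arguments, so no value `Real.log 0 = 0` interferes
    have hV : 0 < fitted X b α₀ (fun j => normEnergy B b Y T α₀ j ω) J α₀ := by
      have hJsq : (1 : ℝ) ≤ (J : ℝ) ^ 2 := one_le_pow₀ (by exact_mod_cast hJ1)
      have h1 := le_mul_of_one_le_left
        (fluctuation_nonneg (X := X) G₀ (fun j => normEnergy B b Y T α₀ j ω) J) hJsq
      have h2 := abs_sum_weight_sub_le (X := X) hB G₀ (fun j => normEnergy B b Y T α₀ j ω) hJ1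
      rw [fitted_self]
      linarith [(abs_le.1 h2).1]
    have h1 := isMinOn_iff.1 hminω α₀ hα₀
    rw [concentrated_eq hB hb hY hJ1 hint α₀, concentrated_eq hB hb hY hJ1 hint α₀,
      Real.log_mul (total_pos hB hJ1).ne' hV.ne',
      Real.log_mul (total_pos hB hJ1).ne' (fitted_pos hw hV _).ne', meanLogRatio_self] at h1
    have h2 := hclose J hJ2 _ hw hfl1 (αhat J ω) (habs _ hmem) (by linarith)
    rw [profileG_eq_fitted hB hb hY hJ1 hint α₀, Prod.dist_eq, Real.dist_eq, Real.dist_eq]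
    exact max_lt h2.1 h2.2
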